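/- Let $\Bbbk$ be an algebraically closed field of characteristic $0$, $\Gamma$ a finite abelian group, $g_1,g_2,g_3\in\Gamma$, $\chi_1,\chi_2,\chi_3\in\widehat\Gamma$, and $q_{ij}=\chi_j(g_i)$. Assume that $q_{ij}q_{ji}=q_{ii}^{a_{ij}}$ for all $i,j$, where $(a_{ij})=\begin{pmatrix}2&-1&0\\-1&2&-1\\0&-2&2\end{pmatrix}$ is the Cartan matrix of type $B_3$, and that the order $N$ of $q_{33}$ is odd and $N>5$. Let $V$ be the Yetter-Drinfeld module over $\Bbbk\Gamma$ with basis $x_1,x_2,x_3$, where $x_i$ has degree $g_i$ and $h\cdot x_i=\chi_i(h)x_i$ for $h\in\Gamma$, and let $\mathfrak B(V)$ be its Nichols algebra. Let $A$ be a Hopf algebra over $\Bbbk$ with a fixed isomorphism of graded Hopf algebras $\operatorname{gr}A\simeq \mathfrak B(V)\#\Bbbk\Gamma$, where $\operatorname{gr}A$ is taken with respect to the coradical filtration $(A_n)_{n\ge0}$; identify $A_0=\Bbbk\Gamma$. Let $y_1,y_2,y_3\in A_1$ have classes $x_1,x_2,x_3$ in degree one and satisfy $\Delta(y_i)=y_i\otimes1+g_i\otimes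 y_i$ and $hy_ih^{-1}=\chi_i(h)y_i$ for $h\in\Gamma$. For the positive roots, indexed by $1,\ 2,\ 3$ (the simple roots $\alpha_1,\alpha_2,\alpha_3$), $21=\alpha_1+\alpha_2$, $32=\alpha_2+\alpha_3$, $31=\alpha_1+\alpha_2+\alpha_3$, $\tilde32=\alpha_2+2\alpha_3$, $\tilde31=\alpha_1+\alpha_2+2\alpha_3$, $\tilde21=\alpha_1+2\alpha_2+2\alpha_3$, put $g_\alpha=\prod_i g_i^{n_i}$ and $\chi_\alpha=\prod_i\chi_i^{n_i}$ if $\alpha=\sum_i n_i\alpha_i$. For $a,b\in A$ attached to roots $\alpha,\beta$ let $[a,b]_c=ab-\chi_\beta(g_\alpha)ba$, and define $$y_{21}=[y_2,y_1]_c,\quad y_{32}=[y_3,y_2]_c,\quad y_{31}=[y_3,y_{21}]_c,\quad y_{\tilde32}=[y_3,y_{32}]_c,\quad y_{\tilde31}=[y_3,y_{31}]_c,\quad y_{\tilde21}=[y_2,y_{\tilde31}]_c .$$ Let $\xi_m=1-q_{33}^{-m}$. Then there are scalars $\mu_\alpha\in\Bbbk$, for the eight positive roots $\alpha\ne\tilde21$,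 with $\mu_\alpha=0$ if $g_\alpha^N=1$ or $\chi_\alpha^N\ne\varepsilon$, such that \begin{align*} y_i^N&=\mu_i(g_i^N-1)\quad(i=1,2,3),\\ y_{(i+1)i}^N&=\mu_{(i+1)i}(g_{(i+1)i}^N-1)-\xi_2^N\mu_{i+1}y_i^N\quad(i=1,2),\\ y_{31}^N&=\mu_{31}(g_{31}^N-1)-\xi_2^N\mu_3y_{21}^N-\xi_2^N\mu_{32}y_1^N,\\ y_{\tilde32}^N&=\mu_{\tilde32}(g_{\tilde32}^N-1)-2\xi_1^N\mu_3y_{32}^N-\xi_1^N\xi_2^N\mu_3^2y_2^N,\\ y_{\tilde31}^N&=\mu_{\tilde31}(g_{\tilde31}^N-1)-2\xi_1^N\mu_3y_{31}^N-\xi_1^N\xi_2^N\mu_3^2y_{21}^N-\xi_2^N\mu_{\tilde32}y_1^N . \end{align*} Moreover, for all such scalars, setting \begin{align*} \lambda_{\tilde31}&=\xi_2^N\mu_2,&\lambda_{31}&=2\xi_1^N(\xi_2^N\mu_2\mu_3-\mu_{32}),\\ \lambda_{21}&=\xi_2^N(\xi_1^N\xi_2^N\mu_2\mu_3^2-2\xi_1^N\mu_3\mu_{32}+\mu_{\tilde32}),&\lambda_1&=\xi_2^N(\xi_2^N\mu_2\mu_{\tilde32}-\xi_1^N\mu_{32}^2),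 \end{align*} there is $\mu_{\tilde21}\in\Bbbk$ such that $$y_{\tilde21}^N=\mu_{\tilde21}(g_{\tilde21}^N-1)-\lambda_{\tilde31}y_{\tilde31}^N-\lambda_{31}y_{31}^N-\lambda_{21}y_{21}^N-\lambda_1y_1^N,$$ and $\mu_{\tilde21}=0$ if $g_{\tilde21}^N=1$ or $\chi_{\tilde21}^N\ne\varepsilon$. -/

import Mathlib

open scoped TensorProduct

noncomputable section

/-! ### The coradical filtration of a coalgebra -/

section Coradical

variable (k : Type*) (C : Type*) [Field k] [AddCommGroup C] [Module k C] [Coalgebra k C]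

/-- For subspaces `X, Y` of `C`, the subspace `X ⊗ Y` of `C ⊗ C`. -/
def tensorSub {k C : Type*} [Field k] [AddCommGroup C] [Module k C] (X Y : Submodule k C) :
    Submodule k (C ⊗[k] C) :=
  LinearMap.range (TensorProduct.map X.subtype Y.subtype)

/-- `X` is a subcoalgebra: `Δ(X) ⊆ X ⊗ X`. -/
def IsSubcoalgebra (X : Submodule k C) : Prop :=
  ∀ a ∈ X, Coalgebra.comul (R := k) a ∈ tensorSub X X

/-- A nonzero subcoalgebra without proper nonzero subcoalgebras. -/
def IsSimpleSubcoalgebra (X : Submodule k C) : Prop :=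
  IsSubcoalgebra k C X ∧ X ≠ ⊥ ∧ ∀ Y : Submodule k C, IsSubcoalgebra k C Y → Y ≤ X → Y = ⊥ ∨ Y = X

/-- The coradical: the sum of all simple subcoalgebras. -/
def coradical : Submodule k C := sSup {X | IsSimpleSubcoalgebra k C X}

/-- The coradical filtration `C_0 = coradical`, `C_{n+1} = Δ⁻¹(C ⊗ C_n + C_0 ⊗ C)`. -/
def coradFilt : ℕ → Submodule k C
  | 0 => coradical k C
  | n + 1 => Submodule.comap (Coalgebra.comul (R := k) (A := C))
      (tensorSub ⊤ (coradFilt n) ⊔ tensorSub (coradical k C) ⊤)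

end Coradical

/-! ### Diagonal Yetter-Drinfeld modules, Nichols algebras and their bosonizations -/

/-- Elements `g_i ∈ Γ` and characters `χ_i` of `Γ`.  They make the vector space `V` with basis
`(x_i)` a Yetter-Drinfeld module over `kΓ`: `x_i` has degree `g_i` and `h · x_i = χ_i(h) x_i`. -/
structure YDDatum (k Γ ι : Type*) [Field k] [CommGroup Γ] where
  /-- the degrees -/
  g : ι → Γ
  /-- the characters -/
  χ : ι → Γ →* kˣ

namespace YDDatum

variable {k Γ ι : Type*} [Field k] [CommGroup Γ] (D : YDDatum k Γ ι)

/-- The braiding matrix `q_{ij} = χ_j(g_i)`. -/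
def q (i j : ι) : k := (D.χ j (D.g i) : k)

/-- The tensor algebra `T(V)`: the free algebra on the basis `(x_i)` of `V`. -/
abbrev T (_D : YDDatum k Γ ι) : Type _ := FreeAlgebra k ι

/-- The homogeneous component `T^n(V)`. -/
def tensorDeg (n : ℕ) : Submodule k D.T :=
  (Submodule.span k (Set.range (FreeAlgebra.ι k : ι → D.T))) ^ n

/-- The action of `h ∈ Γ` on `T(V)`: the algebra map with `x_i ↦ χ_i(h) x_i`. -/
def act (h : Γ) : D.T →ₐ[k] D.T :=
  FreeAlgebra.lift k fun i => (D.χ i h : k) • FreeAlgebra.ι k i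

/-- The coaction `T(V) → kΓ ⊗ T(V)`: the algebra map with `x_i ↦ g_i ⊗ x_i`. -/
def coact : D.T →ₐ[k] MonoidAlgebra k Γ ⊗[k] D.T :=
  FreeAlgebra.lift k fun i => MonoidAlgebra.of k Γ (D.g i) ⊗ₜ[k] FreeAlgebra.ι k i

/-- Left multiplication by `Δ(t)` in the braided tensor square of `T(V)`, whose product is
`(a ⊗ b)(c ⊗ d) = a (b_{(-1)} · c) ⊗ b_{(0)} d`.  The generator `x_i` acts as left multiplication
by `x_i ⊗ 1 + 1 ⊗ x_i`, that is, `u ⊗ v ↦ x_i u ⊗ v + (g_i · u) ⊗ x_i v`. -/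
def braidedRep : D.T →ₐ[k] Module.End k (D.T ⊗[k] D.T) :=
  FreeAlgebra.lift k fun i =>
    TensorProduct.map (LinearMap.mulLeft k (FreeAlgebra.ι k i)) LinearMap.id +
      TensorProduct.map (D.act (D.g i)).toLinearMap (LinearMap.mulLeft k (FreeAlgebra.ι k i))

/-- The braided coproduct of `T(V)`, for which the elements of `V` are primitive:
the algebra map from `T(V)` to its braided tensor square with `x_i ↦ x_i ⊗ 1 + 1 ⊗ x_i`. -/
def tensorComul : D.T →ₗ[k] D.T ⊗[k] D.T :=
  (LinearMap.applyₗ ((1 : D.T) ⊗ₜ[k] (1 : D.T))).comp D.braidedRep.toLinearMap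

/-- The ideals over which the defining ideal of the Nichols algebra is maximal: homogeneous
two-sided ideals of `T(V)` in degrees at least two that are Yetter-Drinfeld submodules and Hopf
ideals.  The counit vanishes in positive degree, and the antipode of the connected graded braided
bialgebra `T(V)` preserves such biideals automatically. -/
structure IsAdmissible (J : Ideal D.T) : Prop where
  mul_right : ∀ a ∈ J, ∀ b, a * b ∈ J
  homogeneous : J.restrictScalars k ≤ ⨆ n : ℕ, J.restrictScalars k ⊓ D.tensorDeg n
  degree : J.restrictScalars k ≤ ⨆ n : ℕ, D.tensorDeg (n + 2)
  act_mem : ∀ h : Γ, ∀ a ∈ J, D.act h a ∈ J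
  coact_mem : ∀ a ∈ J, D.coact a ∈
    LinearMap.range (LinearMap.lTensor (MonoidAlgebra k Γ) (J.restrictScalars k).subtype)
  comul_mem : ∀ a ∈ J, D.tensorComul a ∈
    tensorSub (J.restrictScalars k) ⊤ ⊔ tensorSub ⊤ (J.restrictScalars k)

/-- The ideal `I(V)`: the largest admissible ideal, i.e. the sum of all of them. -/
def nicholsIdeal : Ideal D.T := sSup {J | D.IsAdmissible J}

theorem nicholsIdeal_induction {P : D.T → Prop} (h0 : P 0)
    (hadd : ∀ a b, P a → P b → P (a + b))
    (hmem : ∀ J, D.IsAdmissible J → J ≤ D.nicholsIdeal → ∀ a ∈ J, P a) {a : D.T}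
    (ha : a ∈ D.nicholsIdeal) : P a := by
  rw [nicholsIdeal, sSup_eq_iSup'] at ha
  exact Submodule.iSup_induction (motive := P) _ ha
    (fun J a haJ => hmem J.1 J.2 (le_sSup J.2) a haJ) h0 hadd

instance : D.nicholsIdeal.IsTwoSided where
  mul_mem_of_left {a} b ha := by
    refine D.nicholsIdeal_induction (P := fun a => a * b ∈ D.nicholsIdeal) ?_ ?_ ?_ ha
    · simp
    · intro x y hx hy
      rw [add_mul]
      exact add_mem hx hy
    · intro J hJ hle x hx
      exact hle (hJ.mul_right x hx b)

/-- The Nichols algebra `B(V) = T(V) / I(V)`. -/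
def Nichols : Type _ := D.T ⧸ D.nicholsIdeal

instance : Ring D.Nichols := inferInstanceAs (Ring (D.T ⧸ D.nicholsIdeal))

instance : Algebra k D.Nichols := inferInstanceAs (Algebra k (D.T ⧸ D.nicholsIdeal))

/-- The projection `T(V) → B(V)`. -/
def proj : D.T →ₐ[k] D.Nichols := Ideal.Quotient.mkₐ k D.nicholsIdeal

theorem proj_eq_zero {a : D.T} (ha : a ∈ D.nicholsIdeal) : D.proj a = 0 :=
  Ideal.Quotient.eq_zero_iff_mem.2 ha

/-- The homogeneous component `B^n(V)`. -/
def nicholsDeg (n : ℕ) : Submodule k D.Nichols := (D.tensorDeg n).map D.proj.toLinearMap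

theorem act_mem_nicholsIdeal (h : Γ) {a : D.T} (ha : a ∈ D.nicholsIdeal) :
    D.act h a ∈ D.nicholsIdeal := by
  refine D.nicholsIdeal_induction (P := fun a => D.act h a ∈ D.nicholsIdeal) ?_ ?_ ?_ ha
  · simp
  · intro x y hx hy
    rw [map_add]
    exact add_mem hx hy
  · intro J hJ hle x hx
    exact hle (hJ.act_mem h x hx)

/-- The action of `h ∈ Γ` on `B(V)`. -/
def nicholsAct (h : Γ) : D.Nichols →ₐ[k] D.Nichols :=
  Ideal.Quotient.liftₐ D.nicholsIdeal (D.proj.comp (D.act h)) fun _ ha =>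
    D.proj_eq_zero (D.act_mem_nicholsIdeal h ha)

theorem nicholsAct_proj (h : Γ) (a : D.T) : D.nicholsAct h (D.proj a) = D.proj (D.act h a) := rfl

theorem act_one (a : D.T) : D.act 1 a = a := by
  have : D.act 1 = AlgHom.id k D.T := by
    ext i
    simp [act]
  rw [this]
  rfl

theorem act_mul (h h' : Γ) (a : D.T) : D.act (h * h') a = D.act h (D.act h' a) := by
  have : D.act (h * h') = (D.act h).comp (D.act h') := by
    ext i
    simp [act, smul_smul, mul_comm]
  rw [this]
  rfl

instance : MulSemiringAction Γ D.Nichols where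
  smul h a := D.nicholsAct h a
  one_smul a := by
    obtain ⟨a, rfl⟩ := Ideal.Quotient.mk_surjective a
    exact congrArg D.proj (D.act_one a)
  mul_smul h h' a := by
    obtain ⟨a, rfl⟩ := Ideal.Quotient.mk_surjective a
    exact congrArg D.proj (D.act_mul h h' a)
  smul_zero h := map_zero (D.nicholsAct h)
  smul_add h := map_add (D.nicholsAct h)
  smul_one h := map_one (D.nicholsAct h)
  smul_mul h := map_mul (D.nicholsAct h)

/-- The coaction `B(V) → kΓ ⊗ B(V)`. -/
def nicholsCoact : D.Nichols →ₗ[k] MonoidAlgebra k Γ ⊗[k] D.Nichols :=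
  ((D.nicholsIdeal.restrictScalars k).liftQ
    ((LinearMap.lTensor (MonoidAlgebra k Γ) D.proj.toLinearMap).comp D.coact.toLinearMap) (by
      intro a ha
      refine D.nicholsIdeal_induction (P := fun a => a ∈ LinearMap.ker
        ((LinearMap.lTensor (MonoidAlgebra k Γ) D.proj.toLinearMap).comp D.coact.toLinearMap))
        (zero_mem _) (fun _ _ => add_mem) ?_ ha
      intro J hJ hle x hx
      obtain ⟨t, ht⟩ := hJ.coact_mem x hx
      have h0 : D.proj.toLinearMap.comp (J.restrictScalars k).subtype = 0 := by
        ext y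
        exact D.proj_eq_zero (hle y.2)
      rw [LinearMap.mem_ker, LinearMap.comp_apply, AlgHom.toLinearMap_apply, ← ht,
        ← LinearMap.comp_apply, ← LinearMap.lTensor_comp, h0]
      simp)).comp (Submodule.Quotient.restrictScalarsEquiv k D.nicholsIdeal).symm.toLinearMap

/-- The braided coproduct of `B(V)`. -/
def nicholsComul : D.Nichols →ₗ[k] D.Nichols ⊗[k] D.Nichols :=
  ((D.nicholsIdeal.restrictScalars k).liftQ
    ((TensorProduct.map D.proj.toLinearMap D.proj.toLinearMap).comp D.tensorComul) (by
      intro a ha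
      refine D.nicholsIdeal_induction (P := fun a => a ∈ LinearMap.ker
        ((TensorProduct.map D.proj.toLinearMap D.proj.toLinearMap).comp D.tensorComul))
        (zero_mem _) (fun _ _ => add_mem) ?_ ha
      intro J hJ hle x hx
      have h0 : D.proj.toLinearMap.comp (J.restrictScalars k).subtype = 0 := by
        ext y
        exact D.proj_eq_zero (hle y.2)
      have key : tensorSub (J.restrictScalars k) ⊤ ⊔ tensorSub ⊤ (J.restrictScalars k) ≤
          LinearMap.ker (TensorProduct.map D.proj.toLinearMap D.proj.toLinearMap) := by
        refine sup_le ?_ ?_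
        · rintro _ ⟨t, rfl⟩
          rw [LinearMap.mem_ker, ← LinearMap.comp_apply, ← TensorProduct.map_comp, h0]
          simp
        · rintro _ ⟨t, rfl⟩
          rw [LinearMap.mem_ker, ← LinearMap.comp_apply, ← TensorProduct.map_comp, h0]
          simp
      exact key (hJ.comul_mem x hx))).comp
    (Submodule.Quotient.restrictScalarsEquiv k D.nicholsIdeal).symm.toLinearMap

/-- The algebra `B(V) # kΓ`: the element `r # g` is `SkewMonoidAlgebra.single g r`, and
`(r # g)(s # h) = r (g · s) # g h`. -/
abbrev Bos : Type _ := SkewMonoidAlgebra D.Nichols Γ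

/-- The homogeneous component `B^n(V) # kΓ`. -/
def bosDeg (n : ℕ) : Submodule k D.Bos where
  carrier := {f | ∀ h, f.coeff h ∈ D.nicholsDeg n}
  zero_mem' h := by simp
  add_mem' ha hb h := by
    simpa using add_mem (ha h) (hb h)
  smul_mem' c f hf h := by
    simpa using Submodule.smul_mem _ c (hf h)

/-- The linear map `B(V) ⊗ kΓ → B(V) # kΓ`, `r ⊗ h ↦ r # h g`. -/
def smash (g : Γ) : D.Nichols ⊗[k] MonoidAlgebra k Γ →ₗ[k] D.Bos :=
  TensorProduct.lift
    ((Finsupp.linearCombination k fun h : Γ =>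
        (SkewMonoidAlgebra.lsingle k (h * g) : D.Nichols →ₗ[k] D.Bos)).comp
      (MonoidAlgebra.coeffLinearEquiv k).toLinearMap).flip

/-- The coproduct of `B(V) # kΓ`:
`Δ(r # g) = r^{(1)} # (r^{(2)})_{(-1)} g ⊗ (r^{(2)})_{(0)} # g`. -/
def bosComul : D.Bos →ₗ[k] D.Bos ⊗[k] D.Bos :=
  (Finsupp.lsum k fun g : Γ =>
    (TensorProduct.map (D.smash g) (SkewMonoidAlgebra.lsingle k g : D.Nichols →ₗ[k] D.Bos)).comp
      ((TensorProduct.assoc k D.Nichols (MonoidAlgebra k Γ) D.Nichols).symm.toLinearMap.comp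
        ((LinearMap.lTensor D.Nichols D.nicholsCoact).comp D.nicholsComul))).comp
    (SkewMonoidAlgebra.coeffLinearEquiv : D.Bos ≃ₗ[k] (Γ →₀ D.Nichols)).toLinearMap

/-- The element `1 # g` of `B(V) # kΓ`. -/
def bosGroup (g : Γ) : D.Bos := SkewMonoidAlgebra.single g 1

/-- The element `x_i # 1` of `B(V) # kΓ`. -/
def bosGen (i : ι) : D.Bos := SkewMonoidAlgebra.single 1 (D.proj (FreeAlgebra.ι k i))

/-! ### Liftings -/

variable (A : Type*) [Ring A] [HopfAlgebra k A]

/-- `A` is a lifting of `B(V) # kΓ`: an isomorphism of graded Hopf algebras from `gr A`, the graded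
algebra associated with the coradical filtration `(A_n)`, onto `B(V) # kΓ`.  In degree `n` it is
given as a linear map `symbol n` on `A_n`, onto the component of degree `n`, with kernel `A_{n-1}`.
It respects products and coproducts: `Δ(a)`, for `a ∈ A_n`, lies in `∑ A_i ⊗ A_{n-i}`, and taking
symbols there gives the coproduct of the symbol of `a`.  (An isomorphism of bialgebras respects
counits and antipodes.) -/
structure Lifting where
  /-- the induced isomorphism `A_n / A_{n-1} → B^n(V) # kΓ`, as a map on `A_n` -/
  symbol : ∀ n, coradFilt k A n →ₗ[k] D.Bos
  range_symbol : ∀ n, LinearMap.range (symbol n) = D.bosDeg n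
  symbol_zero : ∀ a, symbol 0 a = 0 ↔ a = 0
  symbol_succ : ∀ n a, symbol (n + 1) a = 0 ↔ (a : A) ∈ coradFilt k A n
  symbol_one : ∃ h : (1 : A) ∈ coradFilt k A 0, symbol 0 ⟨1, h⟩ = 1
  symbol_mul : ∀ m n (a : coradFilt k A m) (b : coradFilt k A n),
    ∃ h : (a * b : A) ∈ coradFilt k A (m + n), symbol (m + n) ⟨a * b, h⟩ = symbol m a * symbol n b
  symbol_comul : ∀ n (a : coradFilt k A n),
    ∃ t : ∀ ij : ℕ × ℕ, coradFilt k A ij.1 ⊗[k] coradFilt k A ij.2,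
      Coalgebra.comul (R := k) (a : A) = ∑ ij ∈ Finset.HasAntidiagonal.antidiagonal n,
        TensorProduct.map (coradFilt k A ij.1).subtype (coradFilt k A ij.2).subtype (t ij) ∧
      D.bosComul (symbol n a) = ∑ ij ∈ Finset.HasAntidiagonal.antidiagonal n,
        TensorProduct.map (symbol ij.1) (symbol ij.2) (t ij)

variable {D A}

theorem bosGroup_mem (g : Γ) : D.bosGroup g ∈ D.bosDeg 0 := by
  classical
  intro h
  have h1 : (1 : D.Nichols) ∈ D.nicholsDeg 0 := ⟨1, by simp [tensorDeg], map_one D.proj⟩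
  simp only [bosGroup, SkewMonoidAlgebra.coeff_single, Finsupp.single_apply]
  split_ifs
  · exact h1
  · exact zero_mem _

theorem Lifting.exists_grp (L : D.Lifting A) (g : Γ) :
    ∃ a : coradFilt k A 0, L.symbol 0 a = D.bosGroup g := by
  have := bosGroup_mem (D := D) g
  rwa [← L.range_symbol 0] at this

/-- The group `Γ` inside `A_0`: the unique element of `A_0` with symbol `1 # g`. -/
def Lifting.grp (L : D.Lifting A) (g : Γ) : A := ((L.exists_grp g).choose : A)

/-- The elements `y_i ∈ A_1` lift the generators `x_i` and lie in `P_{g_i}^{χ_i}(A)`: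
`Δ(y_i) = y_i ⊗ 1 + g_i ⊗ y_i` and `h y_i h⁻¹ = χ_i(h) y_i` for `h ∈ Γ`. -/
structure Lifting.IsLiftOfGenerators (L : D.Lifting A) (y : ι → A) : Prop where
  symbol_eq : ∀ i, ∃ h : y i ∈ coradFilt k A 1, L.symbol 1 ⟨y i, h⟩ = D.bosGen i
  comul_eq : ∀ i, Coalgebra.comul (R := k) (y i) = y i ⊗ₜ[k] 1 + L.grp (D.g i) ⊗ₜ[k] y i
  conj_eq : ∀ (h : Γ) i, L.grp h * y i = (D.χ i h : k) • (y i * L.grp h)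

end YDDatum

/-! ### Cartan type `B_3` -/

/-- The Cartan matrix of type `B_3`, with `α_3` the short simple root. -/
def cartanB3 : Matrix (Fin 3) (Fin 3) ℤ := !![2, -1, 0; -1, 2, -1; 0, -2, 2]

/-- The positive roots of type `B_3`; the letter `t` stands for a tilde. -/
inductive PosRoot
  | a1 | a2 | a3 | a21 | a32 | a31 | a3t2 | a3t1 | a2t1

/-- Coordinates of a positive root in the basis of the simple roots `α_1, α_2, α_3`. -/
def PosRoot.coord : PosRoot → Fin 3 → ℕ
  | a1 => ![1, 0, 0]
  | a2 => ![0, 1, 0]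
  | a3 => ![0, 0, 1]
  | a21 => ![1, 1, 0]
  | a32 => ![0, 1, 1]
  | a31 => ![1, 1, 1]
  | a3t2 => ![0, 1, 2]
  | a3t1 => ![1, 1, 2]
  | a2t1 => ![1, 2, 2]

namespace YDDatum

variable {k Γ : Type*} [Field k] [CommGroup Γ] (D : YDDatum k Γ (Fin 3))

/-- The braiding is of Cartan type `B_3`: `q_{ij} q_{ji} = q_{ii}^{a_{ij}}`. -/
def IsCartanB3 : Prop := ∀ i j, D.q i j * D.q j i = D.q i i ^ cartanB3 i j

/-- `N`, the order of `q_{33}`. -/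
def N : ℕ := orderOf (D.q 2 2)

/-- `ξ_m = 1 - q_{33}^{-m}`. -/
def ξ (m : ℕ) : k := 1 - (D.q 2 2)⁻¹ ^ m

/-- `g_α = ∏ g_i^{n_i}` for `α = ∑ n_i α_i`. -/
def gRoot (α : PosRoot) : Γ := ∏ i, D.g i ^ α.coord i

/-- `χ_α = ∏ χ_i^{n_i}` for `α = ∑ n_i α_i`. -/
def χRoot (α : PosRoot) : Γ →* kˣ := ∏ i, D.χ i ^ α.coord i

/-- `q_{α,β} = χ_β(g_α)`, the product of the `q_{ij}` over the simple constituents. -/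
def qRoot (α β : PosRoot) : k := (D.χRoot β (D.gRoot α) : k)

section RootVectors

variable {A : Type*} [Ring A] [Algebra k A]

/-- The braided commutator `a b - q_{α,β} b a` of elements `a`, `b` of degrees `α`, `β`. -/
def brk (α β : PosRoot) (a b : A) : A := a * b - D.qRoot α β • (b * a)

open PosRoot in
/-- The root vectors `y_α` built from `y_1, y_2, y_3` by iterated braided commutators. -/
def rootVec (y : Fin 3 → A) : PosRoot → A
  | a1 => y 0
  | a2 => y 1
  | a3 => y 2
  | a21 => D.brk a2 a1 (y 1) (y 0)
  | a32 => D.brk a3 a2 (y 2) (y 1)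
  | a31 => D.brk a3 a21 (y 2) (D.brk a2 a1 (y 1) (y 0))
  | a3t2 => D.brk a3 a32 (y 2) (D.brk a3 a2 (y 2) (y 1))
  | a3t1 => D.brk a3 a31 (y 2) (D.brk a3 a21 (y 2) (D.brk a2 a1 (y 1) (y 0)))
  | a2t1 => D.brk a2 a3t1 (y 1)
      (D.brk a3 a31 (y 2) (D.brk a3 a21 (y 2) (D.brk a2 a1 (y 1) (y 0))))

end RootVectors

variable {D} {A : Type*} [Ring A] [HopfAlgebra k A]

open PosRoot in
/-- `μ` gives the deformation parameters of the roots of height at most four, for a choice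
of lifted generators `y`: `μ_α = 0` if `g_α^N = 1` or `χ_α^N ≠ ε`, and the `N`-th powers of the
root vectors satisfy the deformed relations.  The value of `μ` at the root of height five is not
used. -/
structure Lifting.IsLowerParameter (L : D.Lifting A) (y : Fin 3 → A) (μ : PosRoot → k) : Prop where
  vanish : ∀ α, α ≠ a2t1 → D.gRoot α ^ D.N = 1 ∨ D.χRoot α ^ D.N ≠ 1 → μ α = 0
  rel1 : D.rootVec y a1 ^ D.N = μ a1 • (L.grp (D.gRoot a1 ^ D.N) - 1)
  rel2 : D.rootVec y a2 ^ D.N = μ a2 • (L.grp (D.gRoot a2 ^ D.N) - 1)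
  rel3 : D.rootVec y a3 ^ D.N = μ a3 • (L.grp (D.gRoot a3 ^ D.N) - 1)
  rel21 : D.rootVec y a21 ^ D.N = μ a21 • (L.grp (D.gRoot a21 ^ D.N) - 1)
    - (D.ξ 2 ^ D.N * μ a2) • D.rootVec y a1 ^ D.N
  rel32 : D.rootVec y a32 ^ D.N = μ a32 • (L.grp (D.gRoot a32 ^ D.N) - 1)
    - (D.ξ 2 ^ D.N * μ a3) • D.rootVec y a2 ^ D.N
  rel31 : D.rootVec y a31 ^ D.N = μ a31 • (L.grp (D.gRoot a31 ^ D.N) - 1)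
    - (D.ξ 2 ^ D.N * μ a3) • D.rootVec y a21 ^ D.N
    - (D.ξ 2 ^ D.N * μ a32) • D.rootVec y a1 ^ D.N
  rel3t2 : D.rootVec y a3t2 ^ D.N = μ a3t2 • (L.grp (D.gRoot a3t2 ^ D.N) - 1)
    - (2 * D.ξ 1 ^ D.N * μ a3) • D.rootVec y a32 ^ D.N
    - (D.ξ 1 ^ D.N * D.ξ 2 ^ D.N * μ a3 ^ 2) • D.rootVec y a2 ^ D.N
  rel3t1 : D.rootVec y a3t1 ^ D.N = μ a3t1 • (L.grp (D.gRoot a3t1 ^ D.N) - 1)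
    - (2 * D.ξ 1 ^ D.N * μ a3) • D.rootVec y a31 ^ D.N
    - (D.ξ 1 ^ D.N * D.ξ 2 ^ D.N * μ a3 ^ 2) • D.rootVec y a21 ^ D.N
    - (D.ξ 2 ^ D.N * μ a3t2) • D.rootVec y a1 ^ D.N

variable (D)

open PosRoot in
/-- `λ_{3̃1} = ξ_2^N μ_2`. -/
def lam3t1 (μ : PosRoot → k) : k := D.ξ 2 ^ D.N * μ a2

open PosRoot in
/-- `λ_{31} = 2 ξ_1^N (ξ_2^N μ_2 μ_3 - μ_{32})`. -/
def lam31 (μ : PosRoot → k) : k := 2 * D.ξ 1 ^ D.N * (D.ξ 2 ^ D.N * μ a2 * μ a3 - μ a32)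

open PosRoot in
/-- `λ_{21} = ξ_2^N (ξ_1^N ξ_2^N μ_2 μ_3^2 - 2 ξ_1^N μ_3 μ_{32} + μ_{3̃2})`. -/
def lam21 (μ : PosRoot → k) : k :=
  D.ξ 2 ^ D.N * (D.ξ 1 ^ D.N * D.ξ 2 ^ D.N * μ a2 * μ a3 ^ 2
    - 2 * D.ξ 1 ^ D.N * μ a3 * μ a32 + μ a3t2)

open PosRoot in
/-- `λ_1 = ξ_2^N (ξ_2^N μ_2 μ_{3̃2} - ξ_1^N μ_{32}^2)`. -/
def lam1 (μ : PosRoot → k) : k :=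
  D.ξ 2 ^ D.N * (D.ξ 2 ^ D.N * μ a2 * μ a3t2 - D.ξ 1 ^ D.N * μ a32 ^ 2)

end YDDatum

end

/-!
The coproduct `Δ` is an algebra map, so `Δ(y_α)` is the root vector `y_α` formed from the elements
`y_i ⊗ 1 + g_i ⊗ y_i`.  The families `(y_i ⊗ 1)` and `(g_i ⊗ y_i)` commute with each other up to
the scalars `q_{ij}`, and each satisfies the quantum Serre relations: a Serre element is
skew-primitive, and its degree and character are neither trivial nor those of a generator, which
leaves only the value zero (`Lifting.IsLiftOfGenerators.isSerre`).  From the Serre relations follow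
the commutation relations between root vectors, and with them a short expansion of `Δ(y_α)`
(`IsSerrePair.rootVec_a21` to `IsSerrePair.rootVec_a2t1`).

The summands of `Δ(y_α)` do not quite commute up to a common scalar `p`, but the `N`-th power of
their sum is still a combination of their `N`-th powers.  This is proved with a noncommutative
analogue of the `q`-Hermite polynomials, which satisfy an addition rule with Gaussian binomial
coefficients; at an `N`-th root of unity all but the outer coefficients vanish
(`add_pow_of_skew_add`, `add_add_pow_of_sq`, `add_pow_five`).  The outcome is a formula
`Δ(y_α^N) = y_α^N ⊗ 1 + g_α^N ⊗ y_α^N + ∑ c_γ z_γ^N g_γ^N ⊗ y_γ^N`, where `γ` runs over lower roots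
and `z_γ` has weight `α - γ`.

By induction on the height the left factors `z_γ^N` are known elements of `kΓ`, and subtracting
multiples of the lower `y_γ^N` makes `y_α^N` skew-primitive of degree `g_α^N`.  A skew-primitive
element lies in `A_1`, on which the isomorphism with `B(V) # kΓ` gives the basis `h`, `y_i h`; so it
is a multiple of `g_α^N - 1` (`Lifting.IsLiftOfGenerators.eq_smul_grp_sub_one`), with coefficient
zero if `g_α^N = 1` or if `Γ` acts on it by a nontrivial character.  That `Γ` acts by `χ_α^N` on the
subtracted terms as well follows from the vanishing of the parameters of lower roots
(`Lifting.χRoot_pow_eq`).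

The root `α₁ + 2α₂ + 2α₃` needs two more computations.  Its coproduct involves the root vectors
`[y₂, y₃]` and `[[y₂, y₃], y₃]` for the opposite order of the roots; the antipode carries the
original root vectors to multiples of these, which determines their `N`-th powers
(`revVec32_pow`, `revVec3t2_pow`).  The coefficient of `y₁` is a combination `cornerVec` of
`y₂ y_{α₂+2α₃}` and `y_{α₂+α₃}²`, whose `N`-th power is found by applying the `q`-binomial theorem
to `y₂^N y_{α₂+2α₃}^N` (`IsSerre.cornerVec_pow`).
-/

noncomputable section

/-! ### Powers of sums of elements that commute up to a scalar -/

section QPower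

open Finset

variable {k : Type*} [Field k]

/-- The quantum integer `[n]_p = 1 + p + ⋯ + p^{n-1}`. -/
def qNum (p : k) (n : ℕ) : k := ∑ i ∈ range n, p ^ i

theorem qNum_zero (p : k) : qNum p 0 = 0 := by simp [qNum]

theorem qNum_one (p : k) : qNum p 1 = 1 := by simp [qNum]

theorem qNum_succ (p : k) (n : ℕ) : qNum p (n + 1) = qNum p n + p ^ n := by
  simp [qNum, sum_range_succ]

theorem qNum_add (p : k) (m n : ℕ) : qNum p (m + n) = qNum p m + p ^ m * qNum p n := by
  simp [qNum, sum_range_add, pow_add, mul_sum]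

theorem qNum_eq_zero {p : k} {N : ℕ} (hp : IsPrimitiveRoot p N) (hN : 1 < N) : qNum p N = 0 :=
  hp.geom_sum_eq_zero hN

theorem qNum_ne_zero {p : k} {N n : ℕ} (hp : IsPrimitiveRoot p N) (h0 : n ≠ 0) (hn : n < N) :
    qNum p n ≠ 0 := by
  intro h
  have h1 : qNum p n * (p - 1) = p ^ n - 1 := geom_sum_mul p n
  rw [h, zero_mul] at h1
  exact hp.pow_ne_one_of_pos_of_lt h0 hn (sub_eq_zero.1 h1.symm)

/-- The Gaussian binomial coefficient `(i + j choose i)_p`. -/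
def qBinom (p : k) : ℕ → ℕ → k
  | 0, _ => 1
  | _ + 1, 0 => 1
  | i + 1, j + 1 => qBinom p i (j + 1) + p ^ (i + 1) * qBinom p (i + 1) j

theorem qBinom_zero_left (p : k) (j : ℕ) : qBinom p 0 j = 1 := by simp [qBinom]

theorem qBinom_zero_right (p : k) (i : ℕ) : qBinom p i 0 = 1 := by cases i <;> simp [qBinom]

/-- The absorption identities `[i+1] (i+1+j choose i+1) = [i+j+1] (i+j choose i)` and its
mirror image. -/
theorem qBinom_absorb (p : k) (i j : ℕ) :
    qNum p (i + 1) * qBinom p (i + 1) j = qNum p (i + j + 1) * qBinom p i j ∧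
      qNum p (j + 1) * qBinom p i (j + 1) = qNum p (i + j + 1) * qBinom p i j := by
  induction h : i + j generalizing i j with
  | zero =>
    obtain ⟨rfl, rfl⟩ : i = 0 ∧ j = 0 := by omega
    simp [qBinom]
  | succ n ih =>
    constructor
    · cases j with
      | zero => simp only [qBinom_zero_right]; rw [← h, add_zero]
      | succ j =>
        obtain ⟨h1, h2⟩ := ih i j (by omega)
        have h3 := qNum_add p (i + 1) (j + 1)
        rw [show i + 1 + (j + 1) = n + 1 + 1 by omega] at h3
        rw [qBinom, h3]
        linear_combination p ^ (i + 1) * h1 - p ^ (i + 1) * h2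
    · cases i with
      | zero => simp only [qBinom_zero_left]; rw [← h, zero_add]
      | succ i =>
        obtain ⟨h1, h2⟩ := ih i j (by omega)
        have h3 := qNum_add p (i + 1) (j + 1)
        rw [show i + 1 + (j + 1) = n + 1 + 1 by omega] at h3
        rw [qBinom, h3]
        linear_combination h2 - h1

theorem qBinom_eq_zero {p : k} {N i j : ℕ} (hp : IsPrimitiveRoot p N) (hij : i + j = N)
    (hi : i ≠ 0) (hj : j ≠ 0) : qBinom p i j = 0 := by
  obtain ⟨i, rfl⟩ := Nat.exists_eq_succ_of_ne_zero hi
  have h := (qBinom_absorb p i j).1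
  rw [show i + j + 1 = N by omega, qNum_eq_zero hp (by omega), zero_mul] at h
  exact (mul_eq_zero.1 h).resolve_left (qNum_ne_zero hp (by omega) (by omega))

variable {E : Type*} [Ring E] [Algebra k E]

/-- The `q`-Pascal rule, as a recursion for sums with Gaussian binomial coefficients. -/
theorem sum_qBinom_succ (p : k) (n : ℕ) (F : ℕ → ℕ → E) :
    ∑ x ∈ antidiagonal (n + 1), qBinom p x.1 x.2 • F x.1 x.2 =
      ∑ x ∈ antidiagonal n, qBinom p x.1 x.2 • (F (x.1 + 1) x.2 + p ^ x.1 • F x.1 (x.2 + 1)) := by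
  have key : ∀ x : ℕ × ℕ, x ∈ antidiagonal (n + 1) → qBinom p x.1 x.2 • F x.1 x.2 =
      (if x.1 = 0 then 0 else qBinom p (x.1 - 1) x.2 • F x.1 x.2) +
        (if x.2 = 0 then 0 else (p ^ x.1 * qBinom p x.1 (x.2 - 1)) • F x.1 x.2) := by
    rintro ⟨i, j⟩ hx
    rw [HasAntidiagonal.mem_antidiagonal] at hx
    rcases i with _ | i <;> rcases j with _ | j
    · simp at hx
    · simp [qBinom_zero_left]
    · simp [qBinom_zero_right]
    · simp [qBinom, add_smul]
  rw [sum_congr rfl key, sum_add_distrib, Nat.sum_antidiagonal_succ, Nat.sum_antidiagonal_succ']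
  simp only [smul_add, sum_add_distrib, smul_smul]
  simp [mul_comm]

theorem sum_qNum_left (p : k) (n : ℕ) (F : ℕ → ℕ → E) :
    ∑ x ∈ antidiagonal (n + 1), (qNum p x.1 * qBinom p x.1 x.2) • F x.1 x.2 =
      qNum p (n + 1) • ∑ x ∈ antidiagonal n, qBinom p x.1 x.2 • F (x.1 + 1) x.2 := by
  rw [Nat.sum_antidiagonal_succ, smul_sum]
  simp only [qNum_zero, zero_mul, zero_smul, zero_add]
  refine sum_congr rfl fun x hx => ?_
  rw [(qBinom_absorb p x.1 x.2).1, HasAntidiagonal.mem_antidiagonal.1 hx, smul_smul]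

theorem sum_qNum_right (p : k) (n : ℕ) (F : ℕ → ℕ → E) :
    ∑ x ∈ antidiagonal (n + 1), (qNum p x.2 * qBinom p x.1 x.2) • F x.1 x.2 =
      qNum p (n + 1) • ∑ x ∈ antidiagonal n, qBinom p x.1 x.2 • F x.1 (x.2 + 1) := by
  rw [Nat.sum_antidiagonal_succ', smul_sum]
  simp only [qNum_zero, zero_mul, zero_smul, zero_add]
  refine sum_congr rfl fun x hx => ?_
  rw [(qBinom_absorb p x.1 x.2).2, HasAntidiagonal.mem_antidiagonal.1 hx, smul_smul]

/-- At a primitive `N`-th root of unity only the two outer Gaussian binomial coefficients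
`(N choose i)` are nonzero. -/
theorem sum_qBinom_primitive {p : k} {N : ℕ} (hp : IsPrimitiveRoot p N) (hN : 0 < N)
    (F : ℕ → ℕ → E) :
    ∑ x ∈ antidiagonal N, qBinom p x.1 x.2 • F x.1 x.2 = F 0 N + F N 0 := by
  obtain ⟨n, rfl⟩ := Nat.exists_eq_succ_of_ne_zero hN.ne'
  have hne : ((0, n + 1) : ℕ × ℕ) ≠ (n + 1, 0) := by simp
  rw [← sum_subset (s₁ := {(0, n + 1), (n + 1, 0)}), sum_pair hne]
  · simp [qBinom_zero_left, qBinom_zero_right]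
  · intro x hx
    simp only [mem_insert, mem_singleton] at hx
    rcases hx with rfl | rfl <;> simp
  · rintro ⟨i, j⟩ hx hx'
    rw [HasAntidiagonal.mem_antidiagonal] at hx
    simp only [mem_insert, mem_singleton, Prod.mk.injEq, not_or, not_and] at hx'
    rw [qBinom_eq_zero hp hx, zero_smul]
    · rintro rfl; exact hx'.1 rfl (by simpa using hx)
    · rintro rfl; exact hx'.2 (by simpa using hx) rfl

/-- Noncommutative `q`-Hermite sequence: `f_0 = 1` and `f_{n+1} = Y f_n + [n]_p Ω f_{n-1}`. -/
def qHermite (p : k) (Y Ω : E) : ℕ → E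
  | 0 => 1
  | 1 => Y
  | n + 2 => Y * qHermite p Y Ω (n + 1) + qNum p (n + 1) • (Ω * qHermite p Y Ω n)

theorem qHermite_succ (p : k) (Y Ω : E) (n : ℕ) : qHermite p Y Ω (n + 1) =
    Y * qHermite p Y Ω n + qNum p n • (Ω * qHermite p Y Ω (n - 1)) := by
  cases n <;> simp [qHermite, qNum_zero]

/-- The recursion determines the `q`-Hermite sequence. -/
theorem eq_qHermite {p : k} {Y Ω : E} {f : ℕ → E} (h0 : f 0 = 1) (h1 : f 1 = Y)
    (h : ∀ n, f (n + 2) = Y * f (n + 1) + qNum p (n + 1) • (Ω * f n)) (n : ℕ) :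
    f n = qHermite p Y Ω n := by
  suffices h : f n = qHermite p Y Ω n ∧ f (n + 1) = qHermite p Y Ω (n + 1) from h.1
  induction n with
  | zero => simp [qHermite, h0, h1]
  | succ n ih => exact ⟨ih.2, by rw [h, ih.1, ih.2, qHermite]⟩

theorem qHermite_zero_right (p : k) (Y : E) (n : ℕ) : qHermite p Y 0 n = Y ^ n := by
  refine (eq_qHermite (by simp) (by simp) fun n => ?_) n |>.symm
  simp [pow_succ']

theorem qHermite_zero_left_odd (p : k) (Ω : E) {n : ℕ} (hn : Odd n) : qHermite p 0 Ω n = 0 := by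
  obtain ⟨m, rfl⟩ := hn
  induction m with
  | zero => simp [qHermite]
  | succ m ih =>
    rw [show 2 * (m + 1) + 1 = (2 * m + 1) + 2 by ring, qHermite, ih]
    simp

theorem pow_skew {p : k} {Z Y : E} (h : Z * Y = p • (Y * Z)) (n : ℕ) :
    Z * Y ^ n = p ^ n • (Y ^ n * Z) := by
  induction n with
  | zero => simp
  | succ n ih =>
    rw [pow_succ', ← mul_assoc, h, smul_mul_assoc, mul_assoc, ih, mul_smul_comm, smul_smul,
      mul_assoc, ← pow_succ']

theorem qHermite_skew {p : k} {Y Z Ω : E} (hZY : Z * Y = p • (Y * Z))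
    (hZΩ : Z * Ω = p ^ 2 • (Ω * Z)) (n : ℕ) :
    Z * qHermite p Y Ω n = p ^ n • (qHermite p Y Ω n * Z) := by
  suffices h : Z * qHermite p Y Ω n = p ^ n • (qHermite p Y Ω n * Z) ∧
      Z * qHermite p Y Ω (n + 1) = p ^ (n + 1) • (qHermite p Y Ω (n + 1) * Z) from h.1
  induction n with
  | zero => simp [qHermite, hZY]
  | succ n ih =>
    refine ⟨ih.2, ?_⟩
    rw [qHermite, mul_add, mul_smul_comm, ← mul_assoc, ← mul_assoc, hZY, hZΩ, smul_mul_assoc,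
      smul_mul_assoc, mul_assoc, mul_assoc, ih.1, ih.2]
    simp only [mul_smul_comm, smul_smul, add_mul, smul_add, smul_mul_assoc, mul_assoc]
    congr 2 <;> ring

/-- Adding to `Y` a summand on its right that `p`-commutes with `Y`. -/
theorem qHermite_add_right {p : k} {Y Z Ω : E} (hZY : Z * Y = p • (Y * Z))
    (hZΩ : Z * Ω = p ^ 2 • (Ω * Z)) (n : ℕ) :
    qHermite p (Y + Z) Ω n =
      ∑ x ∈ antidiagonal n, qBinom p x.1 x.2 • (qHermite p Y Ω x.1 * Z ^ x.2) := by
  refine (eq_qHermite (f := fun n => ∑ x ∈ antidiagonal n,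
    qBinom p x.1 x.2 • (qHermite p Y Ω x.1 * Z ^ x.2)) (by simp [qHermite, qBinom_zero_left]) ?_
    fun n => ?_) n |>.symm
  · simp [Nat.sum_antidiagonal_succ, qHermite, qBinom_zero_left, qBinom_zero_right, add_comm]
  · have hstep : ∀ i j, (Y + Z) * (qHermite p Y Ω i * Z ^ j) =
        (qHermite p Y Ω (i + 1) * Z ^ j + p ^ i • (qHermite p Y Ω i * Z ^ (j + 1))) -
          qNum p i • (Ω * (qHermite p Y Ω (i - 1) * Z ^ j)) := by
      intro i j
      rw [add_mul, ← mul_assoc Z, qHermite_skew hZY hZΩ, qHermite_succ, pow_succ']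
      simp only [add_mul, smul_mul_assoc, mul_assoc]
      abel
    have h2 := sum_qNum_left p n fun i j => Ω * (qHermite p Y Ω (i - 1) * Z ^ j)
    simp only [Nat.add_sub_cancel] at h2
    simp only [mul_sum, mul_smul_comm, hstep]
    rw [sum_qBinom_succ p (n + 1) fun i j => qHermite p Y Ω i * Z ^ j, ← h2, ← sum_add_distrib]
    refine sum_congr rfl fun x _ => ?_
    rw [smul_sub, smul_smul, mul_comm (qNum p x.1), sub_add_cancel]

/-- The commutation rule of `R` with the powers of `W`, when the commutator of `R` and `W` is
`Ωs + Ωt`, with `Ωs` commuting with `W` up to `p²` and `Ωt` commuting with `W`. -/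
theorem mul_pow_skew_add {p : k} {W R Ωs Ωt : E} (hRW : R * W = p • (W * R) + Ωs + Ωt)
    (hs : Ωs * W = p ^ 2 • (W * Ωs)) (ht : Ωt * W = W * Ωt) (n : ℕ) :
    R * W ^ (n + 1) = p ^ (n + 1) • (W ^ (n + 1) * R) +
      qNum p (n + 1) • (p ^ n • (W ^ n * Ωs) + W ^ n * Ωt) := by
  induction n with
  | zero => simp [qNum_one, hRW, add_assoc]
  | succ n ih =>
    have hs' : Ωs * W ^ (n + 1) = (p ^ 2) ^ (n + 1) • (W ^ (n + 1) * Ωs) := pow_skew hs _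
    have ht' : Ωt * W ^ (n + 1) = W ^ (n + 1) * Ωt := by
      simpa using pow_skew (p := (1 : k)) (Z := Ωt) (Y := W) (by simpa using ht) (n + 1)
    have h1 : R * W ^ (n + 1 + 1) = p • (W * (R * W ^ (n + 1))) + Ωs * W ^ (n + 1) +
        Ωt * W ^ (n + 1) := by
      rw [pow_succ' W (n + 1), ← mul_assoc, hRW]
      simp only [add_mul, smul_mul_assoc, mul_assoc]
    rw [h1, ih, hs', ht']
    have hq : p * qNum p (n + 1) + 1 = qNum p (n + 1 + 1) := by
      rw [show n + 1 + 1 = 1 + (n + 1) by ring, qNum_add p 1 (n + 1), qNum_one]; ring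
    have hq' := qNum_succ p (n + 1)
    simp only [mul_add, mul_smul_comm, smul_add, ← mul_assoc, ← pow_succ', smul_smul]
    match_scalars
    · ring
    · linear_combination -(p ^ (n + 1)) * hq'
    · linear_combination hq

/-- Adding to `R` a summand on its left. -/
theorem qHermite_add_left {p : k} {W R Ωs Ωt : E} (hRW : R * W = p • (W * R) + Ωs + Ωt)
    (hs : Ωs * W = p ^ 2 • (W * Ωs)) (ht : Ωt * W = W * Ωt) (n : ℕ) :
    qHermite p (W + R) (-Ωt) n =
      ∑ x ∈ antidiagonal n, qBinom p x.1 x.2 • (W ^ x.1 * qHermite p R Ωs x.2) := by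
  refine (eq_qHermite (f := fun n => ∑ x ∈ antidiagonal n,
    qBinom p x.1 x.2 • (W ^ x.1 * qHermite p R Ωs x.2)) (by simp [qHermite, qBinom_zero_left]) ?_
    fun n => ?_) n |>.symm
  · simp [Nat.sum_antidiagonal_succ, qHermite, qBinom_zero_left, qBinom_zero_right, add_comm]
  · have ht' : ∀ a, Ωt * W ^ a = W ^ a * Ωt := fun a => by
      simpa using pow_skew (p := (1 : k)) (Z := Ωt) (Y := W) (by simpa using ht) a
    have hstep : ∀ i j, (W + R) * (W ^ i * qHermite p R Ωs j) =
        (W ^ (i + 1) * qHermite p R Ωs j + p ^ i • (W ^ i * qHermite p R Ωs (j + 1))) -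
          qNum p j • (p ^ i • (W ^ i * Ωs * qHermite p R Ωs (j - 1))) +
          qNum p i • (p ^ (i - 1) • (W ^ (i - 1) * Ωs * qHermite p R Ωs j) +
            W ^ (i - 1) * Ωt * qHermite p R Ωs j) := by
      intro i j
      have h1 : R * W ^ i = p ^ i • (W ^ i * R) +
          qNum p i • (p ^ (i - 1) • (W ^ (i - 1) * Ωs) + W ^ (i - 1) * Ωt) := by
        cases i with
        | zero => simp [qNum_zero]
        | succ i => exact mul_pow_skew_add hRW hs ht i
      rw [add_mul, ← mul_assoc W, ← pow_succ', ← mul_assoc R, h1, qHermite_succ]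
      simp only [add_mul, mul_add, smul_mul_assoc, mul_smul_comm, smul_add, smul_smul, mul_assoc]
      module
    -- the `Ωs`-terms telescope, since `[i+j] = [i] + p^i [j]`; the rest is the `Ωt`-term
    have h2 := sum_qNum_left p n fun i j => p ^ (i - 1) • (W ^ (i - 1) * Ωs * qHermite p R Ωs j) +
            W ^ (i - 1) * Ωt * qHermite p R Ωs j
    have h3 := sum_qNum_right p n fun i j => p ^ i • (W ^ i * Ωs * qHermite p R Ωs (j - 1))
    simp only [Nat.add_sub_cancel] at h2 h3
    have h4 : ∀ i j, (p ^ i • (W ^ i * Ωs * qHermite p R Ωs j) + W ^ i * Ωt * qHermite p R Ωs j) -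
        p ^ i • (W ^ i * Ωs * qHermite p R Ωs j) = Ωt * (W ^ i * qHermite p R Ωs j) := by
      intro i j
      rw [← mul_assoc, ht', add_sub_cancel_left]
    simp only [mul_sum, mul_smul_comm, hstep, neg_mul]
    rw [sum_qBinom_succ p (n + 1) fun i j => W ^ i * qHermite p R Ωs j]
    have h5 : qNum p (n + 1) • ∑ x ∈ antidiagonal n,
        qBinom p x.1 x.2 • (Ωt * (W ^ x.1 * qHermite p R Ωs x.2)) =
        (∑ x ∈ antidiagonal (n + 1), (qNum p x.1 * qBinom p x.1 x.2) •
          (p ^ (x.1 - 1) • (W ^ (x.1 - 1) * Ωs * qHermite p R Ωs x.2) +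
            W ^ (x.1 - 1) * Ωt * qHermite p R Ωs x.2)) -
        ∑ x ∈ antidiagonal (n + 1), (qNum p x.2 * qBinom p x.1 x.2) •
          p ^ x.1 • (W ^ x.1 * Ωs * qHermite p R Ωs (x.2 - 1)) := by
      rw [h2, h3, ← smul_sub, ← sum_sub_distrib]
      simp only [← smul_sub, h4]
    simp only [smul_neg, sum_neg_distrib]
    rw [h5, ← sum_sub_distrib, ← sub_eq_add_neg, ← sum_sub_distrib]
    refine sum_congr rfl fun x _ => ?_
    module

section Primitive

variable {p : k} {N : ℕ}

theorem qHermite_add_right_primitive (hp : IsPrimitiveRoot p N) (hN : 0 < N) {Y Z Ω : E}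
    (hZY : Z * Y = p • (Y * Z))
    (hZΩ : Z * Ω = p ^ 2 • (Ω * Z)) :
    qHermite p (Y + Z) Ω N = qHermite p Y Ω N + Z ^ N := by
  rw [qHermite_add_right hZY hZΩ,
    sum_qBinom_primitive hp hN fun i j => qHermite p Y Ω i * Z ^ j]
  simp [qHermite, add_comm]

theorem qHermite_add_left_primitive (hp : IsPrimitiveRoot p N) (hN : 0 < N) {W R Ωs Ωt : E}
    (hRW : R * W = p • (W * R) + Ωs + Ωt)
    (hs : Ωs * W = p ^ 2 • (W * Ωs)) (ht : Ωt * W = W * Ωt) :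
    qHermite p (W + R) (-Ωt) N = W ^ N + qHermite p R Ωs N := by
  rw [qHermite_add_left hRW hs ht,
    sum_qBinom_primitive hp hN fun i j => W ^ i * qHermite p R Ωs j]
  simp [qHermite, add_comm]

theorem add_pow_of_skew (hp : IsPrimitiveRoot p N) (hN : 0 < N) {W R : E}
    (hRW : R * W = p • (W * R)) :
    (W + R) ^ N = W ^ N + R ^ N := by
  have h := qHermite_add_left_primitive hp hN (W := W) (R := R) (Ωs := 0) (Ωt := 0)
    (by simpa using hRW) (by simp) (by simp)
  simpa [qHermite_zero_right] using h

/-- The commutator of two summands may be an element `Ω` that `p²`-commutes with them: for odd `N`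
it does not contribute to the `N`-th power. -/
theorem add_pow_of_skew_add (hp : IsPrimitiveRoot p N) (hN : 0 < N) (hodd : Odd N) {W R Ω : E}
    (hRW : R * W = p • (W * R) + Ω)
    (hΩW : Ω * W = p ^ 2 • (W * Ω)) (hRΩ : R * Ω = p ^ 2 • (Ω * R)) :
    (W + R) ^ N = W ^ N + R ^ N := by
  have h := qHermite_add_left_primitive hp hN (W := W) (R := R) (Ωs := Ω) (Ωt := 0)
    (by simpa using hRW) hΩW (by simp)
  have h' := qHermite_add_right_primitive hp hN (Y := 0) (Z := R) (Ω := Ω) (by simp) hRΩ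
  rw [zero_add, qHermite_zero_left_odd p Ω hodd, zero_add] at h'
  rw [h'] at h
  simpa [qHermite_zero_right] using h

/-- The `q`-Hermite sequence of two scalars: the numbers `u` and `v` commute, hence they commute
up to `p` with the correction term `(1 - p) u v`. -/
theorem qHermite_field (hp : IsPrimitiveRoot p N) (hN : 0 < N) {u v : k} :
    qHermite p (u + v) (-((1 - p) * (u * v))) N = u ^ N + v ^ N := by
  rw [qHermite_add_left_primitive hp hN (W := u) (R := v) (Ωs := 0) (Ωt := (1 - p) * (u * v))
    (by simp only [smul_eq_mul]; ring) (by simp) (by ring), qHermite_zero_right]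

/-- The `N`-th term of the `q`-Hermite sequence with `Ω` a multiple of `Y²`. -/
theorem qHermite_smul_sq (hp : IsPrimitiveRoot p N) (hN : 0 < N) {u v : k} (huv : u + v = 1)
    (Y : E) :
    qHermite p Y (-((1 - p) * (u * v)) • Y ^ 2) N = (u ^ N + v ^ N) • Y ^ N := by
  rw [← qHermite_field hp hN, huv]
  refine (eq_qHermite (f := fun n => qHermite p 1 (-((1 - p) * (u * v))) n • Y ^ n)
    (by simp [qHermite]) (by simp [qHermite]) (fun n => ?_) N).symm
  simp only [qHermite, one_mul, smul_eq_mul, pow_succ', smul_mul_assoc, mul_smul_comm, mul_assoc,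
    pow_zero, mul_one]
  module

/-- Three summands, the product of the outer two being a multiple of the square of the middle
one up to `p`-commutation. -/
theorem add_add_pow_of_sq (hp : IsPrimitiveRoot p N) (hN : 0 < N) {u v : k} (huv : u + v = 1)
    {W Y Z : E} (hYW : Y * W = p • (W * Y))
    (hZY : Z * Y = p • (Y * Z)) (hZW : Z * W = p • (W * Z) - ((1 - p) * (u * v)) • Y ^ 2) :
    (W + (Y + Z)) ^ N = W ^ N + (u ^ N + v ^ N) • Y ^ N + Z ^ N := by
  have hYW2 : Y ^ 2 * W = p ^ 2 • (W * Y ^ 2) := by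
    rw [pow_two, mul_assoc, hYW, mul_smul_comm, ← mul_assoc, hYW, smul_mul_assoc, smul_smul,
      mul_assoc, pow_two]
  have hZY2 := pow_skew hZY 2
  have h := qHermite_add_left_primitive hp hN (W := W) (R := Y + Z)
    (Ωs := -((1 - p) * (u * v)) • Y ^ 2) (Ωt := 0)
    (by rw [add_mul, hYW, hZW, mul_add, smul_add, add_zero, neg_smul]; abel)
    (by rw [smul_mul_assoc, hYW2, mul_smul_comm, smul_comm]) (by simp)
  rw [neg_zero, qHermite_zero_right, qHermite_add_right_primitive hp hN hZY
    (by rw [mul_smul_comm, hZY2, smul_mul_assoc, smul_comm]), qHermite_smul_sq hp hN huv] at h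
  rw [h, add_assoc]

/-- Five summands `T₁, …, T₅`, as for the coordinates of a quantum orthogonal space of dimension
five.  The correction `Ω` enters when `T₁` is split off and cancels when `T₂` is. -/
theorem add_pow_five (hp : IsPrimitiveRoot p N) (hN : 0 < N) {u v : k} (huv : u + v = 1)
    {T₁ T₂ T₃ T₄ T₅ Ω : E}
    (h21 : T₂ * T₁ = p • (T₁ * T₂)) (h31 : T₃ * T₁ = p • (T₁ * T₃)) (h41 : T₄ * T₁ = p • (T₁ * T₄))
    (h51 : T₅ * T₁ = p • (T₁ * T₅) + Ω) (h32 : T₃ * T₂ = p • (T₂ * T₃))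
    (h42 : T₄ * T₂ = p • (T₂ * T₄) - ((1 - p) * (u * v)) • T₃ ^ 2 - Ω)
    (h52 : T₅ * T₂ = p • (T₂ * T₅)) (h43 : T₄ * T₃ = p • (T₃ * T₄)) (h53 : T₅ * T₃ = p • (T₃ * T₅))
    (h54 : T₅ * T₄ = p • (T₄ * T₅)) (hΩ1 : Ω * T₁ = p ^ 2 • (T₁ * Ω)) (hΩ2 : Ω * T₂ = T₂ * Ω)
    (h5Ω : T₅ * Ω = p ^ 2 • (Ω * T₅)) :
    (T₁ + (T₂ + (T₃ + T₄) + T₅)) ^ N =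
      T₁ ^ N + (T₂ ^ N + ((u ^ N + v ^ N) • T₃ ^ N + T₄ ^ N) + T₅ ^ N) := by
  have h := qHermite_add_left_primitive hp hN (W := T₁) (R := T₂ + (T₃ + T₄) + T₅) (Ωs := Ω)
    (Ωt := 0) (by simp only [add_mul, mul_add, smul_add, h21, h31, h41, h51]; abel) hΩ1 (by simp)
  have h32' : T₃ ^ 2 * T₂ = p ^ 2 • (T₂ * T₃ ^ 2) := by
    rw [pow_two, mul_assoc, h32, mul_smul_comm, ← mul_assoc, h32, smul_mul_assoc, smul_smul,
      mul_assoc, pow_two]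
  have h43' := pow_skew h43 2
  have h2 := qHermite_add_left_primitive hp hN (W := T₂) (R := T₃ + T₄)
    (Ωs := -((1 - p) * (u * v)) • T₃ ^ 2) (Ωt := -Ω)
    (by rw [add_mul, h32, h42, mul_add, smul_add, neg_smul]; abel)
    (by rw [smul_mul_assoc, h32', mul_smul_comm, smul_comm])
    (by rw [neg_mul, mul_neg, hΩ2])
  rw [neg_neg, qHermite_add_right_primitive hp hN h43
    (by rw [mul_smul_comm, h43', smul_mul_assoc, smul_comm]), qHermite_smul_sq hp hN huv] at h2
  rw [neg_zero, qHermite_zero_right, qHermite_add_right_primitive hp hN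
    (by simp only [add_mul, mul_add, smul_add, h52, h53, h54]) h5Ω, h2] at h
  exact h

end Primitive

end QPower

/-! ### Skew commutators and the scalars of a braiding of type `B_3` -/

section Skew

variable {k E : Type*} [Field k] [Ring E] [Algebra k E]

/-- `x u = c u x + u'`: the `c`-commutator of `x` and `u` is `u'`. -/
def HasBracket (c : k) (x u u' : E) : Prop := x * u = c • (u * x) + u'

/-- `x` and `u` commute up to the scalar `c`: `x u = c u x`. -/
def Skew (c : k) (x u : E) : Prop := x * u = c • (u * x)

theorem Skew.hasBracket {c : k} {x u : E} (h : Skew c x u) : HasBracket c x u 0 := by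
  rw [HasBracket, add_zero]; exact h

theorem HasBracket.skew {c : k} {x u : E} (h : HasBracket c x u 0) : Skew c x u := by
  rw [HasBracket, add_zero] at h; exact h

theorem HasBracket.congr {c d : k} {x u v w : E} (h : HasBracket c x u v) (hc : c = d)
    (hv : v = w) : HasBracket d x u w := hc ▸ hv ▸ h

theorem HasBracket.unique {c d : k} {x u v w : E} (h : HasBracket c x u v)
    (h' : HasBracket d x u w) (hc : c = d) : v = w := by
  subst hc
  exact add_left_cancel (h.symm.trans h')

/-- Bracketing with `x` is a skew derivation, applied here to both sides of `u v = c v u + w`. -/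
theorem HasBracket.derive {a b c : k} {x u u' v v' w : E} (hu : HasBracket a x u u')
    (hv : HasBracket b x v v') (hw : HasBracket c u v w) :
    HasBracket (a * b) x w (u' * v + a • (u * v') - c • (v' * u + b • (v * u'))) := by
  have h1 : w = u * v - c • (v * u) := by rw [hw]; abel
  have h2 : x * (u * v) = (a * b) • (u * v * x) + (u' * v + a • (u * v')) := by
    rw [← mul_assoc, hu, add_mul, smul_mul_assoc, mul_assoc, hv]
    simp only [mul_add, mul_smul_comm, smul_add, mul_assoc]
    module
  have h3 : x * (v * u) = (a * b) • (v * u * x) + (v' * u + b • (v * u')) := by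
    rw [← mul_assoc, hv, add_mul, smul_mul_assoc, mul_assoc, hu]
    simp only [mul_add, mul_smul_comm, smul_add, mul_assoc]
    module
  rw [HasBracket, h1, mul_sub, mul_smul_comm, h2, h3, sub_mul, smul_mul_assoc]
  module

/-- Bracketing with `x` is a skew derivation, applied here to a product. -/
theorem HasBracket.mul {a b : k} {x u u' v v' : E} (hu : HasBracket a x u u')
    (hv : HasBracket b x v v') : HasBracket (a * b) x (u * v) (u' * v + a • (u * v')) := by
  rw [HasBracket, ← mul_assoc, hu, add_mul, smul_mul_assoc, mul_assoc, hv]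
  simp only [mul_add, mul_smul_comm, smul_add, mul_assoc]
  module

theorem HasBracket.smul {a : k} {x u u' : E} (hu : HasBracket a x u u') (c : k) :
    HasBracket a x (c • u) (c • u') := by
  rw [HasBracket, mul_smul_comm, hu, smul_mul_assoc]
  module

theorem HasBracket.sub {a : k} {x u u' v v' : E} (hu : HasBracket a x u u')
    (hv : HasBracket a x v v') : HasBracket a x (u - v) (u' - v') := by
  rw [HasBracket, mul_sub, hu, hv, sub_mul]
  module

/-- The relation obtained by bracketing `u v = c v u` with `x`. -/
theorem HasBracket.derive_skew {a b c : k} {x u u' v v' : E} (hu : HasBracket a x u u')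
    (hv : HasBracket b x v v') (hw : Skew c u v) :
    u' * v + a • (u * v') = c • (v' * u + b • (v * u')) := by
  have h := (hu.derive hv hw.hasBracket).unique (w := 0) (d := a * b) (by simp [HasBracket]) rfl
  exact sub_eq_zero.1 h

/-- The mirror image of `HasBracket.derive`, with `x` multiplied from the right. -/
theorem HasBracket.derive_right {a b c : k} {x u u' v v' w : E} (hu : HasBracket a u x u')
    (hv : HasBracket b v x v') (hw : HasBracket c u v w) :
    HasBracket (a * b) w x (u * v' + b • (u' * v) - c • (v * u' + a • (v' * u))) := by
  have h1 : w = u * v - c • (v * u) := by rw [hw]; abel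
  have h2 : u * v * x = (a * b) • (x * (u * v)) + (u * v' + b • (u' * v)) := by
    rw [mul_assoc, hv, mul_add, mul_smul_comm, ← mul_assoc, hu]
    simp only [add_mul, smul_mul_assoc, smul_add, mul_assoc]
    module
  have h3 : v * u * x = (a * b) • (x * (v * u)) + (v * u' + a • (v' * u)) := by
    rw [mul_assoc, hu, mul_add, mul_smul_comm, ← mul_assoc, hv]
    simp only [add_mul, smul_mul_assoc, smul_add, mul_assoc]
    module
  rw [HasBracket, h1, sub_mul, smul_mul_assoc, h2, h3, mul_sub, mul_smul_comm]
  module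

theorem HasBracket.mul_right {a b : k} {x u u' v v' : E} (hu : HasBracket a u x u')
    (hv : HasBracket b v x v') : HasBracket (a * b) (u * v) x (u * v' + b • (u' * v)) := by
  rw [HasBracket, mul_assoc, hv, mul_add, mul_smul_comm, ← mul_assoc, hu]
  simp only [add_mul, smul_mul_assoc, smul_add, mul_assoc]
  module

theorem HasBracket.smul_right {a : k} {x u u' : E} (hu : HasBracket a u x u') (c : k) :
    HasBracket a (c • u) x (c • u') := by
  rw [HasBracket, smul_mul_assoc, hu, mul_smul_comm]
  module

theorem HasBracket.derive_right_skew {a b c : k} {x u u' v v' : E} (hu : HasBracket a u x u')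
    (hv : HasBracket b v x v') (hw : Skew c u v) :
    u * v' + b • (u' * v) = c • (v * u' + a • (v' * u)) := by
  have h := hu.derive_right hv hw.hasBracket
  rw [HasBracket, zero_mul, mul_zero, smul_zero, zero_add] at h
  exact sub_eq_zero.1 h.symm

theorem Skew.congr {c d : k} {x u : E} (h : Skew c x u) (hc : c = d) : Skew d x u := hc ▸ h

theorem Skew.symm {c d : k} {x u : E} (h : Skew c x u) (hc : d * c = 1) : Skew d u x := by
  rw [Skew, h, smul_smul, hc, one_smul]

theorem Skew.mul_left {c d : k} {x y u : E} (hx : Skew c x u) (hy : Skew d y u) :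
    Skew (c * d) (x * y) u := by
  rw [Skew, mul_assoc, hy, mul_smul_comm, ← mul_assoc, hx, smul_mul_assoc, smul_smul, mul_assoc,
    mul_comm d]

theorem Skew.mul_right {c d : k} {x u v : E} (hu : Skew c x u) (hv : Skew d x v) :
    Skew (c * d) x (u * v) := by
  rw [Skew, ← mul_assoc, hu, smul_mul_assoc, mul_assoc, hv, mul_smul_comm, smul_smul, mul_assoc]

theorem Skew.smul_left {c : k} {x u : E} (h : Skew c x u) (a : k) : Skew c (a • x) u := by
  rw [Skew, smul_mul_assoc, h, mul_smul_comm, smul_comm]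

theorem Skew.smul_right {c : k} {x u : E} (h : Skew c x u) (a : k) : Skew c x (a • u) := by
  rw [Skew, mul_smul_comm, h, smul_mul_assoc, smul_comm]

theorem Skew.add_left {c : k} {x y u : E} (hx : Skew c x u) (hy : Skew c y u) :
    Skew c (x + y) u := by
  rw [Skew, add_mul, hx, hy, mul_add, smul_add]

theorem Skew.add_right {c : k} {x u v : E} (hu : Skew c x u) (hv : Skew c x v) :
    Skew c x (u + v) := by
  rw [Skew, mul_add, hu, hv, add_mul, smul_add]

theorem Skew.sub_left {c : k} {x y u : E} (hx : Skew c x u) (hy : Skew c y u) :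
    Skew c (x - y) u := by
  rw [Skew, sub_mul, hx, hy, mul_sub, smul_sub]

theorem Skew.sub_right {c : k} {x u v : E} (hu : Skew c x u) (hv : Skew c x v) :
    Skew c x (u - v) := by
  rw [Skew, mul_sub, hu, hv, sub_mul, smul_sub]

/-- Two products `a b` and `a' b'`, when the factors commute up to scalars. -/
theorem Skew.mul_mul {c d e f m : k} {a b a' b' : E} (ha : Skew d a a') (hb : Skew e b b')
    (hba' : Skew c b a') (hb'a : Skew f b' a) (h : c * d * e = m * f) :
    Skew m (a * b) (a' * b') := by
  have h1 : a * b * (a' * b') = (c * d * e) • (a' * a * (b' * b)) := by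
    calc a * b * (a' * b') = a * (b * a') * b' := by simp only [mul_assoc]
      _ = c • (a * a' * (b * b')) := by
        rw [hba', mul_smul_comm, smul_mul_assoc]; simp only [mul_assoc]
      _ = _ := by
        rw [ha, hb, smul_mul_assoc, mul_smul_comm, smul_smul, smul_smul, mul_assoc]
  have h2 : a' * b' * (a * b) = f • (a' * a * (b' * b)) := by
    calc a' * b' * (a * b) = a' * (b' * a) * b := by simp only [mul_assoc]
      _ = _ := by rw [hb'a, mul_smul_comm, smul_mul_assoc]; simp only [mul_assoc]
  rw [Skew, h1, h2, smul_smul, h]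

end Skew

namespace YDDatum

variable {k Γ : Type*} [Field k] [CommGroup Γ] {D : YDDatum k Γ (Fin 3)}

@[simp] theorem q_ne_zero (i j : Fin 3) : D.q i j ≠ 0 := by simp [q]

theorem qRoot_eq_prod (α β : PosRoot) :
    D.qRoot α β = ∏ i, ∏ j, D.q i j ^ (α.coord i * β.coord j) := by
  simp only [qRoot, χRoot, gRoot, q, MonoidHom.finsetProd_apply, MonoidHom.pow_apply, map_prod,
    map_pow, Units.coe_prod, Units.val_pow_eq_pow_val]
  refine Finset.prod_congr rfl fun i _ => ?_
  rw [← Finset.prod_pow]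
  exact Finset.prod_congr rfl fun j _ => by rw [← pow_mul, mul_comm]

/-- The entries of a braiding matrix of type `B_3` in terms of `q_{33}`, `q_{12}`, `q_{13}`
and `q_{23}`. -/
theorem IsCartanB3.q_eq (h : D.IsCartanB3) : D.q 0 0 = D.q 2 2 ^ 2 ∧ D.q 1 1 = D.q 2 2 ^ 2 ∧
    D.q 1 0 = (D.q 2 2 ^ 2 * D.q 0 1)⁻¹ ∧ D.q 2 0 = (D.q 0 2)⁻¹ ∧
    D.q 2 1 = (D.q 2 2 ^ 2 * D.q 1 2)⁻¹ := by
  have hne := D.q_ne_zero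
  have h01 := h 0 1
  have h10 := h 1 0
  have h02 := h 0 2
  have h12 := h 1 2
  have h21 := h 2 1
  simp [cartanB3] at h01 h10 h02 h12 h21
  have e1 : D.q 1 1 = D.q 2 2 ^ 2 := by
    have : (D.q 1 1)⁻¹ = (D.q 2 2 ^ 2)⁻¹ := by
      rw [← h12, mul_comm, h21]
    exact inv_injective this
  have e0 : D.q 0 0 = D.q 2 2 ^ 2 := by
    rw [← e1]
    exact inv_injective (by rw [← h01, mul_comm, h10])
  refine ⟨e0, e1, ?_, ?_, ?_⟩
  · rw [mul_inv, ← e0, ← h01]; field_simp [hne 0 1]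
  · exact eq_inv_of_mul_eq_one_right h02
  · rw [mul_inv, ← e1, ← h12]; field_simp [hne 1 2]

theorem pow_q_ne_one (hN : 5 < D.N) {n : ℕ} (h0 : n ≠ 0) (hn : n < 6) : D.q 2 2 ^ n ≠ 1 := by
  intro h
  have := Nat.le_of_dvd (Nat.pos_of_ne_zero h0) (orderOf_dvd_of_pow_eq_one h)
  rw [N] at hN
  omega

theorem one_add_q_ne_zero (hN : 5 < D.N) : 1 + D.q 2 2 ≠ 0 := fun h =>
  pow_q_ne_one hN (n := 2) (by simp) (by simp) (by linear_combination (D.q 2 2 - 1) * h)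

theorem one_add_q_sq_ne_zero (hN : 5 < D.N) : 1 + D.q 2 2 ^ 2 ≠ 0 := fun h =>
  pow_q_ne_one hN (n := 4) (by simp) (by simp) (by linear_combination (D.q 2 2 ^ 2 - 1) * h)

theorem one_add_q_add_q_sq_ne_zero (hN : 5 < D.N) : 1 + D.q 2 2 + D.q 2 2 ^ 2 ≠ 0 := fun h =>
  pow_q_ne_one hN (n := 3) (by simp) (by simp) (by linear_combination (D.q 2 2 - 1) * h)

/-- The scalars `q_{α,β}` for a braiding of type `B_3`, as monomials in the four free
entries of the braiding matrix. -/
theorem IsCartanB3.qRoot_eq (h : D.IsCartanB3) (α β : PosRoot) : D.qRoot α β =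
    D.q 2 2 ^ (2 * (α.coord 0 * β.coord 0) + 2 * (α.coord 1 * β.coord 1) +
      α.coord 2 * β.coord 2) *
    D.q 0 1 ^ (α.coord 0 * β.coord 1) * D.q 0 2 ^ (α.coord 0 * β.coord 2) *
    D.q 1 2 ^ (α.coord 1 * β.coord 2) * (D.q 2 2 ^ 2 * D.q 0 1)⁻¹ ^ (α.coord 1 * β.coord 0) *
    (D.q 0 2)⁻¹ ^ (α.coord 2 * β.coord 0) *
    (D.q 2 2 ^ 2 * D.q 1 2)⁻¹ ^ (α.coord 2 * β.coord 1) := by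
  obtain ⟨h0, h1, h2, h3, h4⟩ := h.q_eq
  rw [qRoot_eq_prod]
  simp only [Fin.prod_univ_three, h0, h1, h2, h3, h4, pow_add, pow_mul]
  ring

section Relations

variable {E : Type*} [Ring E] [Algebra k E]

open PosRoot

/-- The quantum Serre relations of type `B_3`. -/
structure IsSerre (D : YDDatum k Γ (Fin 3)) (y : Fin 3 → E) : Prop where
  skew_a3_a1 : Skew (D.qRoot a3 a1) (D.rootVec y a3) (D.rootVec y a1)
  skew_a21_a1 : Skew (D.qRoot a21 a1) (D.rootVec y a21) (D.rootVec y a1)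
  skew_a2_a21 : Skew (D.qRoot a2 a21) (D.rootVec y a2) (D.rootVec y a21)
  skew_a32_a2 : Skew (D.qRoot a32 a2) (D.rootVec y a32) (D.rootVec y a2)
  skew_a3_a3t2 : Skew (D.qRoot a3 a3t2) (D.rootVec y a3) (D.rootVec y a3t2)

theorem brk_hasBracket (α β : PosRoot) (u v : E) :
    HasBracket (D.qRoot α β) u v (D.brk α β u v) := by
  rw [HasBracket, brk]; abel

variable (y : Fin 3 → E)

theorem br_a2_a1 : HasBracket (D.qRoot a2 a1) (D.rootVec y a2) (D.rootVec y a1)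
    (D.rootVec y a21) := brk_hasBracket ..

theorem br_a3_a2 : HasBracket (D.qRoot a3 a2) (D.rootVec y a3) (D.rootVec y a2)
    (D.rootVec y a32) := brk_hasBracket ..

theorem br_a3_a21 : HasBracket (D.qRoot a3 a21) (D.rootVec y a3) (D.rootVec y a21)
    (D.rootVec y a31) := brk_hasBracket ..

theorem br_a3_a32 : HasBracket (D.qRoot a3 a32) (D.rootVec y a3) (D.rootVec y a32)
    (D.rootVec y a3t2) := brk_hasBracket ..

theorem br_a3_a31 : HasBracket (D.qRoot a3 a31) (D.rootVec y a3) (D.rootVec y a31)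
    (D.rootVec y a3t1) := brk_hasBracket ..

theorem br_a2_a3t1 : HasBracket (D.qRoot a2 a3t1) (D.rootVec y a2) (D.rootVec y a3t1)
    (D.rootVec y a2t1) := brk_hasBracket ..

end Relations

end YDDatum

/-! ### Commutation relations between root vectors

Each relation follows from earlier ones by bracketing with a further element, a skew derivation
(`HasBracket.derive`).  Once both sides are written as combinations of the same monomials in the
root vectors, `match_scalars` leaves identities between rational functions of the `q_{ij}`.
-/

namespace YDDatum
variable {k Γ : Type*} [Field k] [CommGroup Γ] {D : YDDatum k Γ (Fin 3)}

namespace IsSerre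

open PosRoot

variable {E : Type*} [Ring E] [Algebra k E] {y : Fin 3 → E}

theorem br_a32_a1 (hB : D.IsCartanB3) (hy : D.IsSerre y) :
    HasBracket (D.qRoot a32 a1) (D.rootVec y a32) (D.rootVec y a1) (D.rootVec y a31) := by
  have h := ((br_a3_a2 y).derive hy.skew_a3_a1.hasBracket (br_a2_a1 y)).unique (br_a3_a21 y)
    (by simp [hB.qRoot_eq, coord]; field_simp)
  rw [HasBracket, ← h]
  simp only [mul_zero, zero_mul, smul_zero, add_zero, zero_add]
  match_scalars <;> simp [hB.qRoot_eq, coord]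

theorem br_a3t2_a1 (hB : D.IsCartanB3) (hy : D.IsSerre y) :
    HasBracket (D.qRoot a3t2 a1) (D.rootVec y a3t2) (D.rootVec y a1) (D.rootVec y a3t1) := by
  have h := ((br_a3_a32 y).derive hy.skew_a3_a1.hasBracket (hy.br_a32_a1 hB)).unique (br_a3_a31 y)
    (by simp [hB.qRoot_eq, coord]; field_simp)
  rw [HasBracket, ← h]
  simp only [mul_zero, zero_mul, smul_zero, add_zero, zero_add]
  match_scalars <;> simp [hB.qRoot_eq, coord] <;> field_simp <;> ring

theorem skew_a3_a3t1 (hB : D.IsCartanB3) (hy : D.IsSerre y) :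
    Skew (D.qRoot a3 a3t1) (D.rootVec y a3) (D.rootVec y a3t1) := by
  have h := hy.skew_a3_a3t2.hasBracket.derive hy.skew_a3_a1.hasBracket (hy.br_a3t2_a1 hB)
  exact (h.congr (by simp [hB.qRoot_eq, coord]; field_simp) (by simp)).skew

theorem skew_a2_a32 (hy : D.IsSerre y) :
    Skew (D.qRoot a32 a2)⁻¹ (D.rootVec y a2) (D.rootVec y a32) :=
  hy.skew_a32_a2.symm (inv_mul_cancel₀ (by simp [qRoot]))

/-- Two relations combine to the claim times the nonzero factor `1 + q_{33}²`. -/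
theorem skew_a2_a31 (hB : D.IsCartanB3) (hN : 5 < D.N) (hy : D.IsSerre y) :
    Skew (D.qRoot a2 a31) (D.rootVec y a2) (D.rootVec y a31) := by
  have e1 := hy.skew_a2_a32.hasBracket.derive (br_a2_a1 y) (hy.br_a32_a1 hB)
  have e2 := (br_a3_a2 y).derive_skew (br_a3_a21 y) hy.skew_a2_a21
  simp only [HasBracket, mul_zero, zero_mul, smul_zero, add_zero, zero_add] at e1 e2
  refine smul_right_injective E (one_add_q_sq_ne_zero hN) ?_
  simp only
  linear_combination (norm := skip) (D.q 2 2 ^ 2) • e1 + (D.q 2 2 ^ 2 * D.q 1 2) • e2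
  match_scalars <;> simp [hB.qRoot_eq, coord] <;> field_simp <;> ring

theorem mul_a3t2_a2 (hB : D.IsCartanB3) (hy : D.IsSerre y) :
    HasBracket (D.qRoot a3t2 a2) (D.rootVec y a3t2) (D.rootVec y a2)
      ((D.qRoot a32 a2 - D.qRoot a3 a32) • (D.rootVec y a32 * D.rootVec y a32)) := by
  have e := (br_a3_a32 y).derive_skew (br_a3_a2 y) hy.skew_a32_a2
  simp only [HasBracket] at e ⊢
  linear_combination (norm := skip) e
  match_scalars <;> simp [hB.qRoot_eq, coord] <;> field_simp <;> ring

theorem skew_a3t2_a32 (hB : D.IsCartanB3) (hy : D.IsSerre y) :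
    Skew (D.qRoot a3t2 a32) (D.rootVec y a3t2) (D.rootVec y a32) := by
  have e := (hy.skew_a3_a3t2.hasBracket.derive (br_a3_a2 y) (hy.mul_a3t2_a2 hB)).unique
    (((br_a3_a32 y).mul (br_a3_a32 y)).smul _) (by simp [hB.qRoot_eq, coord]; field_simp)
  simp only [mul_zero, zero_mul, smul_zero, add_zero, zero_add, Skew] at e ⊢
  linear_combination (norm := skip) (D.q 2 2 * D.q 1 2) • e
  match_scalars <;> simp [hB.qRoot_eq, coord] <;> field_simp <;> ring

theorem br_a32_a31_aux (hB : D.IsCartanB3) (hN : 5 < D.N) (hy : D.IsSerre y) :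
    HasBracket (D.qRoot a32 a31) (D.rootVec y a32) (D.rootVec y a31)
      (D.qRoot a2 a31 • (D.rootVec y a3t1 * D.rootVec y a2) -
        D.qRoot a3 a2 • (D.rootVec y a2 * D.rootVec y a3t1)) := by
  have e := (br_a3_a2 y).derive_skew (br_a3_a31 y) (hy.skew_a2_a31 hB hN)
  simp only [HasBracket] at e ⊢
  linear_combination (norm := skip) e
  match_scalars <;> simp [hB.qRoot_eq, coord] <;> field_simp <;> ring

theorem br_a32_a31 (hB : D.IsCartanB3) (hN : 5 < D.N) (hy : D.IsSerre y) :
    HasBracket (D.qRoot a32 a31) (D.rootVec y a32) (D.rootVec y a31)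
      ((D.qRoot a2 a31 * (1 - (D.q 2 2 ^ 2)⁻¹)) • (D.rootVec y a3t1 * D.rootVec y a2) -
        D.qRoot a3 a2 • D.rootVec y a2t1) := by
  have e1 := hy.br_a32_a31_aux hB hN
  have e2 := br_a2_a3t1 (D := D) y
  simp only [HasBracket] at e1 e2 ⊢
  linear_combination (norm := skip) e1 - D.qRoot a3 a2 • e2
  match_scalars <;> simp [hB.qRoot_eq, coord] <;> field_simp <;> ring

/-- Two relations combine to the claim times the nonzero factor `1 + q_{33} + q_{33}²`. -/
theorem skew_a32_a3t1 (hB : D.IsCartanB3) (hN : 5 < D.N) (hy : D.IsSerre y) :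
    Skew (D.qRoot a32 a3t1) (D.rootVec y a32) (D.rootVec y a3t1) := by
  have e1 := (hy.skew_a3t2_a32 hB).symm (d := D.q 1 2) (by simp [hB.qRoot_eq, coord]; field_simp)
    |>.hasBracket.derive
    (hy.br_a32_a1 hB) (hy.br_a3t2_a1 hB)
  have e2 := ((br_a3_a32 y).derive (br_a3_a31 y) (hy.br_a32_a31_aux hB hN)).unique
    ((((hy.skew_a3_a3t1 hB).hasBracket.mul (br_a3_a2 y)).smul _).sub
      ((((br_a3_a2 y).mul (hy.skew_a3_a3t1 hB).hasBracket).congr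
        (by simp [hB.qRoot_eq, coord]; field_simp) rfl).smul _))
        (by simp [hB.qRoot_eq, coord]; field_simp)
  simp only [mul_zero, zero_mul, smul_zero, add_zero, zero_add, HasBracket, Skew] at e1 e2 ⊢
  refine smul_right_injective E (one_add_q_add_q_sq_ne_zero hN) ?_
  simp only
  linear_combination (norm := skip) (D.q 2 2 ^ 2) • e1 + (D.q 2 2 ^ 2 * D.q 1 2) • e2
  match_scalars <;> simp [hB.qRoot_eq, coord] <;> field_simp <;> ring

theorem skew_a3_a2t1 (hB : D.IsCartanB3) (hN : 5 < D.N) (hy : D.IsSerre y) :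
    Skew (D.qRoot a3 a2t1) (D.rootVec y a3) (D.rootVec y a2t1) := by
  have h := (br_a3_a2 y).derive (hy.skew_a3_a3t1 hB).hasBracket (br_a2_a3t1 y)
  refine (h.congr (by simp [hB.qRoot_eq, coord]; field_simp) ?_).skew
  rw [hy.skew_a32_a3t1 hB hN]
  simp only [mul_zero, zero_mul, smul_zero, add_zero, zero_add]
  match_scalars <;> simp [hB.qRoot_eq, coord] <;> field_simp <;> ring

theorem skew_a3t2_a3t1 (hB : D.IsCartanB3) (hN : 5 < D.N) (hy : D.IsSerre y) :
    Skew (D.qRoot a3t2 a3t1) (D.rootVec y a3t2) (D.rootVec y a3t1) := by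
  have e := (br_a3_a32 y).derive_skew (hy.skew_a3_a3t1 hB).hasBracket (hy.skew_a32_a3t1 hB hN)
  simp only [mul_zero, zero_mul, smul_zero, add_zero, zero_add, Skew] at e ⊢
  linear_combination (norm := skip) e
  match_scalars <;> simp [hB.qRoot_eq, coord] <;> field_simp <;> ring

theorem skew_a2_a2t1 (hB : D.IsCartanB3) (hN : 5 < D.N) (hy : D.IsSerre y) :
    Skew (D.qRoot a2 a2t1) (D.rootVec y a2) (D.rootVec y a2t1) := by
  have e1 := hy.skew_a2_a32.hasBracket.derive (hy.skew_a2_a31 hB hN).hasBracket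
    (hy.br_a32_a31 hB hN)
  have e2 := congrArg (· * D.rootVec y a2) (br_a2_a3t1 (D := D) y)
  simp only [HasBracket, Skew, mul_zero, zero_mul, smul_zero, add_zero, sub_zero, mul_sub, sub_mul,
    add_mul, mul_smul_comm, smul_mul_assoc,
    ← mul_assoc] at e1 e2 ⊢
  linear_combination (norm := skip) (-(D.q 2 2 ^ 2 * D.q 1 2)) • e1 +
    (D.q 2 2 ^ 2 * D.q 1 2 * (D.qRoot a2 a31 * (1 - (D.q 2 2 ^ 2)⁻¹))) • e2
  match_scalars <;> simp [hB.qRoot_eq, coord] <;> field_simp <;> ring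

theorem skew_a31_a1 (hB : D.IsCartanB3) (hy : D.IsSerre y) :
    Skew (D.qRoot a31 a1) (D.rootVec y a31) (D.rootVec y a1) := by
  have e := (br_a3_a21 y).derive_skew hy.skew_a3_a1.hasBracket hy.skew_a21_a1
  simp only [mul_zero, zero_mul, smul_zero, add_zero, zero_add, Skew] at e ⊢
  linear_combination (norm := skip) e
  match_scalars <;> simp [hB.qRoot_eq, coord]

theorem skew_a3t1_a1 (hB : D.IsCartanB3) (hy : D.IsSerre y) :
    Skew (D.qRoot a3t1 a1) (D.rootVec y a3t1) (D.rootVec y a1) := by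
  have e := (br_a3_a31 y).derive_skew hy.skew_a3_a1.hasBracket (hy.skew_a31_a1 hB)
  simp only [mul_zero, zero_mul, smul_zero, add_zero, zero_add, Skew] at e ⊢
  linear_combination (norm := skip) e
  match_scalars <;> simp [hB.qRoot_eq, coord] <;> field_simp <;> ring

theorem skew_a31_a21 (hB : D.IsCartanB3) (hN : 5 < D.N) (hy : D.IsSerre y) :
    Skew (D.qRoot a31 a21) (D.rootVec y a31) (D.rootVec y a21) := by
  have e := (hy.skew_a2_a31 hB hN).hasBracket.derive_skew (br_a2_a1 y) (hy.skew_a31_a1 hB)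
  simp only [mul_zero, zero_mul, smul_zero, add_zero, zero_add, Skew] at e ⊢
  linear_combination (norm := skip) (D.qRoot a2 a31)⁻¹ • e
  match_scalars <;> simp [hB.qRoot_eq, coord] <;> field_simp <;> ring

theorem br_a3t1_a21 (hB : D.IsCartanB3) (hN : 5 < D.N) (hy : D.IsSerre y) :
    HasBracket (D.qRoot a3t1 a21) (D.rootVec y a3t1) (D.rootVec y a21)
      ((D.qRoot a31 a21 - D.qRoot a3 a31) • (D.rootVec y a31 * D.rootVec y a31)) := by
  have e := (br_a3_a31 y).derive_skew (br_a3_a21 y) (hy.skew_a31_a21 hB hN)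
  simp only [HasBracket] at e ⊢
  linear_combination (norm := skip) e
  match_scalars <;> simp [hB.qRoot_eq, coord] <;> field_simp <;> ring

theorem skew_a3t1_a31 (hB : D.IsCartanB3) (hN : 5 < D.N) (hy : D.IsSerre y) :
    Skew (D.qRoot a3t1 a31) (D.rootVec y a3t1) (D.rootVec y a31) := by
  have e := ((hy.skew_a3_a3t1 hB).hasBracket.derive (br_a3_a21 y) (hy.br_a3t1_a21 hB hN)).unique
    (((br_a3_a31 y).mul (br_a3_a31 y)).smul _) (by simp [hB.qRoot_eq, coord]; field_simp)
  simp only [mul_zero, zero_mul, smul_zero, add_zero, zero_add, Skew] at e ⊢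
  linear_combination (norm := skip) (D.q 2 2 * D.q 0 2 * D.q 1 2) • e
  match_scalars <;> simp [hB.qRoot_eq, coord] <;> field_simp <;> ring

theorem skew_a2t1_a31 (hB : D.IsCartanB3) (hN : 5 < D.N) (hy : D.IsSerre y) :
    Skew (D.qRoot a2t1 a31) (D.rootVec y a2t1) (D.rootVec y a31) := by
  have e := (br_a2_a3t1 y).derive_skew (hy.skew_a2_a31 hB hN).hasBracket (hy.skew_a3t1_a31 hB hN)
  simp only [mul_zero, zero_mul, smul_zero, add_zero, zero_add, Skew] at e ⊢
  linear_combination (norm := skip) e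
  match_scalars <;> simp [hB.qRoot_eq, coord] <;> field_simp <;> ring

theorem skew_a2t1_a3t1 (hB : D.IsCartanB3) (hN : 5 < D.N) (hy : D.IsSerre y) :
    Skew (D.qRoot a2t1 a3t1) (D.rootVec y a2t1) (D.rootVec y a3t1) := by
  have e := (hy.skew_a3_a2t1 hB hN).hasBracket.derive_skew (br_a3_a31 y) (hy.skew_a2t1_a31 hB hN)
  simp only [mul_zero, zero_mul, smul_zero, add_zero, zero_add, Skew] at e ⊢
  linear_combination (norm := skip) (D.qRoot a3 a2t1)⁻¹ • e
  match_scalars <;> simp [hB.qRoot_eq, coord] <;> field_simp <;> ring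

theorem skew_a2t1_a21 (hB : D.IsCartanB3) (hN : 5 < D.N) (hy : D.IsSerre y) :
    Skew (D.qRoot a2t1 a21) (D.rootVec y a2t1) (D.rootVec y a21) := by
  have e := ((br_a2_a3t1 y).derive hy.skew_a2_a21.hasBracket (hy.br_a3t1_a21 hB hN)).unique
    (((hy.skew_a2_a31 hB hN).hasBracket.mul (hy.skew_a2_a31 hB hN).hasBracket).smul _)
      (by simp [hB.qRoot_eq, coord]; field_simp)
  simp only [mul_zero, zero_mul, smul_zero, add_zero, zero_add, Skew] at e ⊢
  linear_combination (norm := skip) e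
  match_scalars <;> simp [hB.qRoot_eq, coord] <;> field_simp <;> ring

theorem br_a2t1_a1 (hB : D.IsCartanB3) (hy : D.IsSerre y) :
    HasBracket (D.qRoot a2t1 a1) (D.rootVec y a2t1) (D.rootVec y a1)
      (D.qRoot a3t1 a1 • (D.rootVec y a21 * D.rootVec y a3t1) -
        D.qRoot a2 a3t1 • (D.rootVec y a3t1 * D.rootVec y a21)) := by
  have e := (br_a2_a3t1 y).derive_skew (br_a2_a1 y) (hy.skew_a3t1_a1 hB)
  simp only [HasBracket] at e ⊢
  linear_combination (norm := skip) e
  match_scalars <;> simp [hB.qRoot_eq, coord] <;> field_simp <;> ring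

end IsSerre
end YDDatum

/-! ### Root vectors for the opposite order -/

namespace YDDatum
variable {k Γ : Type*} [Field k] [CommGroup Γ] {D : YDDatum k Γ (Fin 3)}
variable {E : Type*} [Ring E] [Algebra k E] {y : Fin 3 → E}

open PosRoot

/-- The root vector `[y₂, y₃]_c` of `α₂ + α₃` for the opposite order of the roots. -/
def revVec32 (D : YDDatum k Γ (Fin 3)) (y : Fin 3 → E) : E := D.brk a2 a3 (y 1) (y 2)

/-- The root vector `[[y₂, y₃]_c, y₃]_c` of `α₂ + 2α₃` for the opposite order of the roots. -/
def revVec3t2 (D : YDDatum k Γ (Fin 3)) (y : Fin 3 → E) : E := D.brk a32 a3 (D.revVec32 y) (y 2)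

/-- The element of weight `2α₂ + 2α₃` that is the coefficient of `y₁` in the coproduct of the
root vector of `α₁ + 2α₂ + 2α₃`. -/
def cornerVec (D : YDDatum k Γ (Fin 3)) (y : Fin 3 → E) : E :=
  D.ξ 2 • (D.ξ 2 • (D.rootVec y a2 * D.rootVec y a3t2) -
    (D.ξ 1 * D.q 1 2) • (D.rootVec y a32 * D.rootVec y a32))

variable (y) in
theorem br_a2_a3 : HasBracket (D.qRoot a2 a3) (D.rootVec y a2) (D.rootVec y a3)
    (D.revVec32 y) := brk_hasBracket ..

variable (y) in
theorem br_rev32_a3 : HasBracket (D.qRoot a32 a3) (D.revVec32 y) (D.rootVec y a3)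
    (D.revVec3t2 y) := brk_hasBracket ..

namespace IsSerre

theorem skew_a2_rev32 (hB : D.IsCartanB3) (hy : D.IsSerre y) :
    Skew (D.qRoot a2 a32) (D.rootVec y a2) (D.revVec32 y) := by
  have e := hy.skew_a32_a2
  simp only [Skew, rootVec, revVec32, brk, mul_sub, sub_mul, mul_smul_comm, smul_mul_assoc,
    smul_sub, ← mul_assoc] at e ⊢
  linear_combination (norm := skip) (D.q 1 2 * D.qRoot a2 a32) • e
  match_scalars <;> simp [hB.qRoot_eq, coord] <;> field_simp <;> ring

theorem skew_rev3t2_a3 (hB : D.IsCartanB3) (hy : D.IsSerre y) :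
    Skew (D.qRoot a3t2 a3) (D.revVec3t2 y) (D.rootVec y a3) := by
  have e := hy.skew_a3_a3t2
  simp only [Skew, rootVec, revVec32, revVec3t2, brk, mul_sub, sub_mul, mul_smul_comm,
    smul_mul_assoc, smul_sub, ← mul_assoc] at e ⊢
  linear_combination (norm := skip) (-(D.qRoot a2 a3 * D.qRoot a32 a3 * D.qRoot a3t2 a3)) • e
  match_scalars <;> simp [hB.qRoot_eq, coord] <;> field_simp <;> ring

theorem br_a2_rev3t2 (hB : D.IsCartanB3) (hy : D.IsSerre y) :
    HasBracket (D.qRoot a2 a3t2) (D.rootVec y a2) (D.revVec3t2 y)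
    ((D.qRoot a2 a32 - D.qRoot a32 a3) • (D.revVec32 y * D.revVec32 y)) := by
  have e := (br_a2_a3 y).derive_right_skew (br_rev32_a3 y) (hy.skew_a2_rev32 hB)
  simp only [HasBracket]
  linear_combination (norm := skip) e
  match_scalars <;> simp [hB.qRoot_eq, coord] <;> field_simp <;> ring

theorem skew_rev32_rev3t2 (hB : D.IsCartanB3) (hy : D.IsSerre y) :
    Skew (D.qRoot a32 a3t2) (D.revVec32 y) (D.revVec3t2 y) := by
  have e := (br_a2_a3 y).derive_right (hy.skew_rev3t2_a3 hB).hasBracket (hy.br_a2_rev3t2 hB)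
  have e' := (br_rev32_a3 (D := D) y).mul_right (br_rev32_a3 (D := D) y)
  have e'' := e.unique (e'.smul_right _) (by simp [hB.qRoot_eq, coord]; field_simp)
  simp only [Skew, mul_zero, zero_mul, smul_zero, add_zero, zero_add] at e'' ⊢
  linear_combination (norm := skip) (D.q 2 2 * D.q 1 2)⁻¹ • e''
  match_scalars <;> simp [hB.qRoot_eq, coord] <;> field_simp <;> ring

/-- The mirror image of the definition of `cornerVec`. -/
theorem cornerVec_eq (hB : D.IsCartanB3) (hy : D.IsSerre y) :
    D.cornerVec y = D.ξ 2 • (D.ξ 2 • (D.revVec3t2 y * D.rootVec y a2) -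
    (D.ξ 1 * D.q 2 1) • (D.revVec32 y * D.revVec32 y)) := by
  have e1 := congrArg (· * D.rootVec y a3) hy.skew_a32_a2
  have e2 := congrArg (D.rootVec y a3 * ·) hy.skew_a32_a2
  simp only [cornerVec, rootVec, revVec32, revVec3t2, brk, mul_sub, sub_mul,
    mul_smul_comm, smul_mul_assoc, smul_sub, ← mul_assoc] at e1 e2 ⊢
  linear_combination (norm := skip) (D.ξ 2 ^ 2 * (D.q 2 2)⁻¹) • e1 -
    (D.ξ 2 ^ 2 * D.q 2 2 * D.q 1 2 ^ 2) • e2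
  match_scalars <;> simp [hB.qRoot_eq, hB.q_eq.2.2.2.2, coord, ξ] <;> field_simp <;> ring

theorem skew_a2_corner (hB : D.IsCartanB3) (hy : D.IsSerre y) :
    Skew (D.qRoot a2 a3t2) (D.rootVec y a2) (D.cornerVec y) := by
  have e1 := congrArg (D.rootVec y a2 * ·) (hy.mul_a3t2_a2 hB)
  have e2 := (hy.skew_a32_a2.mul_left hy.skew_a32_a2)
  simp only [cornerVec, Skew, mul_sub, sub_mul, mul_add,
    mul_smul_comm, smul_mul_assoc, smul_sub, ← mul_assoc] at e1 e2 ⊢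
  linear_combination (norm := skip) (-(D.ξ 2 ^ 2 * D.qRoot a2 a3t2)) • e1 +
    (D.ξ 2 * D.ξ 1 * D.q 1 2 * D.qRoot a2 a3t2) • e2
  match_scalars <;> simp [hB.qRoot_eq, coord, ξ] <;> field_simp <;> ring

theorem skew_a3_corner (hB : D.IsCartanB3) (hy : D.IsSerre y) :
    Skew (D.qRoot a3 a2 * D.qRoot a3 a3t2) (D.rootVec y a3) (D.cornerVec y) := by
  have e1 := (((br_a3_a2 y).mul hy.skew_a3_a3t2.hasBracket).smul (D.ξ 2)).sub
    ((((br_a3_a32 y).mul (br_a3_a32 y)).congr (d := D.qRoot a3 a2 * D.qRoot a3 a3t2)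
      (by simp [hB.qRoot_eq, coord]; field_simp) rfl).smul (D.ξ 1 * D.q 1 2))
  have e2 := hy.skew_a3t2_a32 hB
  rw [Skew] at e2
  refine ((e1.smul (D.ξ 2)).congr rfl ?_).skew
  rw [e2]
  simp only [mul_zero, smul_zero, add_zero]
  match_scalars
  simp [hB.qRoot_eq, coord, ξ]
  right
  field_simp
  ring

theorem skew_rev32_corner (hB : D.IsCartanB3) (hy : D.IsSerre y) :
    Skew (D.qRoot a2 a3t2 * (D.qRoot a3 a2 * D.qRoot a3 a3t2))
    (D.revVec32 y) (D.cornerVec y) :=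
  ((hy.skew_a2_corner hB).mul_left (hy.skew_a3_corner hB)).sub_left
    ((((hy.skew_a3_corner hB).mul_left (hy.skew_a2_corner hB)).congr (mul_comm _ _)).smul_left _)

theorem skew_rev3t2_corner (hB : D.IsCartanB3) (hy : D.IsSerre y) :
    Skew (D.qRoot a2 a3t2 * (D.qRoot a3 a2 * D.qRoot a3 a3t2) * (D.qRoot a3 a2 * D.qRoot a3 a3t2))
      (D.revVec3t2 y) (D.cornerVec y) :=
  ((hy.skew_rev32_corner hB).mul_left (hy.skew_a3_corner hB)).sub_left
    ((((hy.skew_a3_corner hB).mul_left (hy.skew_rev32_corner hB)).congr (mul_comm _ _)).smul_left _)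

theorem skew_rev32_a2t1 (hB : D.IsCartanB3) (hN : 5 < D.N) (hy : D.IsSerre y) :
    Skew (D.qRoot a32 a2t1) (D.revVec32 y) (D.rootVec y a2t1) := by
  have h2 := hy.skew_a2_a2t1 hB hN
  have h3 := hy.skew_a3_a2t1 hB hN
  refine ((h2.mul_left h3).sub_left (((h3.mul_left h2).congr (mul_comm _ _)).smul_left _)).congr ?_
  simp [hB.qRoot_eq, coord] <;> field_simp

theorem skew_rev3t2_a2t1 (hB : D.IsCartanB3) (hN : 5 < D.N) (hy : D.IsSerre y) :
    Skew (D.qRoot a3t2 a2t1) (D.revVec3t2 y) (D.rootVec y a2t1) := by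
  have h2 := hy.skew_rev32_a2t1 hB hN
  have h3 := hy.skew_a3_a2t1 hB hN
  refine ((h2.mul_left h3).sub_left (((h3.mul_left h2).congr (mul_comm _ _)).smul_left _)).congr ?_
  simp [hB.qRoot_eq, coord] <;> field_simp

theorem skew_a32_a2t1 (hB : D.IsCartanB3) (hN : 5 < D.N) (hy : D.IsSerre y) :
    Skew (D.qRoot a32 a2t1) (D.rootVec y a32) (D.rootVec y a2t1) := by
  have h2 := hy.skew_a2_a2t1 hB hN
  have h3 := hy.skew_a3_a2t1 hB hN
  refine ((h3.mul_left h2).sub_left (((h2.mul_left h3).congr (mul_comm _ _)).smul_left _)).congr ?_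
  simp [hB.qRoot_eq, coord] <;> field_simp

theorem skew_corner_a2t1 (hB : D.IsCartanB3) (hN : 5 < D.N) (hy : D.IsSerre y) :
    Skew (D.qRoot a2 a2t1 * D.qRoot a3t2 a2t1) (D.cornerVec y) (D.rootVec y a2t1) := by
  have h1 := ((hy.skew_rev3t2_a2t1 hB hN).mul_left (hy.skew_a2_a2t1 hB hN)).congr
    (d := D.qRoot a2 a2t1 * D.qRoot a3t2 a2t1) (mul_comm _ _)
  have h2 := ((hy.skew_rev32_a2t1 hB hN).mul_left (hy.skew_rev32_a2t1 hB hN)).congr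
    (d := D.qRoot a2 a2t1 * D.qRoot a3t2 a2t1) (by simp [hB.qRoot_eq, coord]; field_simp)
  rw [hy.cornerVec_eq hB]
  exact ((h1.smul_left _).sub_left (h2.smul_left _)).smul_left _

end IsSerre
end YDDatum

/-! ### Root vectors of a sum of two families -/

section
variable {k E : Type*} [Field k] [Ring E] [Algebra k E]

theorem HasBracket.add {a : k} {x u u' v v' : E} (hu : HasBracket a x u u')
    (hv : HasBracket a x v v') : HasBracket a x (u + v) (u' + v') := by
  rw [HasBracket, mul_add, hu, hv, add_mul]
  module

theorem HasBracket.add_left {a : k} {x x' u v v' : E} (hu : HasBracket a x u v)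
    (hv : HasBracket a x' u v') : HasBracket a (x + x') u (v + v') := by
  rw [HasBracket, add_mul, hu, hv, mul_add]
  module

/-- The `c`-commutator of `x` and `u z`, if `z x = e x z`. -/
theorem Skew.hasBracket_mul {e : k} {z x : E} (h : Skew e z x) (c : k) (u : E) :
    HasBracket c x (u * z) ((x * u - (c * e) • (u * x)) * z) := by
  rw [HasBracket, mul_assoc u z x, h, sub_mul, smul_mul_assoc, mul_smul_comm, smul_smul]
  simp only [mul_assoc]
  module

theorem Skew.hasBracket_swap {e : k} {z x : E} (h : Skew e z x) (c : k) :
    HasBracket c x z ((1 - c * e) • (x * z)) := by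
  rw [HasBracket, h]
  module

theorem Skew.assoc {c : k} {x u : E} (h : Skew c x u) (z : E) :
    x * (u * z) = c • (u * (x * z)) := by
  rw [← mul_assoc, h, smul_mul_assoc, mul_assoc]

theorem HasBracket.assoc {c : k} {x u w : E} (h : HasBracket c x u w) (z : E) :
    x * (u * z) = c • (u * (x * z)) + w * z := by
  rw [← mul_assoc, h, add_mul, smul_mul_assoc, mul_assoc]

theorem Skew.refl (x : E) : Skew (1 : k) x x := (one_smul _ _).symm

end

namespace YDDatum
variable {k Γ : Type*} [Field k] [CommGroup Γ] {D : YDDatum k Γ (Fin 3)}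
variable {E : Type*} [Ring E] [Algebra k E]

open PosRoot

theorem skew_brk_left {α β : PosRoot} {c d : k} {u v x : E} (hu : Skew c u x) (hv : Skew d v x) :
    Skew (c * d) (D.brk α β u v) x :=
  (hu.mul_left hv).sub_left (((hv.mul_left hu).congr (mul_comm _ _)).smul_left _)

theorem skew_brk_right {α β : PosRoot} {c d : k} {u v x : E} (hu : Skew c x u) (hv : Skew d x v) :
    Skew (c * d) x (D.brk α β u v) :=
  (hu.mul_right hv).sub_right (((hv.mul_right hu).congr (mul_comm _ _)).smul_right _)

theorem skew_rootVec_left {y : Fin 3 → E} {x : E} {c : Fin 3 → k} (h : ∀ i, Skew (c i) (y i) x)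
    (α : PosRoot) : Skew (∏ i, c i ^ α.coord i) (D.rootVec y α) x := by
  have h21 := skew_brk_left (D := D) (α := a2) (β := a1) (h 1) (h 0)
  have h32 := skew_brk_left (D := D) (α := a3) (β := a2) (h 2) (h 1)
  have h31 := skew_brk_left (D := D) (α := a3) (β := a21) (h 2) h21
  have h3t2 := skew_brk_left (D := D) (α := a3) (β := a32) (h 2) h32
  have h3t1 := skew_brk_left (D := D) (α := a3) (β := a31) (h 2) h31
  have h2t1 := skew_brk_left (D := D) (α := a2) (β := a3t1) (h 1) h3t1
  cases α
  exacts [(h 0).congr (by simp [coord, Fin.prod_univ_three]),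
    (h 1).congr (by simp [coord, Fin.prod_univ_three]),
    (h 2).congr (by simp [coord, Fin.prod_univ_three]),
    h21.congr (by simp [coord, Fin.prod_univ_three]; ring),
    h32.congr (by simp [coord, Fin.prod_univ_three]; ring),
    h31.congr (by simp [coord, Fin.prod_univ_three]; ring),
    h3t2.congr (by simp [coord, Fin.prod_univ_three]; ring),
    h3t1.congr (by simp [coord, Fin.prod_univ_three]; ring),
    h2t1.congr (by simp [coord, Fin.prod_univ_three]; ring)]

theorem skew_rootVec_right {y : Fin 3 → E} {x : E} {c : Fin 3 → k} (h : ∀ i, Skew (c i) x (y i))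
    (α : PosRoot) : Skew (∏ i, c i ^ α.coord i) x (D.rootVec y α) := by
  have h21 := skew_brk_right (D := D) (α := a2) (β := a1) (h 1) (h 0)
  have h32 := skew_brk_right (D := D) (α := a3) (β := a2) (h 2) (h 1)
  have h31 := skew_brk_right (D := D) (α := a3) (β := a21) (h 2) h21
  have h3t2 := skew_brk_right (D := D) (α := a3) (β := a32) (h 2) h32
  have h3t1 := skew_brk_right (D := D) (α := a3) (β := a31) (h 2) h31
  have h2t1 := skew_brk_right (D := D) (α := a2) (β := a3t1) (h 1) h3t1
  cases α
  exacts [(h 0).congr (by simp [coord, Fin.prod_univ_three]),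
    (h 1).congr (by simp [coord, Fin.prod_univ_three]),
    (h 2).congr (by simp [coord, Fin.prod_univ_three]),
    h21.congr (by simp [coord, Fin.prod_univ_three]; ring),
    h32.congr (by simp [coord, Fin.prod_univ_three]; ring),
    h31.congr (by simp [coord, Fin.prod_univ_three]; ring),
    h3t2.congr (by simp [coord, Fin.prod_univ_three]; ring),
    h3t1.congr (by simp [coord, Fin.prod_univ_three]; ring),
    h2t1.congr (by simp [coord, Fin.prod_univ_three]; ring)]

/-- Two families satisfying the Serre relations that commute with each other up to the scalars
of the braiding, like `(y_i ⊗ 1)` and `(g_i ⊗ y_i)`. -/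
structure IsSerrePair (D : YDDatum k Γ (Fin 3)) (a b : Fin 3 → E) : Prop where
  left : D.IsSerre a
  right : D.IsSerre b
  cross : ∀ i j, Skew (D.q i j) (b i) (a j)

namespace IsSerrePair

variable {a b : Fin 3 → E}

theorem skew (h : D.IsSerrePair a b) (α β : PosRoot) :
    Skew (D.qRoot α β) (D.rootVec b α) (D.rootVec a β) := by
  have h1 := skew_rootVec_left (D := D) (fun i => skew_rootVec_right (D := D)
    (fun j => h.cross i j) β) α
  refine h1.congr ?_
  rw [qRoot_eq_prod]
  refine Finset.prod_congr rfl fun i _ => ?_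
  rw [← Finset.prod_pow]
  exact Finset.prod_congr rfl fun j _ => by rw [← pow_mul, mul_comm]

/-- The bracket of `u_a + u_b` and `v_a + v_b` consists of the brackets within each family and of
mixed terms, in which the factors are reordered with `IsSerrePair.skew`.  The same holds for the
other root vectors below. -/
theorem rootVec_a21 (hB : D.IsCartanB3) (h : D.IsSerrePair a b) : D.rootVec (a + b) a21 =
    D.rootVec a a21 + (D.ξ 2 • (D.rootVec a a2 * D.rootVec b a1) + D.rootVec b a21) := by
  have e := (((br_a2_a1 a).add ((h.skew a1 a2).hasBracket_swap (D.qRoot a2 a1))).add_left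
    ((h.skew a2 a1).hasBracket.add (br_a2_a1 b))).unique (br_a2_a1 (D := D) (a + b)) rfl
  rw [← e, zero_add, add_assoc]
  -- `mul_eq_mul_left_iff` and its mirror image would turn an identity into a disjunction
  match_scalars <;> simp [hB.qRoot_eq, coord, ξ, -mul_eq_mul_left_iff, -mul_eq_mul_right_iff] <;>
    field_simp

theorem rootVec_a32 (hB : D.IsCartanB3) (h : D.IsSerrePair a b) : D.rootVec (a + b) a32 =
    D.rootVec a a32 + D.ξ 2 • (D.rootVec a a3 * D.rootVec b a2) + D.rootVec b a32 := by
  have e := (((br_a3_a2 a).add ((h.skew a2 a3).hasBracket_swap (D.qRoot a3 a2))).add_left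
    ((h.skew a3 a2).hasBracket.add (br_a3_a2 b))).unique (br_a3_a2 (D := D) (a + b)) rfl
  rw [← e, zero_add]
  match_scalars <;> simp [hB.qRoot_eq, coord, ξ, -mul_eq_mul_left_iff, -mul_eq_mul_right_iff] <;>
    field_simp

theorem rootVec_a31 (hB : D.IsCartanB3) (h : D.IsSerrePair a b) : D.rootVec (a + b) a31 =
    D.rootVec a a31 + (D.ξ 2 • (D.rootVec a a32 * D.rootVec b a1) +
      D.ξ 2 • (D.rootVec a a3 * D.rootVec b a21)) + D.rootVec b a31 := by
  have e1 := (br_a3_a21 a).add (((((h.skew a1 a3).hasBracket_mul (D.qRoot a3 a21)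
    (D.rootVec a a2)).smul (D.ξ 2))).add ((h.skew a21 a3).hasBracket_swap _))
  have e2 := (h.skew a3 a21).hasBracket.add (((((h.skew a3 a2).hasBracket.mul
    (h.right.skew_a3_a1.hasBracket)).congr (d := D.qRoot a3 a21)
      (by simp [hB.qRoot_eq, coord]; field_simp) rfl).smul (D.ξ 2)).add (br_a3_a21 b))
  rw [← h.rootVec_a21 hB] at e1 e2
  have e := (e1.add_left e2).unique (br_a3_a21 (D := D) (a + b)) rfl
  have f := br_a3_a2 (D := D) a
  rw [HasBracket] at f
  rw [← e, f]
  simp only [mul_zero, zero_mul, smul_zero, add_zero, zero_add, add_mul, sub_mul, smul_mul_assoc]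
  match_scalars <;> simp [hB.qRoot_eq, coord, ξ, -mul_eq_mul_left_iff, -mul_eq_mul_right_iff] <;>
    field_simp <;> ring_nf <;> simp

theorem rootVec_a3t2 (hB : D.IsCartanB3) (h : D.IsSerrePair a b) : D.rootVec (a + b) a3t2 =
    D.rootVec a a3t2 + (D.ξ 1 * D.ξ 2) • (D.rootVec a a3 * D.rootVec a a3 * D.rootVec b a2) +
      (D.ξ 2 * D.q 2 2) • (D.rootVec a a3 * D.rootVec b a32) + D.rootVec b a3t2 := by
  have e1 := ((br_a3_a32 a).add (((h.skew a2 a3).hasBracket_mul (D.qRoot a3 a32)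
    (D.rootVec a a3)).smul (D.ξ 2))).add ((h.skew a32 a3).hasBracket_swap _)
  have e2 := ((h.skew a3 a32).hasBracket.add ((((h.skew a3 a3).hasBracket.mul
    (br_a3_a2 b)).congr (d := D.qRoot a3 a32) (by simp [hB.qRoot_eq, coord]) rfl).smul
      (D.ξ 2))).add (br_a3_a32 b)
  rw [← h.rootVec_a32 hB] at e1 e2
  have e := (e1.add_left e2).unique (br_a3_a32 (D := D) (a + b)) rfl
  rw [← e]
  simp only [zero_mul, zero_add, sub_mul, smul_mul_assoc]
  match_scalars <;> simp [hB.qRoot_eq, coord, ξ, -mul_eq_mul_left_iff, -mul_eq_mul_right_iff] <;>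
    field_simp <;> ring

theorem rootVec_a3t1 (hB : D.IsCartanB3) (h : D.IsSerrePair a b) : D.rootVec (a + b) a3t1 =
    D.rootVec a a3t1 + D.ξ 2 • (D.rootVec a a3t2 * D.rootVec b a1) +
      (D.ξ 1 * D.ξ 2) • (D.rootVec a a3 * D.rootVec a a3 * D.rootVec b a21) +
      (D.ξ 2 * D.q 2 2) • (D.rootVec a a3 * D.rootVec b a31) + D.rootVec b a3t1 := by
  have e1 := ((br_a3_a31 a).add ((((h.skew a1 a3).hasBracket_mul (D.qRoot a3 a31)
    (D.rootVec a a32)).smul (D.ξ 2)).add (((h.skew a21 a3).hasBracket_mul (D.qRoot a3 a31)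
    (D.rootVec a a3)).smul (D.ξ 2)))).add ((h.skew a31 a3).hasBracket_swap _)
  have e2 := ((h.skew a3 a31).hasBracket.add (((((h.skew a3 a32).hasBracket.mul
    h.right.skew_a3_a1.hasBracket).congr (d := D.qRoot a3 a31)
      (by simp [hB.qRoot_eq, coord]; field_simp) rfl).smul (D.ξ 2)).add
    ((((h.skew a3 a3).hasBracket.mul (br_a3_a21 b)).congr (d := D.qRoot a3 a31)
      (by simp [hB.qRoot_eq, coord]; field_simp) rfl).smul
    (D.ξ 2)))).add (br_a3_a31 b)
  rw [← h.rootVec_a31 hB] at e1 e2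
  have e := (e1.add_left e2).unique (br_a3_a31 (D := D) (a + b)) rfl
  have f := br_a3_a32 (D := D) a
  rw [HasBracket] at f
  rw [← e, f]
  simp only [mul_zero, zero_mul, smul_zero, add_zero, zero_add, add_mul, sub_mul, smul_mul_assoc]
  match_scalars <;> simp [hB.qRoot_eq, coord, ξ, -mul_eq_mul_left_iff, -mul_eq_mul_right_iff] <;>
    field_simp <;> ring_nf <;> simp

theorem rootVec_a2t1 (hB : D.IsCartanB3) (hN : 5 < D.N) (h : D.IsSerrePair a b) :
    D.rootVec (a + b) a2t1 = D.rootVec a a2t1 + (D.cornerVec a * D.rootVec b a1 +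
      (D.ξ 2 • (D.revVec3t2 a * D.rootVec b a21) +
      ((D.ξ 2 * D.q 2 2) • (D.revVec32 a * D.rootVec b a31) +
        D.ξ 2 • (D.rootVec a a2 * D.rootVec b a3t1)) +
      D.rootVec b a2t1)) := by
  have e1 := ((((br_a2_a3t1 a).add (((h.skew a1 a2).hasBracket_mul (D.qRoot a2 a3t1)
    (D.rootVec a a3t2)).smul (D.ξ 2))).add (((h.skew a21 a2).hasBracket_mul (D.qRoot a2 a3t1)
    (D.rootVec a a3 * D.rootVec a a3)).smul (D.ξ 1 * D.ξ 2))).add (((h.skew a31 a2).hasBracket_mul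
    (D.qRoot a2 a3t1) (D.rootVec a a3)).smul (D.ξ 2 * D.q 2 2))).add
    ((h.skew a3t1 a2).hasBracket_swap _)
  have e2 := ((((h.skew a2 a3t1).hasBracket.add ((((h.skew a2 a3t2).hasBracket.mul
    (br_a2_a1 b)).congr (d := D.qRoot a2 a3t1) (by simp [hB.qRoot_eq, coord]) rfl).smul
      (D.ξ 2))).add
    (((((h.skew a2 a3).hasBracket.mul (h.skew a2 a3).hasBracket).mul
    h.right.skew_a2_a21.hasBracket).congr (d := D.qRoot a2 a3t1)
      (by simp [hB.qRoot_eq, coord]; field_simp) rfl).smul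
    (D.ξ 1 * D.ξ 2))).add
    (((((h.skew a2 a3).hasBracket.mul (h.right.skew_a2_a31 hB hN).hasBracket).congr
    (d := D.qRoot a2 a3t1) (by simp [hB.qRoot_eq, coord]; field_simp) rfl).smul
      (D.ξ 2 * D.q 2 2)))).add (br_a2_a3t1 b)
  rw [← h.rootVec_a3t1 hB] at e1 e2
  have e := (e1.add_left e2).unique (br_a2_a3t1 (D := D) (a + b)) rfl
  have f1 : D.ξ 2 • (D.rootVec a a2 * D.rootVec a a3t2 - (D.qRoot a2 a3t1 * D.qRoot a1 a2) •
      (D.rootVec a a3t2 * D.rootVec a a2)) = D.cornerVec a := by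
    have f := h.left.mul_a3t2_a2 hB
    rw [HasBracket] at f
    rw [f, cornerVec]
    match_scalars <;> simp [hB.qRoot_eq, coord, ξ, -mul_eq_mul_left_iff, -mul_eq_mul_right_iff] <;>
      field_simp
  have f2 : (D.ξ 1 * D.ξ 2) • (D.rootVec a a2 * (D.rootVec a a3 * D.rootVec a a3) -
    (D.qRoot a2 a3t1 * D.qRoot a21 a2) •
      (D.rootVec a a3 * D.rootVec a a3 * D.rootVec a a2)) +
        (D.ξ 2 * D.qRoot a2 a3t2) • D.rootVec a a3t2 =
      D.ξ 2 • D.revVec3t2 a := by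
    simp only [rootVec, revVec32, revVec3t2, brk, mul_sub, sub_mul, mul_smul_comm, smul_mul_assoc,
      smul_sub, ← mul_assoc]
    match_scalars <;> simp [hB.qRoot_eq, coord, ξ, -mul_eq_mul_left_iff, -mul_eq_mul_right_iff] <;>
      field_simp <;> ring
  have f3 : D.rootVec a a2 * D.rootVec a a3 - (D.qRoot a2 a3t1 * D.qRoot a31 a2) •
      (D.rootVec a a3 * D.rootVec a a2) = D.revVec32 a := by
    rw [revVec32, brk]
    congr 2
    simp [hB.qRoot_eq, coord] <;> field_simp
  rw [← e, ← f1, ← f3, ← smul_mul_assoc _ (D.revVec3t2 a), ← f2]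
  simp only [mul_zero, zero_mul, smul_zero, add_zero, zero_add, add_mul, sub_mul, smul_mul_assoc]
  match_scalars <;> simp [hB.qRoot_eq, coord, ξ, -mul_eq_mul_left_iff, -mul_eq_mul_right_iff] <;>
    field_simp

end IsSerrePair
end YDDatum

/-! ### The `N`-th powers of the root vectors of a sum -/

namespace YDDatum
variable {k Γ : Type*} [Field k] [CommGroup Γ] {D : YDDatum k Γ (Fin 3)}
variable {E : Type*} [Ring E] [Algebra k E]

open PosRoot

theorem N_pos (hN : 5 < D.N) : 0 < D.N := by omega

theorem isPrimitiveRoot_q : IsPrimitiveRoot (D.q 2 2) D.N := IsPrimitiveRoot.orderOf _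

theorem isPrimitiveRoot_q_sq (hodd : Odd D.N) : IsPrimitiveRoot (D.q 2 2 ^ 2) D.N :=
  isPrimitiveRoot_q.pow_of_coprime 2 (Nat.coprime_two_left.2 hodd)

/-- The parameters `u = q_{33} / (1 + q_{33})` and `v = 1 / (1 + q_{33})` used in
`add_add_pow_of_sq` and `add_pow_five`. -/
theorem div_add_div_eq_one (hN : 5 < D.N) :
    D.q 2 2 / (1 + D.q 2 2) + 1 / (1 + D.q 2 2) = 1 := by
  have := one_add_q_ne_zero hN
  field_simp
  ring

/-- The coefficient of the middle term in the `N`-th powers. -/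
theorem middle_coeff (hN : 5 < D.N) (x : E) :
    ((D.q 2 2 / (1 + D.q 2 2)) ^ D.N + (1 / (1 + D.q 2 2)) ^ D.N) •
      ((D.ξ 2 * D.q 2 2) • x) ^ D.N = (2 * D.ξ 1 ^ D.N) • x ^ D.N := by
  have h1 := one_add_q_ne_zero hN
  have hq : D.q 2 2 ^ D.N = 1 := isPrimitiveRoot_q.pow_eq_one
  have h2 : D.ξ 2 * D.q 2 2 = D.ξ 1 * (1 + D.q 2 2) := by
    simp only [ξ]
    have := D.q_ne_zero 2 2
    field_simp
    ring
  rw [h2, smul_pow, smul_smul, mul_pow, div_pow, div_pow, hq]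
  have := pow_ne_zero D.N h1
  congr 1
  field_simp
  norm_num
  ring

namespace IsSerrePair

variable {a b : Fin 3 → E}

theorem rootVec_a21_pow (hB : D.IsCartanB3) (hodd : Odd D.N) (hN : 5 < D.N)
    (h : D.IsSerrePair a b) : D.rootVec (a + b) a21 ^ D.N = D.rootVec a a21 ^ D.N +
      ((D.ξ 2 • (D.rootVec a a2 * D.rootVec b a1)) ^ D.N + D.rootVec b a21 ^ D.N) := by
  have hp := isPrimitiveRoot_q_sq hodd
  rw [h.rootVec_a21 hB, add_pow_of_skew hp (N_pos hN), add_pow_of_skew hp (N_pos hN)]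
  · exact (((h.skew a21 a2).mul_right h.right.skew_a21_a1).congr
      (by simp [hB.qRoot_eq, coord]; field_simp)).smul_right _
  · exact (((h.left.skew_a2_a21.mul_left (h.skew a1 a21)).congr
      (by simp [hB.qRoot_eq, coord]; field_simp)).smul_left _).add_left
      ((h.skew a21 a21).congr (by simp [hB.qRoot_eq, coord]; field_simp))

theorem rootVec_a32_pow (hB : D.IsCartanB3) (hodd : Odd D.N) (hN : 5 < D.N)
    (h : D.IsSerrePair a b) : D.rootVec (a + b) a32 ^ D.N = D.rootVec a a32 ^ D.N +
      (D.ξ 2 • (D.rootVec a a3 * D.rootVec b a2)) ^ D.N + D.rootVec b a32 ^ D.N := by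
  have hp := D.isPrimitiveRoot_q
  rw [h.rootVec_a32 hB, add_pow_of_skew hp (N_pos hN), add_pow_of_skew_add hp (N_pos hN) hodd
    (Ω := (D.ξ 2 * D.qRoot a2 a32) • (D.rootVec a a3t2 * D.rootVec b a2))]
  · have e := ((br_a3_a32 a).mul_right (h.skew a2 a32).hasBracket).congr
      (d := D.q 2 2) (by simp [hB.qRoot_eq, coord]; field_simp) rfl
    refine (e.smul_right (D.ξ 2)).trans ?_
    simp only [mul_zero, zero_add, smul_smul]
  · exact (((h.left.skew_a3t2_a32 hB).mul_left (h.skew a2 a32)).congr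
      (by simp [hB.qRoot_eq, coord]; field_simp)).smul_left _
  · exact ((Skew.mul_mul h.left.skew_a3_a3t2 (Skew.refl _) (h.skew a2 a3t2) (h.skew a2 a3)
      (by simp [hB.qRoot_eq, coord]; field_simp)).smul_left _).smul_right _
  · exact ((h.skew a32 a32).congr (by simp [hB.qRoot_eq, coord]; field_simp)).add_right
      ((((h.skew a32 a3).mul_right h.right.skew_a32_a2).congr
        (by simp [hB.qRoot_eq, coord]; field_simp)).smul_right _)

theorem rootVec_a31_pow (hB : D.IsCartanB3) (hodd : Odd D.N) (hN : 5 < D.N)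
    (h : D.IsSerrePair a b) : D.rootVec (a + b) a31 ^ D.N = D.rootVec a a31 ^ D.N +
      ((D.ξ 2 • (D.rootVec a a32 * D.rootVec b a1)) ^ D.N +
      (D.ξ 2 • (D.rootVec a a3 * D.rootVec b a21)) ^ D.N) + D.rootVec b a31 ^ D.N := by
  have hp := D.isPrimitiveRoot_q
  have r31_1 := h.right.skew_a31_a1 hB
  have r31_21 := h.right.skew_a31_a21 hB hN
  have l := h.left.br_a32_a31 hB hN
  rw [h.rootVec_a31 hB, add_pow_of_skew hp (N_pos hN),
    add_pow_of_skew_add hp (N_pos hN) hodd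
      (R := D.ξ 2 • (D.rootVec a a32 * D.rootVec b a1) +
        D.ξ 2 • (D.rootVec a a3 * D.rootVec b a21))
    (Ω := D.ξ 2 • (D.qRoot a1 a31 • (((D.qRoot a2 a31 * (1 - (D.q 2 2 ^ 2)⁻¹)) •
      (D.rootVec a a3t1 * D.rootVec a a2) - D.qRoot a3 a2 • D.rootVec a a2t1) * D.rootVec b a1) +
      D.qRoot a21 a31 • (D.rootVec a a3t1 * D.rootVec b a21))),
    add_pow_of_skew_add hp (N_pos hN) hodd
      (Ω := (D.ξ 2 ^ 2 * D.qRoot a21 a32 * D.qRoot a21 a1) •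
        (D.rootVec a a3t2 * (D.rootVec b a1 * D.rootVec b a21)))]
  · have e := ((br_a3_a32 a).mul_right (h.skew a21 a32).hasBracket)
    have f := h.right.skew_a21_a1
    simp only [Skew, HasBracket, mul_zero, zero_add] at e f
    have e' := congrArg (· * D.rootVec b a1) e
    have g := (h.skew a1 a3)
    rw [Skew] at g
    simp only [add_mul, smul_mul_assoc, mul_smul_comm, mul_assoc, f, (h.skew a1 a3).assoc] at e' ⊢
    linear_combination (norm := skip) (D.ξ 2 ^ 2) • e'
    match_scalars <;> simp [hB.qRoot_eq, coord, ξ, -mul_eq_mul_left_iff, -mul_eq_mul_right_iff] <;>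
      field_simp <;> ring
  · exact ((Skew.mul_mul (h.left.skew_a3t2_a32 hB) ((Skew.refl _).mul_left h.right.skew_a21_a1)
      ((h.skew a1 a32).mul_left (h.skew a21 a32)) (h.skew a1 a3t2)
      (by simp [hB.qRoot_eq, coord]; field_simp)).smul_left _).smul_right _
  · exact ((Skew.mul_mul (h.left.skew_a3_a3t2) ((h.right.skew_a21_a1).mul_right (Skew.refl _))
      (h.skew a21 a3t2) ((h.skew a1 a3).mul_left (h.skew a21 a3))
      (by simp [hB.qRoot_eq, coord]; field_simp)).smul_left _).smul_right _
  · have e1 := (l.mul_right (h.skew a1 a31).hasBracket).congr (d := D.q 2 2)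
      (by simp [hB.qRoot_eq, coord]; field_simp) rfl
    have e2 := ((br_a3_a31 a).mul_right (h.skew a21 a31).hasBracket).congr (d := D.q 2 2)
      (by simp [hB.qRoot_eq, coord]; field_simp) rfl
    have e := ((e1.smul_right (D.ξ 2)).add_left (e2.smul_right (D.ξ 2)))
    simp only [mul_zero, zero_add, HasBracket] at e
    rw [e, smul_add]
  · have k1 := (((h.left.skew_a3t1_a31 hB hN).mul_left (h.left.skew_a2_a31 hB hN)).congr
      (d := D.qRoot a2t1 a31) (by simp [hB.qRoot_eq, coord]; field_simp)).smul_left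
        (D.qRoot a2 a31 * (1 - (D.q 2 2 ^ 2)⁻¹))
    have k2 := k1.sub_left ((h.left.skew_a2t1_a31 hB hN).smul_left (D.qRoot a3 a2))
    have k3 := ((k2.mul_left (h.skew a1 a31)).congr (d := D.q 2 2 ^ 2)
      (by simp [hB.qRoot_eq, coord]; field_simp)).smul_left (D.qRoot a1 a31)
    have k4 := (((h.left.skew_a3t1_a31 hB hN).mul_left (h.skew a21 a31)).congr (d := D.q 2 2 ^ 2)
      (by simp [hB.qRoot_eq, coord]; field_simp)).smul_left (D.qRoot a21 a31)
    exact (k3.add_left k4).smul_left _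
  · have l1 := h.left.skew_a32_a3t1 hB hN
    have l2 := h.left.skew_a32_a2
    have l3 := h.left.skew_a32_a2t1 hB hN
    have l4 := h.left.skew_a3_a3t1 hB
    have l5 := br_a3_a2 (D := D) a
    have l6 := h.left.skew_a3_a2t1 hB hN
    have r1 := h.right.skew_a21_a1
    have n1 := h.skew a1 a3t1
    have n2 := h.skew a1 a2
    have n3 := h.skew a1 a2t1
    have n4 := h.skew a21 a3t1
    have n5 := h.skew a21 a2
    have n6 := h.skew a21 a2t1
    have n7 := h.skew a1 a32
    have n8 := h.skew a1 a3
    have n9 := h.skew a21 a32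
    have n10 := h.skew a21 a3
    simp only [mul_add, add_mul, mul_sub, sub_mul, smul_mul_assoc, mul_smul_comm, mul_assoc,
      n1.assoc, n2.assoc, n3.assoc, n4.assoc, n5.assoc, n6.assoc, n7.assoc, n8.assoc, n9.assoc,
      n10.assoc, l1.assoc, l2.assoc, l3.assoc, l4.assoc, l5.assoc, l6.assoc, show _ = _ from r1]
    match_scalars <;> simp [hB.qRoot_eq, coord, ξ, -mul_eq_mul_left_iff, -mul_eq_mul_right_iff] <;>
      field_simp <;> ring
  · exact ((h.skew a31 a31).congr (by simp [hB.qRoot_eq, coord]; field_simp)).add_right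
      ((((((h.skew a31 a32).mul_right r31_1).congr
        (by simp [hB.qRoot_eq, coord]; field_simp)).smul_right _)).add_right
      ((((h.skew a31 a3).mul_right r31_21).congr
        (by simp [hB.qRoot_eq, coord]; field_simp)).smul_right _))

theorem rootVec_a3t2_pow (hB : D.IsCartanB3) (hodd : Odd D.N) (hN : 5 < D.N)
    (h : D.IsSerrePair a b) : D.rootVec (a + b) a3t2 ^ D.N = D.rootVec a a3t2 ^ D.N +
      (((D.ξ 1 * D.ξ 2) • (D.rootVec a a3 * D.rootVec a a3 * D.rootVec b a2)) ^ D.N +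
      (2 * D.ξ 1 ^ D.N) • (D.rootVec a a3 * D.rootVec b a32) ^ D.N +
      D.rootVec b a3t2 ^ D.N) := by
  have hp := isPrimitiveRoot_q_sq hodd
  -- needed by `field_simp`, for the denominators of `u` and `v`
  have h1 := one_add_q_ne_zero hN
  have l3 := h.left.skew_a3_a3t2
  have e := h.right.mul_a3t2_a2 hB
  have n1 := h.skew a3t2 a3
  have n2 := h.skew a32 a3
  rw [h.rootVec_a3t2 hB, add_assoc, add_assoc, add_pow_of_skew hp (N_pos hN),
    add_add_pow_of_sq hp (N_pos hN) (div_add_div_eq_one hN), middle_coeff hN]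
  · exact ((Skew.mul_mul ((Skew.refl _).mul_right (Skew.refl _)) h.right.skew_a32_a2
      (n2.mul_right n2) (h.skew a2 a3)
      (by simp [hB.qRoot_eq, coord]; field_simp)).smul_left _).smul_right _
  · exact ((n1.mul_right (h.right.skew_a3t2_a32 hB)).congr
      (by simp [hB.qRoot_eq, coord]; field_simp)).smul_right _
  · simp only [pow_two, smul_mul_assoc, mul_smul_comm, mul_assoc, n1.assoc, n2.assoc,
      show _ = _ from e, mul_add]
    match_scalars <;> simp [hB.qRoot_eq, coord, ξ, -mul_eq_mul_left_iff, -mul_eq_mul_right_iff] <;>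
      field_simp <;> ring
  · exact ((((l3.mul_left l3).mul_left (h.skew a2 a3t2)).congr
      (by simp [hB.qRoot_eq, coord]; field_simp)).smul_left _).add_left
      ((((l3.mul_left (h.skew a32 a3t2)).congr
        (by simp [hB.qRoot_eq, coord]; field_simp)).smul_left _).add_left
      ((h.skew a3t2 a3t2).congr (by simp [hB.qRoot_eq, coord]; field_simp)))

theorem rootVec_a3t1_pow (hB : D.IsCartanB3) (hodd : Odd D.N) (hN : 5 < D.N)
    (h : D.IsSerrePair a b) : D.rootVec (a + b) a3t1 ^ D.N = D.rootVec a a3t1 ^ D.N +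
      ((D.ξ 2 • (D.rootVec a a3t2 * D.rootVec b a1)) ^ D.N +
      (((D.ξ 1 * D.ξ 2) • (D.rootVec a a3 * D.rootVec a a3 * D.rootVec b a21)) ^ D.N +
      (2 * D.ξ 1 ^ D.N) • (D.rootVec a a3 * D.rootVec b a31) ^ D.N +
      D.rootVec b a3t1 ^ D.N)) := by
  have hp := isPrimitiveRoot_q_sq hodd
  -- needed by `field_simp`, for the denominators of `u` and `v`
  have h1 := one_add_q_ne_zero hN
  have l1 := h.left.skew_a3_a3t1 hB
  have l3 := h.left.skew_a3_a3t2
  have e := h.right.br_a3t1_a21 hB hN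
  have n1 := h.skew a3t1 a3
  have n2 := h.skew a31 a3
  rw [h.rootVec_a3t1 hB, add_assoc, add_assoc, add_assoc, add_pow_of_skew hp (N_pos hN),
    add_pow_of_skew hp (N_pos hN),
    add_add_pow_of_sq hp (N_pos hN) (div_add_div_eq_one hN), middle_coeff hN]
  · exact ((Skew.mul_mul ((Skew.refl _).mul_right (Skew.refl _)) (h.right.skew_a31_a21 hB hN)
      (n2.mul_right n2) (h.skew a21 a3)
      (by simp [hB.qRoot_eq, coord]; field_simp)).smul_left _).smul_right _
  · exact ((n1.mul_right (h.right.skew_a3t1_a31 hB hN)).congr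
      (by simp [hB.qRoot_eq, coord]; field_simp)).smul_right _
  · simp only [pow_two, smul_mul_assoc, mul_smul_comm, mul_assoc, n1.assoc, n2.assoc,
      show _ = _ from e, mul_add]
    match_scalars <;> simp [hB.qRoot_eq, coord, ξ, -mul_eq_mul_left_iff, -mul_eq_mul_right_iff] <;>
      field_simp <;> ring
  · exact (((((Skew.mul_mul (l3.mul_left l3) h.right.skew_a21_a1 (h.skew a21 a3t2)
      ((h.skew a1 a3).mul_right (h.skew a1 a3))
        (by simp [hB.qRoot_eq, coord]; field_simp)).smul_left _).add_left
      (((Skew.mul_mul l3 (h.right.skew_a31_a1 hB) (h.skew a31 a3t2)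
      (h.skew a1 a3) (by simp [hB.qRoot_eq, coord]; field_simp)).smul_left _).add_left
      (((h.skew a3t1 a3t2).mul_right (h.right.skew_a3t1_a1 hB)).congr
        (by simp [hB.qRoot_eq, coord]; field_simp)))))).smul_right _
  · exact ((((h.left.skew_a3t2_a3t1 hB hN).mul_left (h.skew a1 a3t1)).congr
      (by simp [hB.qRoot_eq, coord]; field_simp)).smul_left _).add_left
      (((((l1.mul_left l1).mul_left (h.skew a21 a3t1)).congr
        (by simp [hB.qRoot_eq, coord]; field_simp)).smul_left _).add_left
      ((((l1.mul_left (h.skew a31 a3t1)).congr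
        (by simp [hB.qRoot_eq, coord]; field_simp)).smul_left _).add_left
      ((h.skew a3t1 a3t1).congr (by simp [hB.qRoot_eq, coord]; field_simp))))

theorem skew_rev32 (h : D.IsSerrePair a b) (α : PosRoot) :
    Skew (D.qRoot α a2 * D.qRoot α a3) (D.rootVec b α) (D.revVec32 a) :=
  skew_brk_right (h.skew α a2) (h.skew α a3)

theorem skew_rev3t2 (h : D.IsSerrePair a b) (α : PosRoot) :
    Skew (D.qRoot α a2 * D.qRoot α a3 * D.qRoot α a3) (D.rootVec b α) (D.revVec3t2 a) :=
  skew_brk_right (h.skew_rev32 α) (h.skew α a3)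

theorem skew_corner (hB : D.IsCartanB3) (h : D.IsSerrePair a b) (α : PosRoot) :
    Skew (D.qRoot α a2 * D.qRoot α a3t2) (D.rootVec b α) (D.cornerVec a) := by
  refine ((((h.skew α a2).mul_right (h.skew α a3t2)).smul_right _).sub_right
    ((((h.skew α a32).mul_right (h.skew α a32)).congr ?_).smul_right _)).smul_right _
  cases α <;> simp [hB.qRoot_eq, coord] <;> field_simp

theorem rootVec_a2t1_pow (hB : D.IsCartanB3) (hodd : Odd D.N) (hN : 5 < D.N)
    (h : D.IsSerrePair a b) : D.rootVec (a + b) a2t1 ^ D.N = D.rootVec a a2t1 ^ D.N +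
      ((D.cornerVec a * D.rootVec b a1) ^ D.N +
      ((D.ξ 2 • (D.revVec3t2 a * D.rootVec b a21)) ^ D.N +
      ((2 * D.ξ 1 ^ D.N) • (D.revVec32 a * D.rootVec b a31) ^ D.N +
      (D.ξ 2 • (D.rootVec a a2 * D.rootVec b a3t1)) ^ D.N) + D.rootVec b a2t1 ^ D.N)) := by
  have hp := isPrimitiveRoot_q_sq hodd
  -- needed by `field_simp`, for the denominators of `u` and `v`
  have h1 := one_add_q_ne_zero hN
  have r2t1_21 := h.right.skew_a2t1_a21 hB hN
  have r2t1_3t1 := h.right.skew_a2t1_a3t1 hB hN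
  have r2t1_31 := h.right.skew_a2t1_a31 hB hN
  have r21_1 := h.right.skew_a21_a1
  have r31_1 := h.right.skew_a31_a1 hB
  have r3t1_1 := h.right.skew_a3t1_a1 hB
  have r31_21 := h.right.skew_a31_a21 hB hN
  have r3t1_31 := h.right.skew_a3t1_a31 hB hN
  have r3t1_21 := h.right.br_a3t1_a21 hB hN
  have r2t1_1 := h.right.br_a2t1_a1 hB
  have l := h.left.br_a2_rev3t2 hB
  rw [h.rootVec_a2t1 hB hN, add_pow_of_skew hp (N_pos hN),
    add_pow_five hp (N_pos hN) (div_add_div_eq_one hN)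
    (Ω := D.cornerVec a * ((D.qRoot a2t1 a2 * D.qRoot a2t1 a3t2) •
      (D.qRoot a3t1 a1 • (D.rootVec b a21 * D.rootVec b a3t1) -
      D.qRoot a2 a3t1 • (D.rootVec b a3t1 * D.rootVec b a21)))), middle_coeff hN]
  · exact (Skew.mul_mul (h.left.skew_rev3t2_corner hB) r21_1 (h.skew_corner hB a21)
      (h.skew_rev3t2 a1) (by simp [hB.qRoot_eq, coord]; field_simp)).smul_left _
  · exact (Skew.mul_mul (h.left.skew_rev32_corner hB) r31_1 (h.skew_corner hB a31)
      (h.skew_rev32 a1) (by simp [hB.qRoot_eq, coord]; field_simp)).smul_left _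
  · exact (Skew.mul_mul (h.left.skew_a2_corner hB) r3t1_1 (h.skew_corner hB a3t1)
      (h.skew a1 a2) (by simp [hB.qRoot_eq, coord]; field_simp)).smul_left _
  · have e := ((h.skew_corner hB a2t1).hasBracket.mul r2t1_1).congr (d := D.q 2 2 ^ 2)
      (by simp [hB.qRoot_eq, coord]; field_simp) rfl
    simp only [zero_mul, zero_add] at e
    rw [e, mul_smul_comm]
  · exact ((Skew.mul_mul (h.left.skew_rev32_rev3t2 hB) r31_21 (h.skew_rev3t2 a31)
      (h.skew_rev32 a21) (by simp [hB.qRoot_eq, coord]; field_simp)).smul_left _).smul_right _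
  · have n1 := h.skew_rev3t2 a3t1
    have n2 := h.skew_rev32 a31
    rw [h.left.cornerVec_eq hB]
    have n3 := h.skew a21 a2
    simp only [pow_two, mul_add, mul_sub, sub_mul, smul_mul_assoc, mul_smul_comm, mul_assoc,
      n1.assoc, n2.assoc, show _ = _ from r3t1_21, l.assoc, n3.assoc]
    match_scalars <;> simp [hB.qRoot_eq, hB.q_eq.2.2.2.2, coord, ξ, -mul_eq_mul_left_iff,
      -mul_eq_mul_right_iff] <;> field_simp <;> ring
  · exact ((((h.skew_rev3t2 a2t1).mul_right r2t1_21).congr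
      (by simp [hB.qRoot_eq, coord]; field_simp))).smul_right _
  · exact ((Skew.mul_mul (h.left.skew_a2_rev32 hB) r3t1_31 (h.skew_rev32 a3t1)
      (h.skew a31 a2) (by simp [hB.qRoot_eq, coord]; field_simp)).smul_left _).smul_right _
  · exact ((((h.skew_rev32 a2t1).mul_right r2t1_31).congr
      (by simp [hB.qRoot_eq, coord]; field_simp))).smul_right _
  · exact ((((h.skew a2t1 a2).mul_right r2t1_3t1).congr
      (by simp [hB.qRoot_eq, coord]; field_simp))).smul_right _
  · have e1 := r21_1.mul_left r3t1_1
    have e2 := (r3t1_1.mul_left r21_1).congr (mul_comm _ _)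
    have f1 := (h.skew_corner hB a21).mul_left (h.skew_corner hB a3t1)
    have f2 := ((h.skew_corner hB a3t1).mul_left (h.skew_corner hB a21)).congr (mul_comm _ _)
    have e := ((e1.smul_left (D.qRoot a3t1 a1)).sub_left (e2.smul_left (D.qRoot a2 a3t1))).smul_left
      (D.qRoot a2t1 a2 * D.qRoot a2t1 a3t2)
    have f := ((f1.smul_left (D.qRoot a3t1 a1)).sub_left (f2.smul_left (D.qRoot a2 a3t1))).smul_left
      (D.qRoot a2t1 a2 * D.qRoot a2t1 a3t2)
    exact Skew.mul_mul (Skew.refl _) e f (h.skew_corner hB a1)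
      (by simp [hB.qRoot_eq, coord]; field_simp)
  · have n1 := h.skew_rev3t2 a3t1
    have n2 := h.skew_rev3t2 a21
    have n3 := h.skew_corner hB a21
    have n4 := h.skew_rev3t2 a31
    have c1 := h.left.skew_rev3t2_corner hB
    simp only [mul_add, add_mul, mul_sub, sub_mul, smul_mul_assoc, mul_smul_comm, mul_assoc,
      n1.assoc, n2.assoc, n3.assoc, n4.assoc, c1.assoc, show _ = _ from r3t1_21, r31_21.assoc,
      show _ = _ from r31_21]
    match_scalars <;> simp [hB.qRoot_eq, coord, ξ, -mul_eq_mul_left_iff, -mul_eq_mul_right_iff] <;>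
      field_simp <;> ring
  · have e := ((((r2t1_21.mul_right r2t1_3t1).smul_right (D.qRoot a3t1 a1)).sub_right
      (((r2t1_3t1.mul_right r2t1_21).congr (mul_comm _ _)).smul_right (D.qRoot a2 a3t1))).smul_right
      (D.qRoot a2t1 a2 * D.qRoot a2t1 a3t2))
    exact ((h.skew_corner hB a2t1).mul_right e).congr (by simp [hB.qRoot_eq, coord]; field_simp)
  · have l2 := h.left.skew_a2_a2t1 hB hN
    exact (((h.left.skew_corner_a2t1 hB hN).mul_left (h.skew a1 a2t1)).congr
      (by simp [hB.qRoot_eq, coord]; field_simp)).add_left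
      ((((((h.left.skew_rev3t2_a2t1 hB hN).mul_left (h.skew a21 a2t1)).congr
        (by simp [hB.qRoot_eq, coord]; field_simp)).smul_left _).add_left
      (((((h.left.skew_rev32_a2t1 hB hN).mul_left (h.skew a31 a2t1)).congr
        (by simp [hB.qRoot_eq, coord]; field_simp)).smul_left _).add_left
      (((l2.mul_left (h.skew a3t1 a2t1)).congr
        (by simp [hB.qRoot_eq, coord]; field_simp)).smul_left _))).add_left
      ((h.skew a2t1 a2t1).congr (by simp [hB.qRoot_eq, coord]; field_simp)))

end IsSerrePair
end YDDatum

/-! ### The `N`-th power of the corner element -/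

section QPower

open Finset

variable {k : Type*} [Field k] {E : Type*} [Ring E] [Algebra k E]

theorem pow_choose_two_eq_one {M : Type*} [Monoid M] {x : M} {N : ℕ} (hodd : Odd N)
    (hx : x ^ N = 1) : x ^ N.choose 2 = 1 := by
  obtain ⟨m, rfl⟩ := hodd
  rw [Nat.choose_two_right, Nat.add_sub_cancel, mul_left_comm, Nat.mul_div_cancel_left _ two_pos,
    pow_mul, hx, one_pow]

/-- The product `(X + p^m Z)(X + p^{m+1} Z) ⋯` of `n` factors. -/
def qShift (p : k) (X Z : E) (m n : ℕ) : E :=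
  ((List.range' m n).map fun j => X + p ^ j • Z).prod

/-- The `q`-binomial theorem for commuting elements. -/
theorem qShift_eq_sum {X Z : E} (h : Commute X Z) (p : k) (n : ℕ) : qShift p X Z 0 n =
    ∑ x ∈ antidiagonal n, qBinom p x.1 x.2 • (p ^ x.2.choose 2 • (X ^ x.1 * Z ^ x.2)) := by
  induction n with
  | zero => simp [qShift, qBinom]
  | succ n ih =>
    rw [sum_qBinom_succ p n fun i j => p ^ j.choose 2 • (X ^ i * Z ^ j), qShift, List.range'_concat,
      List.map_append, List.prod_append]
    rw [qShift] at ih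
    rw [ih, sum_mul]
    refine sum_congr rfl fun x hx => ?_
    rw [HasAntidiagonal.mem_antidiagonal] at hx
    have h1 : X ^ x.1 * Z ^ x.2 * X = X ^ (x.1 + 1) * Z ^ x.2 := by
      rw [mul_assoc, ← (h.pow_right x.2).eq, ← mul_assoc, pow_succ]
    have h2 : (x.2 + 1).choose 2 = x.2 + x.2.choose 2 := by
      rw [Nat.choose_succ_succ' x.2 1, Nat.choose_one_right]
    simp only [List.map_cons, List.map_nil, List.prod_cons, List.prod_nil, mul_one, smul_mul_assoc,
      mul_add, mul_smul_comm, h1, h2, ← hx, zero_add, one_mul]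
    rw [mul_assoc, ← pow_succ, pow_add, pow_add]
    module

theorem qShift_primitive {p : k} {N : ℕ} (hp : IsPrimitiveRoot p N) (hodd : Odd N) {X Z : E}
    (h : Commute X Z) : qShift p X Z 0 N = X ^ N + Z ^ N := by
  rw [qShift_eq_sum h, sum_qBinom_primitive hp hodd.pos
    fun i j => p ^ j.choose 2 • (X ^ i * Z ^ j)]
  simp [pow_choose_two_eq_one hodd hp.pow_eq_one, add_comm]

/-- If `W V = X + Z` for commuting `X`, `Z` that commute with `W` up to the scalars `t` and `t p`,
then `W^N V^N` is a multiple of `X^N + Z^N`. -/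
theorem pow_mul_pow_of_skew {p t : k} {N : ℕ} (hp : IsPrimitiveRoot p N) (hodd : Odd N)
    {W V X Z : E} (h : Commute X Z) (hWV : W * V = X + Z) (hX : Skew t W X)
    (hZ : Skew (t * p) W Z) : W ^ N * V ^ N = t ^ N.choose 2 • (X ^ N + Z ^ N) := by
  have hstep : ∀ m n, W * qShift p X Z m n = t ^ n • (qShift p X Z (m + 1) n * W) := by
    intro m n
    induction n generalizing m with
    | zero => simp [qShift]
    | succ n ih =>
      have ih := ih (m + 1)
      simp only [qShift, List.range'_succ, List.map_cons, List.prod_cons] at ih ⊢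
      have e : W * (X + p ^ m • Z) = t • ((X + p ^ (m + 1) • Z) * W) := by
        rw [mul_add, hX, mul_smul_comm, hZ, add_mul, smul_mul_assoc, pow_succ]
        module
      rw [← mul_assoc, e, smul_mul_assoc, mul_assoc, ih, mul_smul_comm, smul_smul, ← pow_succ',
        mul_assoc]
  have key : ∀ n, W ^ n * V ^ n = t ^ n.choose 2 • qShift p X Z 0 n := by
    intro n
    induction n with
    | zero => simp [qShift]
    | succ n ih =>
      have hc : Commute (qShift p X Z 1 n) (X + Z) := by
        refine (Commute.list_prod_right _ _ fun y hy => ?_).symm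
        obtain ⟨j, -, rfl⟩ := List.mem_map.1 hy
        exact ((Commute.refl X).add_left h.symm).add_right
          ((h.add_left (Commute.refl Z)).smul_right _)
      have h2 : (n + 1).choose 2 = n.choose 2 + n := by
        rw [Nat.choose_succ_succ' n 1, Nat.choose_one_right, add_comm]
      rw [pow_succ', pow_succ V, mul_assoc, ← mul_assoc (W ^ n), ih, smul_mul_assoc, mul_smul_comm,
        ← mul_assoc, hstep, smul_mul_assoc, mul_assoc, hWV, hc.eq, smul_smul, h2, pow_add]
      simp [qShift, List.range'_succ]
  rw [key, qShift_primitive hp hodd h]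

/-- If `x y = c y x` then `(y x)^n` and `y^n x^n` differ by a power of `c`. -/
theorem Skew.mul_pow {c : k} {x y : E} (h : Skew c x y) (n : ℕ) :
    (y * x) ^ n = c ^ n.choose 2 • (y ^ n * x ^ n) := by
  have hs : ∀ n, x ^ n * y = c ^ n • (y * x ^ n) := by
    intro n
    induction n with
    | zero => simp
    | succ n ih => rw [pow_succ', mul_assoc, ih, mul_smul_comm, ← mul_assoc, h, smul_mul_assoc,
        mul_assoc, smul_smul, pow_succ]
  induction n with
  | zero => simp
  | succ n ih =>
    have h2 : (n + 1).choose 2 = n.choose 2 + n := by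
      rw [Nat.choose_succ_succ' n 1, Nat.choose_one_right, add_comm]
    rw [pow_succ, ih, smul_mul_assoc, mul_assoc, ← mul_assoc (x ^ n), hs, smul_mul_assoc,
      mul_smul_comm, smul_smul, h2, pow_add, pow_succ y, pow_succ x]
    simp only [mul_assoc]

end QPower

namespace YDDatum
variable {k Γ : Type*} [Field k] [CommGroup Γ] {D : YDDatum k Γ (Fin 3)}
variable {E : Type*} [Ring E] [Algebra k E] {y : Fin 3 → E}

open PosRoot

/-- With `W = ξ_2² y₂` and `V = y_{α₂+2α₃}`, the product `W V` is the sum of `cornerVec` and a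
multiple of `y_{α₂+α₃}²`, to which `pow_mul_pow_of_skew` applies. -/
theorem IsSerre.cornerVec_pow (hB : D.IsCartanB3) (hodd : Odd D.N) (hy : D.IsSerre y) :
    (D.ξ 2 ^ D.N) ^ 2 • (D.rootVec y a2 ^ D.N * D.rootVec y a3t2 ^ D.N) =
      (D.q 1 2 ^ D.N) ^ (D.N - 1) • (D.cornerVec y ^ D.N +
        (D.ξ 1 ^ D.N * D.ξ 2 ^ D.N * D.q 1 2 ^ D.N) • (D.rootVec y a32 ^ D.N) ^ 2) := by
  have hq : D.q 2 2 ^ D.N = 1 := isPrimitiveRoot_q.pow_eq_one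
  have hp := (isPrimitiveRoot_q_sq hodd).inv
  have h32 : Commute (D.cornerVec y) (D.rootVec y a32) := by
    have e := ((hy.skew_a3_corner hB).mul_left (hy.skew_a2_corner hB)).sub_left
      ((((hy.skew_a2_corner hB).mul_left (hy.skew_a3_corner hB)).congr (mul_comm _ _)).smul_left
        (D.qRoot a3 a2))
    have e' := e.congr (d := 1) (by simp [hB.qRoot_eq, coord]; field_simp)
    rw [Skew, one_smul] at e'
    exact e'.symm
  have h2 := (hy.skew_a2_a32).mul_right (hy.skew_a2_a32)
  have key := pow_mul_pow_of_skew hp hodd (W := D.ξ 2 ^ 2 • D.rootVec y a2) (V := D.rootVec y a3t2)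
    (X := D.cornerVec y)
    (Z := (D.ξ 1 * D.ξ 2 * D.q 1 2) • (D.rootVec y a32 * D.rootVec y a32))
    ((h32.mul_right h32).smul_right _)
    (by rw [cornerVec, smul_mul_assoc]; match_scalars <;> ring) ((hy.skew_a2_corner hB).smul_left _)
    (((h2.congr (by simp [hB.qRoot_eq, coord]; field_simp)).smul_left _).smul_right _)
  have ht : D.qRoot a2 a3t2 ^ D.N.choose 2 = (D.q 1 2 ^ D.N) ^ (D.N - 1) := by
    have e : D.qRoot a2 a3t2 = D.q 2 2 ^ 2 * D.q 1 2 ^ 2 := by simp [hB.qRoot_eq, coord]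
    rw [e, mul_pow, pow_right_comm, pow_choose_two_eq_one hodd hq, one_pow, one_mul, ← pow_mul,
      ← pow_mul, mul_comm 2, Nat.choose_two_right]
    congr 1
    obtain ⟨m, hm⟩ := hodd
    rw [hm, Nat.add_sub_cancel, mul_left_comm, Nat.mul_div_cancel_left _ two_pos]
    ring
  rw [ht, smul_pow, smul_mul_assoc, smul_pow, mul_pow, mul_pow] at key
  rw [pow_right_comm, key, (Commute.refl (D.rootVec y a32)).mul_pow, pow_two (_ ^ D.N)]

end YDDatum

/-! ### The components of degree at most one of a Nichols algebra -/

namespace YDDatum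

section Nichols

variable {k Γ ι : Type*} [Field k] [CommGroup Γ] (D : YDDatum k Γ ι)

/-- The projection of the tensor algebra onto its components of degree at most one. -/
def tensorToTriv : D.T →ₐ[k] TrivSqZeroExt k (ι →₀ k) :=
  FreeAlgebra.lift k fun i => TrivSqZeroExt.inr (Finsupp.single i 1)

/-- The ideal of the Nichols algebra lives in degrees at least two. -/
theorem tensorToTriv_eq_zero {a : D.T} (ha : a ∈ D.nicholsIdeal) : D.tensorToTriv a = 0 := by
  have key : ∀ n, D.tensorDeg (n + 2) ≤ LinearMap.ker D.tensorToTriv.toLinearMap := by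
    intro n
    have h1 : ∀ x ∈ Submodule.span k (Set.range (FreeAlgebra.ι k : ι → D.T)),
        ∃ m, D.tensorToTriv x = TrivSqZeroExt.inr m := by
      intro x hx
      induction hx using Submodule.span_induction with
      | mem x hx =>
        obtain ⟨i, rfl⟩ := hx
        exact ⟨_, by simp [tensorToTriv]; rfl⟩
      | zero => exact ⟨0, by simp⟩
      | add x y _ _ hx hy =>
        obtain ⟨⟨m, hm⟩, m', hm'⟩ := And.intro hx hy
        exact ⟨m + m', by rw [map_add, hm, hm', TrivSqZeroExt.inr_add]⟩
      | smul c x _ hx =>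
        obtain ⟨m, hm⟩ := hx
        exact ⟨c • m, by rw [map_smul, hm, TrivSqZeroExt.inr_smul]⟩
    have h2 : Submodule.span k (Set.range (FreeAlgebra.ι k : ι → D.T)) *
        Submodule.span k (Set.range (FreeAlgebra.ι k : ι → D.T)) ≤
        LinearMap.ker D.tensorToTriv.toLinearMap := by
      rw [Submodule.mul_le]
      intro x hx y hy
      obtain ⟨⟨m, hm⟩, m', hm'⟩ := And.intro (h1 x hx) (h1 y hy)
      rw [LinearMap.mem_ker, AlgHom.toLinearMap_apply, map_mul, hm, hm', TrivSqZeroExt.inr_mul_inr]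
    rw [tensorDeg, pow_add, pow_two, Submodule.mul_le]
    intro x _ y hy
    have := h2 hy
    rw [LinearMap.mem_ker, AlgHom.toLinearMap_apply] at this ⊢
    rw [map_mul, this, mul_zero]
  refine D.nicholsIdeal_induction (P := fun a => D.tensorToTriv a = 0) (map_zero _) ?_ ?_ ha
  · intro a b ha hb
    rw [map_add, ha, hb, add_zero]
  · intro J hJ _ a haJ
    exact (iSup_le key) (hJ.degree haJ)

/-- The projection of the Nichols algebra onto its components of degree at most one. -/
def nicholsToTriv : D.Nichols →ₐ[k] TrivSqZeroExt k (ι →₀ k) :=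
  Ideal.Quotient.liftₐ D.nicholsIdeal D.tensorToTriv fun _ ha => D.tensorToTriv_eq_zero ha

theorem nicholsToTriv_proj (i : ι) : D.nicholsToTriv (D.proj (FreeAlgebra.ι k i)) =
    TrivSqZeroExt.inr (Finsupp.single i 1) := by
  change D.tensorToTriv (FreeAlgebra.ι k i) = _
  simp [tensorToTriv]

instance : Nontrivial D.Nichols := D.nicholsToTriv.toRingHom.domain_nontrivial

theorem linearIndependent_proj_ι :
    LinearIndependent k fun i => D.proj (FreeAlgebra.ι k i) := by
  refine LinearIndependent.of_comp D.nicholsToTriv.toLinearMap ?_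
  have e : (D.nicholsToTriv.toLinearMap ∘ fun i => D.proj (FreeAlgebra.ι k i)) =
      TrivSqZeroExt.inrHom k (ι →₀ k) ∘ fun i => Finsupp.single i 1 := by
    ext1 i
    exact D.nicholsToTriv_proj i
  rw [e]
  refine LinearIndependent.map' ?_ _ (LinearMap.ker_eq_bot.2 TrivSqZeroExt.inr_injective)
  exact (Finsupp.basisSingleOne (R := k) (ι := ι)).linearIndependent

theorem nicholsComul_one : D.nicholsComul 1 = 1 ⊗ₜ 1 := by
  change TensorProduct.map D.proj.toLinearMap D.proj.toLinearMap (D.tensorComul 1) = _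
  simp [tensorComul]

theorem nicholsCoact_one : D.nicholsCoact 1 = 1 ⊗ₜ 1 := by
  change LinearMap.lTensor (MonoidAlgebra k Γ) D.proj.toLinearMap (D.coact 1) = _
  simp [Algebra.TensorProduct.one_def]

theorem bosComul_bosGroup (g : Γ) :
    D.bosComul (D.bosGroup g) = D.bosGroup g ⊗ₜ D.bosGroup g := by
  have e : (SkewMonoidAlgebra.coeffLinearEquiv : D.Bos ≃ₗ[k] (Γ →₀ D.Nichols)) (D.bosGroup g) =
      Finsupp.single g 1 := by
    simp [bosGroup, SkewMonoidAlgebra.coeffLinearEquiv, SkewMonoidAlgebra.coeff_single]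
  rw [bosComul, LinearMap.comp_apply, LinearEquiv.coe_coe, e, Finsupp.lsum_single]
  simp only [LinearMap.comp_apply, nicholsComul_one, LinearMap.lTensor_tmul, nicholsCoact_one,
    LinearEquiv.coe_coe, TensorProduct.assoc_symm_tmul, TensorProduct.map_tmul]
  simp [smash, bosGroup, MonoidAlgebra.one_def]
  rfl

end Nichols

end YDDatum

/-! ### The group inside a lifting -/

namespace YDDatum

variable {k Γ ι A : Type*} [Field k] [CommGroup Γ] {D : YDDatum k Γ ι} [Ring A] [HopfAlgebra k A]

theorem bosGroup_mul (g h : Γ) : D.bosGroup g * D.bosGroup h = D.bosGroup (g * h) := by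
  simp [bosGroup, SkewMonoidAlgebra.single_mul_single]

theorem bosGen_mul_bosGroup (i : ι) (h : Γ) : D.bosGen i * D.bosGroup h =
    SkewMonoidAlgebra.single h (D.proj (FreeAlgebra.ι k i)) := by
  simp [bosGroup, bosGen, SkewMonoidAlgebra.single_mul_single]

theorem linearIndependent_single {κ : Type*} {v : κ → D.Nichols} (hv : LinearIndependent k v) :
    LinearIndependent k fun j : κ × Γ => (SkewMonoidAlgebra.single j.2 (v j.1) : D.Bos) := by
  refine LinearIndependent.of_comp
    (SkewMonoidAlgebra.coeffLinearEquiv : D.Bos ≃ₗ[k] (Γ →₀ D.Nichols)).toLinearMap ?_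
  have h := Finsupp.linearIndependent_single (φ := fun _ : Γ => κ) (f := fun _ => v) fun _ => hv
  exact h.comp (fun j : κ × Γ => ⟨j.2, j.1⟩) fun a b hab => by
    simp only [Sigma.mk.injEq, heq_eq_eq] at hab
    exact Prod.ext hab.2 hab.1

theorem linearIndependent_bosGroup : LinearIndependent k D.bosGroup := by
  have h := linearIndependent_single (D := D) (v := fun _ : Unit => (1 : D.Nichols))
    (LinearIndependent.of_subsingleton () one_ne_zero)
  have h' := h.comp (fun g => ((), g)) fun _ _ h => (Prod.ext_iff.1 h).2
  exact h'

theorem linearIndependent_bosGen_mul_bosGroup :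
    LinearIndependent k fun j : ι × Γ => D.bosGen j.1 * D.bosGroup j.2 := by
  simp only [bosGen_mul_bosGroup]
  exact linearIndependent_single (v := fun i => D.proj (FreeAlgebra.ι k i))
    D.linearIndependent_proj_ι

theorem bosDeg_le {κ : Type*} {v : κ → D.Nichols} {n : ℕ}
    (h : D.nicholsDeg n ≤ Submodule.span k (Set.range v)) : D.bosDeg n ≤ Submodule.span k
      (Set.range fun j : κ × Γ => (SkewMonoidAlgebra.single j.2 (v j.1) : D.Bos)) := by
  intro f hf
  rw [← SkewMonoidAlgebra.sum_single f, SkewMonoidAlgebra.sum_def]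
  refine Submodule.sum_mem _ fun g _ => ?_
  have h1 : Submodule.span k (Set.range v) ≤ (Submodule.span k
      (Set.range fun j : κ × Γ => (SkewMonoidAlgebra.single j.2 (v j.1) : D.Bos))).comap
      (SkewMonoidAlgebra.lsingle k g : D.Nichols →ₗ[k] D.Bos) := by
    rw [Submodule.span_le]
    rintro _ ⟨i, rfl⟩
    exact Submodule.subset_span ⟨(i, g), rfl⟩
  exact h1 (h (hf g))

theorem bosDeg_zero_le : D.bosDeg 0 ≤ Submodule.span k (Set.range D.bosGroup) := by
  refine (bosDeg_le (D := D) (v := fun _ : Unit => (1 : D.Nichols)) ?_).trans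
    (Submodule.span_mono ?_)
  · rw [nicholsDeg, tensorDeg, pow_zero, Submodule.one_eq_span, Submodule.map_span,
      Submodule.span_le]
    rintro _ ⟨_, rfl, rfl⟩
    rw [AlgHom.toLinearMap_apply, map_one]
    exact Submodule.subset_span ⟨(), rfl⟩
  · rintro _ ⟨j, rfl⟩
    exact ⟨j.2, rfl⟩

theorem bosDeg_one_le : D.bosDeg 1 ≤
    Submodule.span k (Set.range fun j : ι × Γ => D.bosGen j.1 * D.bosGroup j.2) := by
  simp only [bosGen_mul_bosGroup]
  refine bosDeg_le (v := fun i => D.proj (FreeAlgebra.ι k i)) ?_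
  rw [nicholsDeg, tensorDeg, pow_one, Submodule.map_span, ← Set.range_comp]
  rfl

namespace Lifting

variable (L : D.Lifting A)

theorem grp_mem (g : Γ) : L.grp g ∈ coradFilt k A 0 := (L.exists_grp g).choose.2

theorem symbol_grp (g : Γ) : L.symbol 0 ⟨L.grp g, L.grp_mem g⟩ = D.bosGroup g :=
  (L.exists_grp g).choose_spec

theorem symbol_zero_injective : Function.Injective (L.symbol 0) :=
  (injective_iff_map_eq_zero _).2 fun a => (L.symbol_zero a).1

theorem eq_grp {g : Γ} {a : A} (ha : a ∈ coradFilt k A 0)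
    (h : L.symbol 0 ⟨a, ha⟩ = D.bosGroup g) : a = L.grp g :=
  congrArg Subtype.val (L.symbol_zero_injective (h.trans (L.symbol_grp g).symm))

theorem grp_one : L.grp 1 = 1 := by
  obtain ⟨h, e⟩ := L.symbol_one
  exact (L.eq_grp h e).symm

theorem grp_mul (g h : Γ) : L.grp (g * h) = L.grp g * L.grp h := by
  obtain ⟨hm, e⟩ := L.symbol_mul 0 0 ⟨_, L.grp_mem g⟩ ⟨_, L.grp_mem h⟩
  refine (L.eq_grp hm ?_).symm
  rw [L.symbol_grp, L.symbol_grp, bosGroup_mul] at e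
  exact e

/-- The inclusion of `Γ` into the lifting, as a homomorphism of monoids. -/
def grpHom : Γ →* A where
  toFun := L.grp
  map_one' := L.grp_one
  map_mul' := L.grp_mul

theorem grp_pow (g : Γ) (n : ℕ) : L.grp (g ^ n) = L.grp g ^ n := map_pow L.grpHom g n

theorem grp_commute (g h : Γ) : Commute (L.grp g) (L.grp h) := by
  rw [Commute, SemiconjBy, ← L.grp_mul, ← L.grp_mul, mul_comm]

theorem grp_mul_inv (g : Γ) : L.grp g * L.grp g⁻¹ = 1 := by
  rw [← L.grp_mul, mul_inv_cancel, L.grp_one]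

theorem grp_inv_mul (g : Γ) : L.grp g⁻¹ * L.grp g = 1 := by
  rw [← L.grp_mul, inv_mul_cancel, L.grp_one]

theorem grp_ne_zero (g : Γ) : L.grp g ≠ 0 := by
  intro h
  have e := L.symbol_grp g
  have : (⟨L.grp g, L.grp_mem g⟩ : coradFilt k A 0) = 0 := Subtype.ext h
  rw [this, map_zero] at e
  exact (linearIndependent_bosGroup (D := D)).ne_zero g e.symm

theorem comul_grp (g : Γ) : Coalgebra.comul (R := k) (L.grp g) = L.grp g ⊗ₜ[k] L.grp g := by
  obtain ⟨t, h1, h2⟩ := L.symbol_comul 0 ⟨_, L.grp_mem g⟩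
  rw [Finset.Nat.antidiagonal_zero, Finset.sum_singleton] at h1 h2
  rw [L.symbol_grp, bosComul_bosGroup, ← L.symbol_grp, ← TensorProduct.map_tmul] at h2
  have h3 := TensorProduct.map_injective_of_flat_flat _ _ L.symbol_zero_injective
    L.symbol_zero_injective h2
  rw [h1, ← h3]
  rfl

theorem isGroupLikeElem_grp (g : Γ) : IsGroupLikeElem k (L.grp g) where
  counit_eq_one := by
    have h := Coalgebra.rTensor_counit_comul (R := k) (L.grp g)
    rw [L.comul_grp, LinearMap.rTensor_tmul] at h
    have h' := congrArg (TensorProduct.lid k A) h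
    rw [TensorProduct.lid_tmul, TensorProduct.lid_tmul, one_smul] at h'
    have h'' : (Coalgebra.counit (R := k) (L.grp g) - 1) • L.grp g = 0 := by
      rw [sub_smul, h', one_smul, sub_self]
    exact sub_eq_zero.1 ((smul_eq_zero.1 h'').resolve_right (L.grp_ne_zero g))
  comul_eq_tmul_self := L.comul_grp g

theorem antipode_grp (g : Γ) : HopfAlgebra.antipode k (L.grp g) = L.grp g⁻¹ :=
  left_inv_eq_right_inv (L.isGroupLikeElem_grp g).antipode_mul_cancel (L.grp_mul_inv g)

theorem linearIndependent_grp : LinearIndependent k L.grp := by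
  have h := linearIndependent_bosGroup (D := D)
  have e : D.bosGroup = L.symbol 0 ∘ fun g => ⟨L.grp g, L.grp_mem g⟩ :=
    funext fun g => (L.symbol_grp g).symm
  rw [e] at h
  exact (h.of_comp _).map' (Submodule.subtype _) (Submodule.ker_subtype _)

end Lifting

end YDDatum

/-! ### Skew-primitive elements of a lifting -/

namespace YDDatum.Lifting

variable {k Γ ι A : Type*} [Field k] [CommGroup Γ] {D : YDDatum k Γ ι} [Ring A] [HopfAlgebra k A]
variable {L : D.Lifting A} {y : ι → A}

namespace IsLiftOfGenerators

theorem exists_mul_grp_mem (hy : L.IsLiftOfGenerators y) (j : ι × Γ) :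
    ∃ h : y j.1 * L.grp j.2 ∈ coradFilt k A 1,
      L.symbol 1 ⟨_, h⟩ = D.bosGen j.1 * D.bosGroup j.2 := by
  obtain ⟨h1, e1⟩ := hy.symbol_eq j.1
  obtain ⟨h, e⟩ := L.symbol_mul 1 0 ⟨_, h1⟩ ⟨_, L.grp_mem j.2⟩
  exact ⟨h, by rw [← e1, ← L.symbol_grp]; exact e⟩

/-- The elements `y_i h` and `h`, for `h ∈ Γ`, which form a basis of `A_1`. -/
def family (_hy : L.IsLiftOfGenerators y) : ι × Γ ⊕ Γ → A :=
  Sum.elim (fun j => y j.1 * L.grp j.2) L.grp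

theorem linearIndependent_family (hy : L.IsLiftOfGenerators y) :
    LinearIndependent k hy.family := by
  choose hm hs using hy.exists_mul_grp_mem
  have h1 : LinearIndependent k (L.symbol 1 ∘ fun j : ι × Γ => ⟨y j.1 * L.grp j.2, hm j⟩) := by
    have e : (L.symbol 1 ∘ fun j : ι × Γ => ⟨y j.1 * L.grp j.2, hm j⟩) =
        fun j : ι × Γ => D.bosGen j.1 * D.bosGroup j.2 := funext hs
    rw [e]
    exact linearIndependent_bosGen_mul_bosGroup
  refine LinearIndependent.sum_type
    ((h1.of_comp _).map' (Submodule.subtype _) (Submodule.ker_subtype _)) L.linearIndependent_grp ?_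
  rw [Submodule.disjoint_def]
  intro x hx hx'
  have hx0 : x ∈ coradFilt k A 0 :=
    (Submodule.span_le.2 (by rintro _ ⟨g, rfl⟩; exact L.grp_mem g)) hx'
  obtain ⟨c, rfl⟩ := (Finsupp.mem_span_range_iff_exists_finsupp).1 hx
  have e : (c.sum fun i a => a • ((⟨y i.1 * L.grp i.2, hm i⟩ : coradFilt k A 1) : A)) =
      ((c.sum fun i a => a • ⟨y i.1 * L.grp i.2, hm i⟩ : coradFilt k A 1) : A) := by
    simp [Finsupp.sum]
  have h2 := (L.symbol_succ 0 (c.sum fun i a => a • ⟨y i.1 * L.grp i.2, hm i⟩)).2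
    (by rw [← e]; exact hx0)
  rw [map_finsuppSum] at h2
  simp only [map_smul] at h2
  have h3 : c = 0 := linearIndependent_iff.1 h1 c h2
  rw [h3]
  simp

theorem mem_span_family (hy : L.IsLiftOfGenerators y) {x : A} (hx : x ∈ coradFilt k A 1) :
    x ∈ Submodule.span k (Set.range hy.family) := by
  choose hm hs using hy.exists_mul_grp_mem
  have hA0 : coradFilt k A 0 ≤ Submodule.span k (Set.range hy.family) := by
    intro a ha
    have h1 : L.symbol 0 ⟨a, ha⟩ ∈ D.bosDeg 0 := L.range_symbol 0 ▸ LinearMap.mem_range_self _ _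
    obtain ⟨c, hc⟩ := (Finsupp.mem_span_range_iff_exists_finsupp).1 (bosDeg_zero_le h1)
    have h2 : L.symbol 0 (c.sum fun g a => a • ⟨L.grp g, L.grp_mem g⟩) = L.symbol 0 ⟨a, ha⟩ := by
      rw [← hc, map_finsuppSum]
      simp only [map_smul, L.symbol_grp]
    have h3 := congrArg Subtype.val (L.symbol_zero_injective h2)
    change _ = a at h3
    rw [← h3]
    simp only [Finsupp.sum, Submodule.coe_sum, Submodule.coe_smul]
    exact Submodule.sum_mem _ fun g _ => Submodule.smul_mem _ _
      (Submodule.subset_span ⟨Sum.inr g, rfl⟩)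
  have h1 : L.symbol 1 ⟨x, hx⟩ ∈ D.bosDeg 1 := L.range_symbol 1 ▸ LinearMap.mem_range_self _ _
  obtain ⟨c, hc⟩ := (Finsupp.mem_span_range_iff_exists_finsupp).1 (bosDeg_one_le h1)
  have h2 : L.symbol 1 (⟨x, hx⟩ - c.sum fun j a => a • ⟨y j.1 * L.grp j.2, hm j⟩) = 0 := by
    rw [map_sub, ← hc, map_finsuppSum]
    simp only [map_smul, hs, sub_self]
  have h3 := hA0 ((L.symbol_succ 0 _).1 h2)
  rw [Submodule.coe_sub] at h3
  refine (Submodule.sub_mem_iff_left _ ?_).1 h3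
  simp only [Finsupp.sum, Submodule.coe_sum, Submodule.coe_smul]
  exact Submodule.sum_mem _ fun g _ => Submodule.smul_mem _ _
    (Submodule.subset_span ⟨Sum.inl g, rfl⟩)

theorem comul_mul_grp (hy : L.IsLiftOfGenerators y) (i : ι) (h : Γ) :
    Coalgebra.comul (R := k) (y i * L.grp h) =
      (y i * L.grp h) ⊗ₜ L.grp h + L.grp (D.g i * h) ⊗ₜ (y i * L.grp h) := by
  rw [Bialgebra.comul_mul, hy.comul_eq, L.comul_grp, add_mul, Algebra.TensorProduct.tmul_mul_tmul,
    Algebra.TensorProduct.tmul_mul_tmul, one_mul, L.grp_mul]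

/-- Skew-primitive elements lie in the first term of the coradical filtration. -/
theorem mem_coradFilt_one {g : Γ} {x : A}
    (hx : Coalgebra.comul (R := k) x = x ⊗ₜ 1 + L.grp g ⊗ₜ x) : x ∈ coradFilt k A 1 := by
  rw [coradFilt, Submodule.mem_comap, hx]
  refine Submodule.add_mem_sup ?_ ?_
  · exact ⟨⟨x, Submodule.mem_top⟩ ⊗ₜ ⟨1, by rw [← L.grp_one]; exact L.grp_mem 1⟩, rfl⟩
  · exact ⟨⟨L.grp g, L.grp_mem g⟩ ⊗ₜ ⟨x, Submodule.mem_top⟩, rfl⟩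

/-- A skew-primitive element on which `Γ` acts by a character is a multiple of `g - 1`, unless its
degree and character are those of a generator. -/
theorem eq_smul_grp_sub_one [Finite Γ] [Finite ι] (hy : L.IsLiftOfGenerators y) {g : Γ}
    {χ : Γ →* kˣ} {x : A} (hx : Coalgebra.comul (R := k) x = x ⊗ₜ 1 + L.grp g ⊗ₜ x)
    (hχ : ∀ h, L.grp h * x = (χ h : k) • (x * L.grp h))
    (hne : ∀ i, g = D.g i → χ ≠ D.χ i) :
    ∃ d : k, x = d • (L.grp g - 1) ∧ (g = 1 ∨ χ ≠ 1 → d = 0) := by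
  classical
  cases nonempty_fintype Γ
  cases nonempty_fintype ι
  obtain ⟨c, hc⟩ := (Submodule.mem_span_range_iff_exists_fun k).1
    (hy.mem_span_family (mem_coradFilt_one hx))
  obtain ⟨Λ, hΛ⟩ := LinearMap.exists_leftInverse_of_injective
    (Finsupp.linearCombination k hy.family) (LinearMap.ker_eq_bot.2 hy.linearIndependent_family)
  have hΛe : ∀ j, Λ (hy.family j) = Finsupp.single j 1 := by
    intro j
    have := LinearMap.congr_fun hΛ (Finsupp.single j 1)
    simpa using this
  -- coordinates with respect to the family, and their tensor products
  let φ : (ι × Γ ⊕ Γ) → A →ₗ[k] k := fun j => (Finsupp.lapply j).comp Λ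
  have hφg : ∀ j h, φ j (L.grp h) = if Sum.inr h = j then 1 else 0 := fun j h => by
    have := hΛe (Sum.inr h)
    simp only [family, Sum.elim_inr] at this
    simp [φ, this, Finsupp.single_apply]
  have hφy : ∀ j i h, φ j (y i * L.grp h) = if Sum.inl (i, h) = j then 1 else 0 := fun j i h => by
    have := hΛe (Sum.inl (i, h))
    simp only [family, Sum.elim_inl] at this
    simp [φ, this, Finsupp.single_apply]
  let β : (ι × Γ ⊕ Γ) → (ι × Γ ⊕ Γ) → A ⊗[k] A →ₗ[k] k := fun j j' =>
    (LinearMap.mul' k k).comp (TensorProduct.map (φ j) (φ j'))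
  have hβ : ∀ j j' a b, β j j' (a ⊗ₜ b) = φ j a * φ j' b := fun j j' a b => by simp [β]
  rw [Fintype.sum_sum_type] at hc
  simp only [family, Sum.elim_inl, Sum.elim_inr] at hc
  have hφx : ∀ j, φ j x = c j := by
    intro j
    rw [← hc]
    cases j <;> simp [hφg, hφy]
  have h1 : ∀ j, φ j 1 = if Sum.inr 1 = j then 1 else 0 := fun j => by
    rw [← L.grp_one, hφg]
  have key : ∀ j j', (∑ p : ι × Γ, c (Sum.inl p) *
        ((if Sum.inl p = j then 1 else 0) * (if Sum.inr p.2 = j' then 1 else 0) +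
          (if Sum.inr (D.g p.1 * p.2) = j then 1 else 0) * (if Sum.inl p = j' then 1 else 0)) +
      ∑ h : Γ, c (Sum.inr h) * ((if Sum.inr h = j then 1 else 0) *
        (if Sum.inr h = j' then 1 else 0))) =
      c j * (if Sum.inr 1 = j' then 1 else 0) + (if Sum.inr g = j then 1 else 0) * c j' := by
    intro j j'
    have e := congrArg (β j j') hx
    rw [map_add, hβ, hβ, hφx, hφx, h1, hφg] at e
    rw [← e]
    conv_rhs => rw [← hc]
    simp only [map_add, map_sum, map_smul, hy.comul_mul_grp, L.comul_grp, hβ, hφg, hφy,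
      smul_eq_mul, Prod.mk.eta]
  -- comparing coefficients in `Δ(x) = x ⊗ 1 + g ⊗ x`: only the `y_i` with `g_i = g` can occur
  have hc1 : ∀ i h, h ≠ 1 → c (Sum.inl (i, h)) = 0 := by
    intro i h hh
    have e := key (Sum.inl (i, h)) (Sum.inr h)
    rw [Fintype.sum_eq_single (i, h) fun p hp => by simp [hp]] at e
    simpa [hh.symm] using e
  have hc2 : ∀ i, g ≠ D.g i → c (Sum.inl (i, 1)) = 0 := by
    intro i hi
    have e := key (Sum.inr (D.g i)) (Sum.inl (i, 1))
    rw [Fintype.sum_eq_single (i, 1) fun p hp => by simp [hp]] at e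
    simpa [hi] using e
  have hc3 : ∀ p, c (Sum.inl p) = 0 := by
    rintro ⟨i, h⟩
    by_cases hh : h = 1
    · subst hh
      by_cases hi : g = D.g i
      · -- for those, `χ ≠ χ_i`, and conjugation by a suitable `h` gives the coefficient zero
        obtain ⟨h, hh⟩ := DFunLike.ne_iff.1 (hne i hi)
        have e := congrArg (φ (Sum.inl (i, h))) (hχ h)
        have e1 : ∀ p : ι × Γ, L.grp h * (y p.1 * L.grp p.2) =
            (D.χ p.1 h : k) • (y p.1 * L.grp (h * p.2)) := fun p => by
          rw [← mul_assoc, hy.conj_eq, smul_mul_assoc, mul_assoc, L.grp_mul]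
        rw [← hc] at e
        simp only [mul_add, add_mul, Finset.mul_sum, Finset.sum_mul, mul_smul_comm, smul_mul_assoc,
          e1, mul_assoc, ← L.grp_mul, map_add, map_sum, map_smul, hφy, hφg, smul_eq_mul] at e
        rw [Fintype.sum_eq_single (i, 1), Fintype.sum_eq_single (i, 1)] at e
        · simp only [mul_one, one_mul, if_true, reduceCtorEq, if_false, mul_zero,
            Finset.sum_const_zero, add_zero] at e
          have e2 : ((χ h : k) - D.χ i h) * c (Sum.inl (i, 1)) = 0 := by linear_combination -e
          refine (mul_eq_zero.1 e2).resolve_left fun h0 => hh (Units.ext (sub_eq_zero.1 h0))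
        · rintro ⟨i', h'⟩ hp
          simp only [ne_eq, Prod.mk.injEq, not_and, Sum.inl.injEq, mul_eq_right] at hp ⊢
          simp
          tauto
        · rintro ⟨i', h'⟩ hp
          simp only [ne_eq, Prod.mk.injEq, not_and, Sum.inl.injEq] at hp ⊢
          simp
          tauto
      · exact hc2 i hi
    · exact hc1 i h hh
  simp only [hc3, zero_smul, Finset.sum_const_zero, zero_add, zero_mul] at hc key
  -- what remains is an element of `kΓ`, in which only `g` and `1` can occur
  have hc4 : ∀ h h', (if h = h' then c (Sum.inr h) else 0) =
      c (Sum.inr h) * (if 1 = h' then 1 else 0) + (if g = h then 1 else 0) * c (Sum.inr h') := by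
    intro h h'
    have e := key (Sum.inr h) (Sum.inr h')
    rw [Fintype.sum_eq_single h fun p hp => by simp [hp]] at e
    simpa using e
  have hx1 : g = 1 → x = 0 := by
    rintro rfl
    rw [← hc]
    refine Finset.sum_eq_zero fun h _ => ?_
    have e := hc4 1 h
    by_cases hh : 1 = h
    · subst hh
      simp at e
      rw [e, zero_smul]
    · simp [hh] at e
      rw [← e, zero_smul]
  have hx2 : ∃ d : k, x = d • (L.grp g - 1) := by
    by_cases hg : g = 1
    · exact ⟨0, by rw [hx1 hg, zero_smul]⟩
    · refine ⟨c (Sum.inr g), ?_⟩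
      rw [← hc, Fintype.sum_eq_add g 1 hg]
      · have e := hc4 g 1
        simp [hg] at e
        rw [L.grp_one, smul_sub, sub_eq_add_neg, ← neg_smul]
        congr 2
        linear_combination -e
      · rintro h ⟨h1, h2⟩
        have e := hc4 h h
        simp [Ne.symm h1, Ne.symm h2] at e
        rw [e, zero_smul]
  by_cases hx0 : x = 0
  · exact ⟨0, by rw [hx0, zero_smul], fun _ => rfl⟩
  · obtain ⟨d, hd⟩ := hx2
    refine ⟨d, hd, fun h => absurd ?_ hx0⟩
    rcases h with h | h
    · exact hx1 h
    · obtain ⟨h, hh⟩ := DFunLike.ne_iff.1 h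
      have e : L.grp h * x = x * L.grp h := by
        rw [hd, mul_smul_comm, smul_mul_assoc, mul_sub, sub_mul, (L.grp_commute h g).eq, mul_one,
          one_mul]
      rw [hχ h] at e
      have e2 : ((χ h : k) - 1) • (x * L.grp h) = 0 := by rw [sub_smul, e, one_smul, sub_self]
      have e3 := (smul_eq_zero.1 e2).resolve_left
        fun h0 => hh (Units.ext (by simpa using sub_eq_zero.1 h0))
      rw [← mul_one x, ← L.grp_mul_inv h, ← mul_assoc, e3, zero_mul]

end IsLiftOfGenerators

end YDDatum.Lifting

/-! ### Serre elements of a sum of two families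

For two families that commute with each other up to the braiding, the mixed terms of each Serre
element of the sum cancel.  In a lifting this says that the Serre elements are skew-primitive.
-/

namespace YDDatum

open PosRoot

section Cross

variable {k Γ : Type*} [Field k] [CommGroup Γ] {D : YDDatum k Γ (Fin 3)}
variable {E : Type*} [Ring E] [Algebra k E] {a b : Fin 3 → E}

theorem brk_a3_a1_add (hB : D.IsCartanB3) (h : ∀ i j, Skew (D.q i j) (b i) (a j)) :
    D.brk a3 a1 (D.rootVec (a + b) a3) (D.rootVec (a + b) a1) =
      D.brk a3 a1 (D.rootVec a a3) (D.rootVec a a1) +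
      D.brk a3 a1 (D.rootVec b a3) (D.rootVec b a1) := by
  obtain ⟨-, -, -, q20, -⟩ := hB.q_eq
  simp only [rootVec, brk, Pi.add_apply, mul_add, add_mul, smul_add,
    show ∀ i j, _ = _ from h]
  match_scalars <;> simp [hB.qRoot_eq, coord, q20]

theorem brk_a21_a1_add (hB : D.IsCartanB3) (h : ∀ i j, Skew (D.q i j) (b i) (a j)) :
    D.brk a21 a1 (D.rootVec (a + b) a21) (D.rootVec (a + b) a1) =
      D.brk a21 a1 (D.rootVec a a21) (D.rootVec a a1) +
      D.brk a21 a1 (D.rootVec b a21) (D.rootVec b a1) := by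
  obtain ⟨q0, -, q10, -, -⟩ := hB.q_eq
  simp only [rootVec, brk, Pi.add_apply, mul_add, add_mul, mul_sub, sub_mul, smul_add, smul_sub,
    mul_smul_comm, smul_mul_assoc, mul_assoc, show ∀ i j, _ = _ from h, (h _ _).assoc]
  match_scalars <;> simp [hB.qRoot_eq, coord, q0, q10] <;> field_simp <;> ring

theorem brk_a2_a21_add (hB : D.IsCartanB3) (h : ∀ i j, Skew (D.q i j) (b i) (a j)) :
    D.brk a2 a21 (D.rootVec (a + b) a2) (D.rootVec (a + b) a21) =
      D.brk a2 a21 (D.rootVec a a2) (D.rootVec a a21) +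
      D.brk a2 a21 (D.rootVec b a2) (D.rootVec b a21) := by
  obtain ⟨-, q1, q10, -, -⟩ := hB.q_eq
  simp only [rootVec, brk, Pi.add_apply, mul_add, add_mul, mul_sub, sub_mul, smul_add, smul_sub,
    mul_smul_comm, smul_mul_assoc, mul_assoc, show ∀ i j, _ = _ from h, (h _ _).assoc]
  match_scalars <;> simp [hB.qRoot_eq, coord, q1, q10] <;> field_simp <;> ring

theorem brk_a32_a2_add (hB : D.IsCartanB3) (h : ∀ i j, Skew (D.q i j) (b i) (a j)) :
    D.brk a32 a2 (D.rootVec (a + b) a32) (D.rootVec (a + b) a2) =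
      D.brk a32 a2 (D.rootVec a a32) (D.rootVec a a2) +
      D.brk a32 a2 (D.rootVec b a32) (D.rootVec b a2) := by
  obtain ⟨-, q1, -, -, q21⟩ := hB.q_eq
  simp only [rootVec, brk, Pi.add_apply, mul_add, add_mul, mul_sub, sub_mul, smul_add, smul_sub,
    mul_smul_comm, smul_mul_assoc, mul_assoc, show ∀ i j, _ = _ from h, (h _ _).assoc]
  match_scalars <;> simp [hB.qRoot_eq, coord, q1, q21] <;> field_simp <;> ring

theorem brk_a3_a3t2_add (hB : D.IsCartanB3) (h : ∀ i j, Skew (D.q i j) (b i) (a j)) :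
    D.brk a3 a3t2 (D.rootVec (a + b) a3) (D.rootVec (a + b) a3t2) =
      D.brk a3 a3t2 (D.rootVec a a3) (D.rootVec a a3t2) +
      D.brk a3 a3t2 (D.rootVec b a3) (D.rootVec b a3t2) := by
  obtain ⟨-, -, -, -, q21⟩ := hB.q_eq
  simp only [rootVec, brk, Pi.add_apply, mul_add, add_mul, mul_sub, sub_mul, smul_add, smul_sub,
    mul_smul_comm, smul_mul_assoc, mul_assoc, show ∀ i j, _ = _ from h, (h _ _).assoc]
  match_scalars <;> simp [hB.qRoot_eq, coord, q21] <;> field_simp <;> ring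

end Cross
end YDDatum

/-! ### The Serre relations in a lifting -/

namespace YDDatum

open PosRoot

section Root

variable {k Γ : Type*} [Field k] [CommGroup Γ] {D : YDDatum k Γ (Fin 3)}
variable {E F : Type*} [Ring E] [Algebra k E] [Ring F] [Algebra k F]

theorem map_rootVec (f : E →ₐ[k] F) (y : Fin 3 → E) (α : PosRoot) :
    f (D.rootVec y α) = D.rootVec (f ∘ y) α := by
  cases α <;> simp [rootVec, brk]

theorem gRoot_a21 : D.gRoot a21 = D.gRoot a2 * D.gRoot a1 := by
  simp [gRoot, Fin.prod_univ_three, coord, mul_comm]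

theorem gRoot_a32 : D.gRoot a32 = D.gRoot a3 * D.gRoot a2 := by
  simp [gRoot, Fin.prod_univ_three, coord, mul_comm]

theorem gRoot_a31 : D.gRoot a31 = D.gRoot a3 * D.gRoot a21 := by
  simp [gRoot, Fin.prod_univ_three, coord, mul_comm]

theorem gRoot_a3t2 : D.gRoot a3t2 = D.gRoot a3 * D.gRoot a32 := by
  simp [gRoot, Fin.prod_univ_three, coord, pow_two, mul_left_comm]

theorem gRoot_a3t1 : D.gRoot a3t1 = D.gRoot a3 * D.gRoot a31 := by
  simp [gRoot, Fin.prod_univ_three, coord, pow_two, mul_left_comm]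

theorem gRoot_a2t1 : D.gRoot a2t1 = D.gRoot a2 * D.gRoot a3t1 := by
  simp [gRoot, Fin.prod_univ_three, coord, pow_two, mul_comm, mul_left_comm, mul_assoc]

theorem gRoot_simple (i : Fin 3) : D.g i = D.gRoot (![a1, a2, a3] i) := by
  fin_cases i <;> simp [gRoot, Fin.prod_univ_three, coord]

theorem χRoot_apply (α : PosRoot) (h : Γ) :
    (D.χRoot α h : k) = ∏ i, (D.χ i h : k) ^ α.coord i := by
  simp [χRoot, MonoidHom.finsetProd_apply, Units.coe_prod]

end Root

namespace Lifting

variable {k Γ A : Type*} [Field k] [CommGroup Γ] {D : YDDatum k Γ (Fin 3)} [Ring A]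
  [HopfAlgebra k A] (L : D.Lifting A)

/-- The elements `y_i ⊗ 1`. -/
def tensorLeft (_L : D.Lifting A) (y : Fin 3 → A) (i : Fin 3) : A ⊗[k] A := y i ⊗ₜ 1

/-- The elements `g_i ⊗ y_i`. -/
def tensorRight (y : Fin 3 → A) (i : Fin 3) : A ⊗[k] A := L.grp (D.g i) ⊗ₜ y i

theorem rootVec_tensorLeft (y : Fin 3 → A) (α : PosRoot) :
    D.rootVec (L.tensorLeft y) α = D.rootVec y α ⊗ₜ 1 :=
  (map_rootVec (Algebra.TensorProduct.includeLeft : A →ₐ[k] A ⊗[k] A) y α).symm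

theorem brk_grp_tmul (α β : PosRoot) (g h : Γ) (u v : A) :
    D.brk α β (L.grp g ⊗ₜ[k] u) (L.grp h ⊗ₜ[k] v) = L.grp (g * h) ⊗ₜ D.brk α β u v := by
  rw [brk, brk, Algebra.TensorProduct.tmul_mul_tmul, Algebra.TensorProduct.tmul_mul_tmul,
    ← L.grp_mul, ← L.grp_mul, mul_comm h g, TensorProduct.tmul_sub, TensorProduct.tmul_smul]

theorem rootVec_tensorRight (y : Fin 3 → A) (α : PosRoot) :
    D.rootVec (L.tensorRight y) α = L.grp (D.gRoot α) ⊗ₜ D.rootVec y α := by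
  cases α <;> simp only [rootVec, tensorRight, brk_grp_tmul, gRoot_a2t1, gRoot_a3t1, gRoot_a3t2,
    gRoot_a31, gRoot_a32, gRoot_a21, gRoot_simple] <;> rfl

namespace IsLiftOfGenerators

variable {L} {y : Fin 3 → A}

theorem grp_mul_rootVec (hy : L.IsLiftOfGenerators y) (h : Γ) (α : PosRoot) :
    L.grp h * D.rootVec y α = (D.χRoot α h : k) • (D.rootVec y α * L.grp h) := by
  rw [χRoot_apply]
  exact skew_rootVec_right (fun i => hy.conj_eq h i) α

theorem comul_rootVec (hy : L.IsLiftOfGenerators y) (α : PosRoot) :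
    Coalgebra.comul (R := k) (D.rootVec y α) =
      D.rootVec (L.tensorLeft y + L.tensorRight y) α := by
  refine (map_rootVec (Bialgebra.comulAlgHom k A) y α).trans ?_
  congr 1
  ext1 i
  exact hy.comul_eq i

theorem cross (hy : L.IsLiftOfGenerators y) (i j : Fin 3) :
    Skew (D.q i j) (L.tensorRight y i) (L.tensorLeft y j) := by
  rw [Skew, tensorRight, tensorLeft, Algebra.TensorProduct.tmul_mul_tmul,
    Algebra.TensorProduct.tmul_mul_tmul, hy.conj_eq, one_mul, mul_one, TensorProduct.smul_tmul']
  rfl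

/-- A skew-primitive element of degree `g` and character `χ` vanishes if `χ(g)` is neither
one nor a diagonal entry of the braiding matrix. -/
theorem eq_zero_of_comul [Finite Γ] (hy : L.IsLiftOfGenerators y) {g : Γ} {χ : Γ →* kˣ} {x : A}
    (hx : Coalgebra.comul (R := k) x = x ⊗ₜ 1 + L.grp g ⊗ₜ x)
    (hχ : ∀ h, L.grp h * x = (χ h : k) • (x * L.grp h)) (h1 : (χ g : k) ≠ 1)
    (hne : ∀ i, (χ g : k) ≠ D.q i i) : x = 0 := by
  obtain ⟨d, hd, hd'⟩ := hy.eq_smul_grp_sub_one hx hχ fun i hi h => hne i (by rw [h, hi, q])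
  rw [hd, hd' (Or.inr fun h => h1 (by rw [h]; rfl)), zero_smul]

/-- A Serre element whose coproduct has no mixed terms vanishes.  The power `q_{33}^n` is the value
of its character on its degree. -/
theorem brk_eq_zero [Finite Γ] (hy : L.IsLiftOfGenerators y) (hB : D.IsCartanB3) {α β : PosRoot}
    (h : D.brk α β (D.rootVec (L.tensorLeft y + L.tensorRight y) α)
        (D.rootVec (L.tensorLeft y + L.tensorRight y) β) =
      D.brk α β (D.rootVec (L.tensorLeft y) α) (D.rootVec (L.tensorLeft y) β) +
      D.brk α β (D.rootVec (L.tensorRight y) α) (D.rootVec (L.tensorRight y) β)) {n : ℕ}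
    (hn : D.qRoot α α * D.qRoot α β * (D.qRoot β α * D.qRoot β β) = D.q 2 2 ^ n)
    (h0 : D.q 2 2 ^ n ≠ 1) (h1 : D.q 2 2 ^ n ≠ D.q 2 2) (h2 : D.q 2 2 ^ n ≠ D.q 2 2 ^ 2) :
    Skew (D.qRoot α β) (D.rootVec y α) (D.rootVec y β) := by
  have hval : ((D.χRoot α * D.χRoot β) (D.gRoot α * D.gRoot β) : k) = D.q 2 2 ^ n := by
    rw [← hn]
    simp only [qRoot, map_mul, MonoidHom.mul_apply, Units.val_mul]
  have key : D.brk α β (D.rootVec y α) (D.rootVec y β) = 0 := by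
    refine hy.eq_zero_of_comul (g := D.gRoot α * D.gRoot β) (χ := D.χRoot α * D.χRoot β)
      ?_ (fun g => ?_) (by rwa [hval]) fun i => ?_
    · rw [rootVec_tensorLeft, rootVec_tensorLeft, rootVec_tensorRight, rootVec_tensorRight,
        brk_grp_tmul, ← hy.comul_rootVec, ← hy.comul_rootVec] at h
      have e : D.brk α β (D.rootVec y α ⊗ₜ[k] (1 : A)) (D.rootVec y β ⊗ₜ[k] (1 : A)) =
          D.brk α β (D.rootVec y α) (D.rootVec y β) ⊗ₜ[k] (1 : A) := by
        rw [brk, brk, Algebra.TensorProduct.tmul_mul_tmul, Algebra.TensorProduct.tmul_mul_tmul,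
          mul_one, TensorProduct.sub_tmul, TensorProduct.smul_tmul']
      rw [← e, ← h]
      simp only [brk, map_sub, map_smul, Bialgebra.comul_mul]
    · have e := skew_brk_right (D := D) (α := α) (β := β) (hy.grp_mul_rootVec g α)
        (hy.grp_mul_rootVec g β)
      rw [Skew] at e
      rw [e]
      simp
    · rw [hval]
      fin_cases i
      · simpa [hB.q_eq.1] using h2
      · simpa [hB.q_eq.2.1] using h2
      · exact h1
  rw [brk] at key
  exact sub_eq_zero.1 key

theorem isSerre [Finite Γ] (hy : L.IsLiftOfGenerators y) (hB : D.IsCartanB3) (hodd : Odd D.N)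
    (hN : 5 < D.N) : D.IsSerre y := by
  have hq := D.q_ne_zero 2 2
  have h2 := pow_q_ne_one hN (n := 2) (by norm_num) (by norm_num)
  have h3 := pow_q_ne_one hN (n := 3) (by norm_num) (by norm_num)
  have h4 := pow_q_ne_one hN (n := 4) (by norm_num) (by norm_num)
  have h5 := pow_q_ne_one hN (n := 5) (by norm_num) (by norm_num)
  have h1 := pow_q_ne_one hN (n := 1) (by norm_num) (by norm_num)
  -- six is excluded as a value of `N` by parity
  have h6 : D.q 2 2 ^ 6 ≠ 1 := fun h => by
    have hd : D.N ∣ 6 := orderOf_dvd_of_pow_eq_one h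
    have := Nat.le_of_dvd (by norm_num) hd
    have : D.N = 6 := by omega
    rw [this] at hodd
    exact absurd hodd (by decide)
  have cancel : ∀ {m n : ℕ}, D.q 2 2 ^ n ≠ 1 → D.q 2 2 ^ (m + n) ≠ D.q 2 2 ^ m := by
    intro m n hn h
    rw [pow_add] at h
    exact hn (mul_left_cancel₀ (pow_ne_zero m hq) (h.trans (mul_one _).symm))
  have cancel1 : ∀ {n : ℕ}, D.q 2 2 ^ n ≠ 1 → D.q 2 2 ^ (1 + n) ≠ D.q 2 2 := by
    intro n hn
    simpa using cancel (m := 1) hn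
  constructor
  · exact hy.brk_eq_zero hB (brk_a3_a1_add hB hy.cross) (n := 3)
      (by simp [hB.qRoot_eq, coord]; field_simp) h3 (cancel1 h2) (cancel (m := 2) (n := 1) h1)
  · exact hy.brk_eq_zero hB (brk_a21_a1_add hB hy.cross) (n := 6)
      (by simp [hB.qRoot_eq, coord]; field_simp) h6 (cancel1 h5) (cancel (m := 2) (n := 4) h4)
  · exact hy.brk_eq_zero hB (brk_a2_a21_add hB hy.cross) (n := 6)
      (by simp [hB.qRoot_eq, coord]; field_simp) h6 (cancel1 h5) (cancel (m := 2) (n := 4) h4)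
  · exact hy.brk_eq_zero hB (brk_a32_a2_add hB hy.cross) (n := 5)
      (by simp [hB.qRoot_eq, coord]; field_simp) h5 (cancel1 h4) (cancel (m := 2) (n := 3) h3)
  · exact hy.brk_eq_zero hB (brk_a3_a3t2_add hB hy.cross) (n := 5)
      (by simp [hB.qRoot_eq, coord]; field_simp) h5 (cancel1 h4) (cancel (m := 2) (n := 3) h3)

theorem isSerrePair [Finite Γ] (hy : L.IsLiftOfGenerators y) (hB : D.IsCartanB3)
    (hodd : Odd D.N) (hN : 5 < D.N) : D.IsSerrePair (L.tensorLeft y) (L.tensorRight y) := by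
  have hS := hy.isSerre hB hodd hN
  have hl : ∀ {α β : PosRoot} {c : k}, Skew c (D.rootVec y α) (D.rootVec y β) →
      Skew c (D.rootVec (L.tensorLeft y) α) (D.rootVec (L.tensorLeft y) β) := by
    intro α β c h
    rw [rootVec_tensorLeft, rootVec_tensorLeft, Skew, Algebra.TensorProduct.tmul_mul_tmul,
      Algebra.TensorProduct.tmul_mul_tmul, h, TensorProduct.smul_tmul']
  have hr : ∀ {α β : PosRoot} {c : k}, Skew c (D.rootVec y α) (D.rootVec y β) →
      Skew c (D.rootVec (L.tensorRight y) α) (D.rootVec (L.tensorRight y) β) := by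
    intro α β c h
    rw [rootVec_tensorRight, rootVec_tensorRight, Skew, Algebra.TensorProduct.tmul_mul_tmul,
      Algebra.TensorProduct.tmul_mul_tmul, h, (L.grp_commute _ _).eq, TensorProduct.tmul_smul]
  exact ⟨⟨hl hS.1, hl hS.2, hl hS.3, hl hS.4, hl hS.5⟩, ⟨hr hS.1, hr hS.2, hr hS.3, hr hS.4,
    hr hS.5⟩, hy.cross⟩

end IsLiftOfGenerators

end Lifting
end YDDatum

/-! ### Coproducts of the `N`-th powers of root vectors

The hypotheses that certain `N`-th powers commute with `Γ` allow the group-like factors to be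
pulled out of the `N`-th powers in the left tensor factor; otherwise a power of the character would
appear.
-/

namespace YDDatum

open PosRoot

namespace Lifting

variable {k Γ A : Type*} [Field k] [CommGroup Γ] {D : YDDatum k Γ (Fin 3)} [Ring A]
  [HopfAlgebra k A] {L : D.Lifting A}

/-- `Γ` acts on `x` by conjugation through the character `χ`. -/
def HasChar (L : D.Lifting A) (χ : Γ →* kˣ) (x : A) : Prop :=
  ∀ h, L.grp h * x = (χ h : k) • (x * L.grp h)

namespace HasChar

theorem mul {χ ψ : Γ →* kˣ} {x z : A} (hx : L.HasChar χ x) (hz : L.HasChar ψ z) :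
    L.HasChar (χ * ψ) (x * z) := fun h => by
  rw [MonoidHom.mul_apply, Units.val_mul]
  exact Skew.mul_right (hx h) (hz h)

theorem one : L.HasChar 1 1 := fun h => by simp

theorem grp (g : Γ) : L.HasChar 1 (L.grp g) := fun h => by
  rw [(L.grp_commute h g).eq]
  simp

theorem pow {χ : Γ →* kˣ} {x : A} (hx : L.HasChar χ x) (n : ℕ) : L.HasChar (χ ^ n) (x ^ n) := by
  intro h
  rw [MonoidHom.pow_apply, Units.val_pow_eq_pow_val]
  induction n with
  | zero => simp
  | succ n ih =>
    rw [pow_succ, pow_succ]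
    exact Skew.mul_right ih (hx h)

theorem mul_one_char {x z : A} (hx : L.HasChar 1 x) (hz : L.HasChar 1 z) :
    L.HasChar 1 (x * z) := fun h => by simpa using (hx.mul hz) h

theorem add {χ : Γ →* kˣ} {x z : A} (hx : L.HasChar χ x) (hz : L.HasChar χ z) :
    L.HasChar χ (x + z) := fun h => Skew.add_right (hx h) (hz h)

theorem sub {χ : Γ →* kˣ} {x z : A} (hx : L.HasChar χ x) (hz : L.HasChar χ z) :
    L.HasChar χ (x - z) := fun h => Skew.sub_right (hx h) (hz h)

theorem smul {χ : Γ →* kˣ} {x : A} (hx : L.HasChar χ x) (c : k) : L.HasChar χ (c • x) :=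
  fun h => Skew.smul_right (hx h) c

theorem smul_of_ne {χ ψ : Γ →* kˣ} {x : A} (hx : L.HasChar χ x) {c : k} (hc : c ≠ 0 → χ = ψ) :
    L.HasChar ψ (c • x) := by
  by_cases h : c = 0
  · intro g
    simp [h]
  · exact hc h ▸ hx.smul c

theorem eq_one {χ : Γ →* kˣ} {x : A} (hx : L.HasChar χ x) (h1 : L.HasChar 1 x) (h0 : x ≠ 0) :
    χ = 1 := by
  by_contra hχ
  obtain ⟨h, hh⟩ := DFunLike.ne_iff.1 hχ
  have e2 : ((χ h : k) - 1) • (x * L.grp h) = 0 := by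
    rw [sub_smul, ← hx h, h1 h]
    simp
  have e3 := (smul_eq_zero.1 e2).resolve_left
    fun h0 => hh (Units.ext (by simpa using sub_eq_zero.1 h0))
  exact h0 (by rw [← mul_one x, ← L.grp_mul_inv h, ← mul_assoc, e3, zero_mul])

/-- If the `N`-th power of a weight vector `x` commutes with `Γ` then `(x g)^N = x^N g^N`: either
`x^N = 0` or the `N`-th power of its character is trivial. -/
theorem mul_grp_pow {χ : Γ →* kˣ} {x : A} (hx : L.HasChar χ x) {N : ℕ} (hodd : Odd N)
    (h1 : L.HasChar 1 (x ^ N)) (g : Γ) : (x * L.grp g) ^ N = x ^ N * L.grp (g ^ N) := by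
  rw [Skew.mul_pow (hx g), L.grp_pow]
  by_cases h0 : x ^ N = 0
  · simp [h0]
  · have e := (hx.pow N).eq_one h1 h0
    have e' : (χ g : k) ^ N = 1 := by
      have := DFunLike.congr_fun e g
      simpa [Units.ext_iff] using this
    rw [pow_choose_two_eq_one hodd e', one_smul]

end HasChar

namespace IsLiftOfGenerators

variable {y : Fin 3 → A}

theorem hasChar_rootVec (hy : L.IsLiftOfGenerators y) (α : PosRoot) :
    L.HasChar (D.χRoot α) (D.rootVec y α) := fun h => hy.grp_mul_rootVec h α

theorem qRoot_self_pow (hB : D.IsCartanB3) (α : PosRoot) : D.qRoot α α ^ D.N = 1 := by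
  have hq : D.q 2 2 ^ D.N = 1 := isPrimitiveRoot_q.pow_eq_one
  have : ∃ m : ℕ, D.qRoot α α = D.q 2 2 ^ m := by
    cases α
    exacts [⟨2, by simp [hB.qRoot_eq, coord]⟩, ⟨2, by simp [hB.qRoot_eq, coord]⟩,
      ⟨1, by simp [hB.qRoot_eq, coord]⟩, ⟨2, by simp [hB.qRoot_eq, coord]; field_simp⟩,
      ⟨1, by simp [hB.qRoot_eq, coord]; field_simp⟩,
      ⟨1, by simp [hB.qRoot_eq, coord]; field_simp⟩,
      ⟨2, by simp [hB.qRoot_eq, coord]; field_simp⟩,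
      ⟨2, by simp [hB.qRoot_eq, coord]; field_simp⟩,
      ⟨2, by simp [hB.qRoot_eq, coord]; field_simp⟩]
  obtain ⟨m, hm⟩ := this
  rw [hm, pow_right_comm, hq, one_pow]

/-- A skew-primitive element with the degree and the character of the `N`-th power of a root
vector is a multiple of `g_α^N - 1`. -/
theorem eq_smul_of_comul [Finite Γ] (hy : L.IsLiftOfGenerators y) (hB : D.IsCartanB3)
    (hN : 5 < D.N) {α : PosRoot} {x : A}
    (hx : Coalgebra.comul (R := k) x = x ⊗ₜ 1 + L.grp (D.gRoot α ^ D.N) ⊗ₜ x)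
    (hχ : L.HasChar (D.χRoot α ^ D.N) x) : ∃ d : k, x = d • (L.grp (D.gRoot α ^ D.N) - 1) ∧
      (D.gRoot α ^ D.N = 1 ∨ D.χRoot α ^ D.N ≠ 1 → d = 0) := by
  -- the character takes the value one at the degree, unlike that of a generator
  refine hy.eq_smul_grp_sub_one hx hχ fun i hi h => ?_
  have h1 : D.q i i = 1 := by
    rw [q, ← h, ← hi, MonoidHom.pow_apply, map_pow, Units.val_pow_eq_pow_val,
      Units.val_pow_eq_pow_val]
    rw [← qRoot, qRoot_self_pow hB, one_pow]
  have hq2 := pow_q_ne_one hN (n := 2) (by norm_num) (by norm_num)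
  have hq1 := pow_q_ne_one hN (n := 1) (by norm_num) (by norm_num)
  fin_cases i
  · exact hq2 (by rw [← hB.q_eq.1]; exact h1)
  · exact hq2 (by rw [← hB.q_eq.2.1]; exact h1)
  · exact hq1 (by rw [pow_one]; exact h1)


theorem comul_pow_a1 [Finite Γ] (hy : L.IsLiftOfGenerators y) (hB : D.IsCartanB3)
    (hodd : Odd D.N) : Coalgebra.comul (R := k) (D.rootVec y a1 ^ D.N) =
    (D.rootVec y a1 ^ D.N) ⊗ₜ 1 + L.grp (D.gRoot a1 ^ D.N) ⊗ₜ (D.rootVec y a1 ^ D.N) := by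
  have e := hy.comul_rootVec a1
  rw [Bialgebra.comul_pow, e]
  change (D.rootVec (L.tensorLeft y) a1 + D.rootVec (L.tensorRight y) a1) ^ D.N = _
  rw [add_pow_of_skew (isPrimitiveRoot_q_sq hodd) hodd.pos, rootVec_tensorLeft,
    rootVec_tensorRight, Algebra.TensorProduct.tmul_pow, Algebra.TensorProduct.tmul_pow, one_pow,
    L.grp_pow]
  exact (hy.cross 0 0).congr hB.q_eq.1

theorem comul_pow_a2 [Finite Γ] (hy : L.IsLiftOfGenerators y) (hB : D.IsCartanB3)
    (hodd : Odd D.N) : Coalgebra.comul (R := k) (D.rootVec y a2 ^ D.N) =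
    (D.rootVec y a2 ^ D.N) ⊗ₜ 1 + L.grp (D.gRoot a2 ^ D.N) ⊗ₜ (D.rootVec y a2 ^ D.N) := by
  have e := hy.comul_rootVec a2
  rw [Bialgebra.comul_pow, e]
  change (D.rootVec (L.tensorLeft y) a2 + D.rootVec (L.tensorRight y) a2) ^ D.N = _
  rw [add_pow_of_skew (isPrimitiveRoot_q_sq hodd) hodd.pos, rootVec_tensorLeft,
    rootVec_tensorRight, Algebra.TensorProduct.tmul_pow, Algebra.TensorProduct.tmul_pow, one_pow,
    L.grp_pow]
  exact (hy.cross 1 1).congr hB.q_eq.2.1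

theorem comul_pow_a3 [Finite Γ] (hy : L.IsLiftOfGenerators y) (hodd : Odd D.N) :
    Coalgebra.comul (R := k) (D.rootVec y a3 ^ D.N) =
    (D.rootVec y a3 ^ D.N) ⊗ₜ 1 + L.grp (D.gRoot a3 ^ D.N) ⊗ₜ (D.rootVec y a3 ^ D.N) := by
  have e := hy.comul_rootVec a3
  rw [Bialgebra.comul_pow, e]
  change (D.rootVec (L.tensorLeft y) a3 + D.rootVec (L.tensorRight y) a3) ^ D.N = _
  rw [add_pow_of_skew D.isPrimitiveRoot_q hodd.pos, rootVec_tensorLeft,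
    rootVec_tensorRight, Algebra.TensorProduct.tmul_pow, Algebra.TensorProduct.tmul_pow, one_pow,
    L.grp_pow]
  exact hy.cross 2 2

/-- The `N`-th power of the product of `x ⊗ 1` and `g_β ⊗ y_β`. -/
theorem tmul_mul_rootVec_pow (hodd : Odd D.N) {χ : Γ →* kˣ} {x : A} (hx : L.HasChar χ x)
    (h1 : L.HasChar 1 (x ^ D.N)) (β : PosRoot) :
    (x ⊗ₜ[k] (1 : A) * D.rootVec (L.tensorRight y) β) ^ D.N =
      (x ^ D.N * L.grp (D.gRoot β ^ D.N)) ⊗ₜ (D.rootVec y β ^ D.N) := by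
  rw [rootVec_tensorRight, Algebra.TensorProduct.tmul_mul_tmul, Algebra.TensorProduct.tmul_pow,
    hx.mul_grp_pow hodd h1, one_mul]

theorem comul_pow_a21 [Finite Γ] (hy : L.IsLiftOfGenerators y) (hB : D.IsCartanB3)
    (hodd : Odd D.N) (hN : 5 < D.N) (h2 : L.HasChar 1 (D.rootVec y a2 ^ D.N)) :
    Coalgebra.comul (R := k) (D.rootVec y a21 ^ D.N) = (D.rootVec y a21 ^ D.N) ⊗ₜ 1 +
      (D.ξ 2 ^ D.N • ((D.rootVec y a2 ^ D.N * L.grp (D.gRoot a1 ^ D.N)) ⊗ₜ (D.rootVec y a1 ^ D.N)) +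
      L.grp (D.gRoot a21 ^ D.N) ⊗ₜ (D.rootVec y a21 ^ D.N)) := by
  rw [Bialgebra.comul_pow, hy.comul_rootVec, (hy.isSerrePair hB hodd hN).rootVec_a21_pow hB hodd hN,
    smul_pow, rootVec_tensorLeft, rootVec_tensorLeft,
    tmul_mul_rootVec_pow hodd (hy.hasChar_rootVec a2) h2, rootVec_tensorRight,
    Algebra.TensorProduct.tmul_pow, Algebra.TensorProduct.tmul_pow, one_pow, L.grp_pow
      (D.gRoot a21)]

theorem comul_pow_a32 [Finite Γ] (hy : L.IsLiftOfGenerators y) (hB : D.IsCartanB3)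
    (hodd : Odd D.N) (hN : 5 < D.N) (h3 : L.HasChar 1 (D.rootVec y a3 ^ D.N)) :
    Coalgebra.comul (R := k) (D.rootVec y a32 ^ D.N) = (D.rootVec y a32 ^ D.N) ⊗ₜ 1 +
      D.ξ 2 ^ D.N • ((D.rootVec y a3 ^ D.N * L.grp (D.gRoot a2 ^ D.N)) ⊗ₜ (D.rootVec y a2 ^ D.N)) +
      L.grp (D.gRoot a32 ^ D.N) ⊗ₜ (D.rootVec y a32 ^ D.N) := by
  rw [Bialgebra.comul_pow, hy.comul_rootVec, (hy.isSerrePair hB hodd hN).rootVec_a32_pow hB hodd hN,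
    smul_pow, rootVec_tensorLeft, rootVec_tensorLeft,
    tmul_mul_rootVec_pow hodd (hy.hasChar_rootVec a3) h3, rootVec_tensorRight,
    Algebra.TensorProduct.tmul_pow, Algebra.TensorProduct.tmul_pow, one_pow, L.grp_pow
      (D.gRoot a32)]

theorem comul_pow_a31 [Finite Γ] (hy : L.IsLiftOfGenerators y) (hB : D.IsCartanB3)
    (hodd : Odd D.N) (hN : 5 < D.N) (h3 : L.HasChar 1 (D.rootVec y a3 ^ D.N))
    (h32 : L.HasChar 1 (D.rootVec y a32 ^ D.N)) :
    Coalgebra.comul (R := k) (D.rootVec y a31 ^ D.N) = (D.rootVec y a31 ^ D.N) ⊗ₜ 1 +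
      (D.ξ 2 ^ D.N • ((D.rootVec y a32 ^ D.N * L.grp (D.gRoot a1 ^ D.N)) ⊗ₜ (D.rootVec y a1 ^ D.N))
        +
      D.ξ 2 ^ D.N • ((D.rootVec y a3 ^ D.N * L.grp (D.gRoot a21 ^ D.N)) ⊗ₜ
        (D.rootVec y a21 ^ D.N))) +
      L.grp (D.gRoot a31 ^ D.N) ⊗ₜ (D.rootVec y a31 ^ D.N) := by
  rw [Bialgebra.comul_pow, hy.comul_rootVec, (hy.isSerrePair hB hodd hN).rootVec_a31_pow hB hodd hN,
    smul_pow, smul_pow, rootVec_tensorLeft, rootVec_tensorLeft, rootVec_tensorLeft,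
    tmul_mul_rootVec_pow hodd (hy.hasChar_rootVec a3) h3,
    tmul_mul_rootVec_pow hodd (hy.hasChar_rootVec a32) h32, rootVec_tensorRight,
    Algebra.TensorProduct.tmul_pow, Algebra.TensorProduct.tmul_pow, one_pow, L.grp_pow
      (D.gRoot a31)]

theorem hasChar_sq_pow {x : A} {N : ℕ} (h : L.HasChar 1 (x ^ N)) : L.HasChar 1 ((x * x) ^ N) := by
  rw [(Commute.refl x).mul_pow]
  exact h.mul_one_char h

theorem comul_pow_a3t2 [Finite Γ] (hy : L.IsLiftOfGenerators y) (hB : D.IsCartanB3)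
    (hodd : Odd D.N) (hN : 5 < D.N) (h3 : L.HasChar 1 (D.rootVec y a3 ^ D.N)) :
    Coalgebra.comul (R := k) (D.rootVec y a3t2 ^ D.N) = (D.rootVec y a3t2 ^ D.N) ⊗ₜ 1 +
      ((D.ξ 1 ^ D.N * D.ξ 2 ^ D.N) • ((D.rootVec y a3 ^ D.N * D.rootVec y a3 ^ D.N *
        L.grp (D.gRoot a2 ^ D.N)) ⊗ₜ (D.rootVec y a2 ^ D.N)) +
      (2 * D.ξ 1 ^ D.N) • ((D.rootVec y a3 ^ D.N * L.grp (D.gRoot a32 ^ D.N)) ⊗ₜ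
        (D.rootVec y a32 ^ D.N)) +
      L.grp (D.gRoot a3t2 ^ D.N) ⊗ₜ (D.rootVec y a3t2 ^ D.N)) := by
  have hc := hy.hasChar_rootVec a3
  rw [Bialgebra.comul_pow, hy.comul_rootVec,
    (hy.isSerrePair hB hodd hN).rootVec_a3t2_pow hB hodd hN, smul_pow, rootVec_tensorLeft,
    rootVec_tensorLeft, tmul_mul_rootVec_pow hodd hc h3, Algebra.TensorProduct.tmul_mul_tmul,
    mul_one, tmul_mul_rootVec_pow hodd (hc.mul hc) (hasChar_sq_pow h3), rootVec_tensorRight,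
    Algebra.TensorProduct.tmul_pow, Algebra.TensorProduct.tmul_pow, one_pow,
    L.grp_pow (D.gRoot a3t2), (Commute.refl _).mul_pow, mul_pow]

theorem comul_pow_a3t1 [Finite Γ] (hy : L.IsLiftOfGenerators y) (hB : D.IsCartanB3)
    (hodd : Odd D.N) (hN : 5 < D.N) (h3 : L.HasChar 1 (D.rootVec y a3 ^ D.N))
    (h3t2 : L.HasChar 1 (D.rootVec y a3t2 ^ D.N)) :
    Coalgebra.comul (R := k) (D.rootVec y a3t1 ^ D.N) = (D.rootVec y a3t1 ^ D.N) ⊗ₜ 1 +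
      (D.ξ 2 ^ D.N • ((D.rootVec y a3t2 ^ D.N * L.grp (D.gRoot a1 ^ D.N)) ⊗ₜ
        (D.rootVec y a1 ^ D.N)) +
      ((D.ξ 1 ^ D.N * D.ξ 2 ^ D.N) • ((D.rootVec y a3 ^ D.N * D.rootVec y a3 ^ D.N *
        L.grp (D.gRoot a21 ^ D.N)) ⊗ₜ (D.rootVec y a21 ^ D.N)) +
      (2 * D.ξ 1 ^ D.N) • ((D.rootVec y a3 ^ D.N * L.grp (D.gRoot a31 ^ D.N)) ⊗ₜ
        (D.rootVec y a31 ^ D.N)) +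
      L.grp (D.gRoot a3t1 ^ D.N) ⊗ₜ (D.rootVec y a3t1 ^ D.N))) := by
  have hc := hy.hasChar_rootVec a3
  rw [Bialgebra.comul_pow, hy.comul_rootVec,
    (hy.isSerrePair hB hodd hN).rootVec_a3t1_pow hB hodd hN, smul_pow, smul_pow,
    rootVec_tensorLeft, rootVec_tensorLeft, rootVec_tensorLeft,
    tmul_mul_rootVec_pow hodd (hy.hasChar_rootVec a3t2) h3t2, tmul_mul_rootVec_pow hodd hc h3,
    Algebra.TensorProduct.tmul_mul_tmul,
    mul_one, tmul_mul_rootVec_pow hodd (hc.mul hc) (hasChar_sq_pow h3), rootVec_tensorRight,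
    Algebra.TensorProduct.tmul_pow, Algebra.TensorProduct.tmul_pow, one_pow,
    L.grp_pow (D.gRoot a3t1), (Commute.refl _).mul_pow, mul_pow]

theorem hasChar_revVec32 (hy : L.IsLiftOfGenerators y) :
    L.HasChar (D.χRoot a2 * D.χRoot a3) (D.revVec32 y) := fun h => by
  rw [MonoidHom.mul_apply, Units.val_mul]
  exact skew_brk_right (hy.hasChar_rootVec a2 h) (hy.hasChar_rootVec a3 h)

theorem hasChar_revVec3t2 (hy : L.IsLiftOfGenerators y) :
    L.HasChar (D.χRoot a2 * D.χRoot a3 * D.χRoot a3) (D.revVec3t2 y) := fun h => by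
  rw [MonoidHom.mul_apply, Units.val_mul]
  exact skew_brk_right (hy.hasChar_revVec32 h) (hy.hasChar_rootVec a3 h)

theorem χRoot_a32 : D.χRoot a32 = D.χRoot a2 * D.χRoot a3 := by
  ext h
  simp [χRoot, Fin.prod_univ_three, coord]

theorem χRoot_a3t2 : D.χRoot a3t2 = D.χRoot a2 * D.χRoot a3 * D.χRoot a3 := by
  ext h
  simp [χRoot, Fin.prod_univ_three, coord, pow_two, mul_assoc]

theorem hasChar_cornerVec (hy : L.IsLiftOfGenerators y) :
    L.HasChar (D.χRoot a2 * D.χRoot a3t2) (D.cornerVec y) := by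
  have h1 := (hy.hasChar_rootVec a2).mul (hy.hasChar_rootVec a3t2)
  have h2 := (hy.hasChar_rootVec a32).mul (hy.hasChar_rootVec a32)
  have e : D.χRoot a32 * D.χRoot a32 = D.χRoot a2 * D.χRoot a3t2 := by
    ext h
    simp [χRoot_a32, χRoot_a3t2]
    ring
  rw [e] at h2
  exact ((h1.smul _).sub (h2.smul _)).smul _

theorem comul_pow_a2t1 [Finite Γ] (hy : L.IsLiftOfGenerators y) (hB : D.IsCartanB3)
    (hodd : Odd D.N) (hN : 5 < D.N) (h2 : L.HasChar 1 (D.rootVec y a2 ^ D.N))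
    (h32 : L.HasChar 1 (D.revVec32 y ^ D.N)) (h3t2 : L.HasChar 1 (D.revVec3t2 y ^ D.N))
    (hc : L.HasChar 1 (D.cornerVec y ^ D.N)) :
    Coalgebra.comul (R := k) (D.rootVec y a2t1 ^ D.N) = (D.rootVec y a2t1 ^ D.N) ⊗ₜ 1 +
      ((D.cornerVec y ^ D.N * L.grp (D.gRoot a1 ^ D.N)) ⊗ₜ (D.rootVec y a1 ^ D.N) +
      (D.ξ 2 ^ D.N • ((D.revVec3t2 y ^ D.N * L.grp (D.gRoot a21 ^ D.N)) ⊗ₜ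
        (D.rootVec y a21 ^ D.N)) +
      ((2 * D.ξ 1 ^ D.N) • ((D.revVec32 y ^ D.N * L.grp (D.gRoot a31 ^ D.N)) ⊗ₜ
        (D.rootVec y a31 ^ D.N)) +
      D.ξ 2 ^ D.N • ((D.rootVec y a2 ^ D.N * L.grp (D.gRoot a3t1 ^ D.N)) ⊗ₜ
        (D.rootVec y a3t1 ^ D.N))) +
      L.grp (D.gRoot a2t1 ^ D.N) ⊗ₜ (D.rootVec y a2t1 ^ D.N))) := by
  have e1 : D.revVec32 (L.tensorLeft y) = D.revVec32 y ⊗ₜ[k] (1 : A) := by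
    simp [revVec32, brk, tensorLeft, TensorProduct.sub_tmul, TensorProduct.smul_tmul']
  have e2 : D.revVec3t2 (L.tensorLeft y) = D.revVec3t2 y ⊗ₜ[k] (1 : A) := by
    rw [revVec3t2, e1]
    simp [revVec3t2, brk, tensorLeft, TensorProduct.sub_tmul, TensorProduct.smul_tmul']
  have e3 : D.cornerVec (L.tensorLeft y) = D.cornerVec y ⊗ₜ[k] (1 : A) := by
    simp only [cornerVec, rootVec_tensorLeft, Algebra.TensorProduct.tmul_mul_tmul, mul_one,
      TensorProduct.smul_tmul', ← TensorProduct.sub_tmul]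
  rw [Bialgebra.comul_pow, hy.comul_rootVec,
    (hy.isSerrePair hB hodd hN).rootVec_a2t1_pow hB hodd hN, smul_pow, smul_pow, e1, e2, e3,
    rootVec_tensorLeft, rootVec_tensorLeft, tmul_mul_rootVec_pow hodd hy.hasChar_cornerVec hc,
    tmul_mul_rootVec_pow hodd hy.hasChar_revVec32 h32,
    tmul_mul_rootVec_pow hodd hy.hasChar_revVec3t2 h3t2,
    tmul_mul_rootVec_pow hodd (hy.hasChar_rootVec a2) h2, rootVec_tensorRight,
    Algebra.TensorProduct.tmul_pow, Algebra.TensorProduct.tmul_pow, one_pow,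
    L.grp_pow (D.gRoot a2t1)]

end IsLiftOfGenerators
end Lifting
end YDDatum

/-! ### The antipode and the opposite root vectors -/

namespace YDDatum

open PosRoot

namespace Lifting

variable {k Γ A : Type*} [Field k] [CommGroup Γ] {D : YDDatum k Γ (Fin 3)} [Ring A]
  [HopfAlgebra k A] {L : D.Lifting A}

theorem antipode_pow (x : A) (n : ℕ) :
    HopfAlgebra.antipode k (x ^ n) = HopfAlgebra.antipode k x ^ n := by
  induction n with
  | zero => simp
  | succ n ih => rw [pow_succ, HopfAlgebra.antipode_mul_antidistrib, ih, pow_succ']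

/-- The `N`-th power of `x` is determined by that of an element `z` whose antipode is
`x g⁻¹` up to a scalar. -/
theorem HasChar.pow_eq_antipode {χ : Γ →* kˣ} {x z : A} (hx : L.HasChar χ x) {N : ℕ}
    (hodd : Odd N) {g : Γ} {c σ : k} (h : HopfAlgebra.antipode k z = c • (x * L.grp g⁻¹))
    (hg : (χ g : k) ^ N = 1) (hc : c ≠ 0) (hσ : z ^ N ≠ 0 → c ^ N = σ) :
    x ^ N = σ⁻¹ • (HopfAlgebra.antipode k (z ^ N) * L.grp (g ^ N)) := by
  have hg' : (χ g⁻¹ : k) ^ N = 1 := by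
    rw [map_inv, Units.val_inv_eq_inv_val, inv_pow, hg, inv_one]
  have e : HopfAlgebra.antipode k (z ^ N) * L.grp (g ^ N) = c ^ N • x ^ N := by
    -- `(x g⁻¹)^N = x^N g^{-N}` because `χ(g)^N = 1` and `N` is odd
    rw [antipode_pow, h, smul_pow, Skew.mul_pow (hx g⁻¹), pow_choose_two_eq_one hodd hg', one_smul,
      L.grp_pow, smul_mul_assoc, mul_assoc,
      ← ((L.grp_commute g g⁻¹).symm.mul_pow N), L.grp_inv_mul, one_pow, mul_one]
  by_cases hz : z ^ N = 0
  · rw [hz, map_zero, zero_mul] at e ⊢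
    rw [smul_zero]
    exact (smul_eq_zero.1 e.symm).resolve_left (pow_ne_zero N hc)
  · rw [e, ← hσ hz, smul_smul, inv_mul_cancel₀ (pow_ne_zero N hc), one_smul]

namespace IsLiftOfGenerators

variable {y : Fin 3 → A}

theorem antipode_eq (hy : L.IsLiftOfGenerators y) (i : Fin 3) :
    HopfAlgebra.antipode k (y i) = -(L.grp (D.g i)⁻¹ * y i) := by
  have h := HopfAlgebra.mul_antipode_rTensor_comul_apply (R := k) (y i)
  have hε : Coalgebra.counit (R := k) (y i) = 0 := by
    have h := Coalgebra.rTensor_counit_comul (R := k) (y i)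
    rw [hy.comul_eq, map_add, LinearMap.rTensor_tmul, LinearMap.rTensor_tmul,
      (L.isGroupLikeElem_grp _).counit_eq_one] at h
    have h' := congrArg (TensorProduct.lid k A) h
    rw [map_add, TensorProduct.lid_tmul, TensorProduct.lid_tmul, one_smul, add_eq_right] at h'
    have h1 : (1 : A) ≠ 0 := by rw [← L.grp_one]; exact L.grp_ne_zero 1
    exact (smul_eq_zero.1 h').resolve_right h1
  rw [hy.comul_eq, map_add, LinearMap.rTensor_tmul, LinearMap.rTensor_tmul, map_add,
    LinearMap.mul'_apply, LinearMap.mul'_apply, mul_one, L.antipode_grp, hε, map_zero] at h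
  exact eq_neg_of_add_eq_zero_left h

theorem mul_grp_inv (hy : L.IsLiftOfGenerators y) (i : Fin 3) (h : Γ) :
    L.grp h⁻¹ * y i = (D.χ i h : k)⁻¹ • (y i * L.grp h⁻¹) := by
  rw [hy.conj_eq, map_inv, Units.val_inv_eq_inv_val]

/-- The antipode of the root vector of `α₂ + α₃` is a multiple of the opposite root vector, up to
the group-like factor. -/
theorem antipode_a32 (hy : L.IsLiftOfGenerators y) (hB : D.IsCartanB3) :
    HopfAlgebra.antipode k (D.rootVec y a32) =
      (D.q 2 2 ^ 3 * D.q 1 2)⁻¹ • (D.revVec32 y * L.grp (D.gRoot a32)⁻¹) := by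
  have e : L.grp (D.gRoot a32)⁻¹ = L.grp (D.g 2)⁻¹ * L.grp (D.g 1)⁻¹ := by
    rw [← L.grp_mul, gRoot_a32, mul_inv]
    simp [gRoot, Fin.prod_univ_three, coord]
  have hc := (L.grp_commute (D.g 1)⁻¹ (D.g 2)⁻¹).eq
  have m : ∀ i j (z : A), L.grp (D.g i)⁻¹ * (y j * z) = (D.q i j)⁻¹ •
    (y j * (L.grp (D.g i)⁻¹ * z)) :=
    fun i j z => Skew.assoc (hy.mul_grp_inv j (D.g i)) z
  have m' : ∀ i j, L.grp (D.g i)⁻¹ * y j = (D.q i j)⁻¹ • (y j * L.grp (D.g i)⁻¹) :=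
    fun i j => hy.mul_grp_inv j (D.g i)
  obtain ⟨-, q1, -, -, q21⟩ := hB.q_eq
  simp only [rootVec, revVec32, brk, map_sub, map_smul, HopfAlgebra.antipode_mul_antidistrib,
    hy.antipode_eq, e, sub_mul, smul_mul_assoc, neg_mul_neg, mul_assoc, m, m', mul_smul_comm, hc]
  match_scalars <;> simp [hB.qRoot_eq, coord, q1, q21] <;> field_simp

theorem antipode_a3t2 (hy : L.IsLiftOfGenerators y) (hB : D.IsCartanB3) :
    HopfAlgebra.antipode k (D.rootVec y a3t2) =
      (-(D.q 2 2 ^ 5 * D.q 1 2 ^ 2))⁻¹ • (D.revVec3t2 y * L.grp (D.gRoot a3t2)⁻¹) := by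
  have e : L.grp (D.gRoot a3t2)⁻¹ = L.grp (D.g 2)⁻¹ * L.grp (D.gRoot a32)⁻¹ := by
    rw [← L.grp_mul, gRoot_a3t2, mul_inv]
    simp [gRoot, Fin.prod_univ_three, coord]
  have hc := (L.grp_commute (D.gRoot a32)⁻¹ (D.g 2)⁻¹).eq
  have m1 : ∀ z : A, L.grp (D.gRoot a32)⁻¹ * (y 2 * z) =
      (D.qRoot a32 a3)⁻¹ • (y 2 * (L.grp (D.gRoot a32)⁻¹ * z)) := fun z => by
    rw [hy.mul_grp_inv 2 (D.gRoot a32) |> fun h => Skew.assoc h z]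
    congr 2
    simp [qRoot, χRoot_apply, Fin.prod_univ_three, coord]
  have m2 : ∀ z : A, L.grp (D.g 2)⁻¹ * (D.revVec32 y * z) =
      (D.qRoot a3 a2 * D.qRoot a3 a3)⁻¹ • (D.revVec32 y * (L.grp (D.g 2)⁻¹ * z)) := fun z => by
    rw [Skew.assoc (hy.hasChar_revVec32 (D.g 2)⁻¹) z]
    congr 1
    simp [qRoot, χRoot_apply, Fin.prod_univ_three, coord, gRoot, mul_comm]
  have m3 : L.grp (D.g 2)⁻¹ * y 2 = (D.q 2 2)⁻¹ • (y 2 * L.grp (D.g 2)⁻¹) :=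
    hy.mul_grp_inv 2 (D.g 2)
  have h32 : D.rootVec y a3t2 = D.brk a3 a32 (y 2) (D.rootVec y a32) := rfl
  rw [h32]
  simp only [revVec3t2, brk, map_sub, map_smul, HopfAlgebra.antipode_mul_antidistrib,
    hy.antipode_a32 hB, hy.antipode_eq, e, sub_mul, smul_mul_assoc, neg_mul, mul_neg, mul_assoc,
    m1, m2, m3, mul_smul_comm, hc, smul_neg]
  match_scalars <;> simp [hB.qRoot_eq, coord] <;> field_simp

theorem pow_χ_apply {α : PosRoot} {N : ℕ} (h : D.χRoot α ^ N = 1) (g : Γ) :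
    ∏ i, ((D.χ i g : k) ^ N) ^ α.coord i = 1 := by
  have e : ((D.χRoot α ^ N) g : k) = 1 := by rw [h]; simp
  rw [MonoidHom.pow_apply, Units.val_pow_eq_pow_val, χRoot_apply, ← Finset.prod_pow] at e
  rw [← e]
  exact Finset.prod_congr rfl fun i _ => pow_right_comm _ _ _

/-- A nonzero `N`-th power has trivial character, which restricts the braiding matrix. -/
theorem q_pow_eq_one_of_a32 (hy : L.IsLiftOfGenerators y) (hB : D.IsCartanB3)
    (h1 : L.HasChar 1 (D.rootVec y a32 ^ D.N)) (h0 : D.rootVec y a32 ^ D.N ≠ 0) :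
    D.q 1 2 ^ D.N = 1 := by
  have hq : D.q 2 2 ^ D.N = 1 := isPrimitiveRoot_q.pow_eq_one
  have e := pow_χ_apply (((hy.hasChar_rootVec a32).pow D.N).eq_one h1 h0) (D.g 1)
  simp only [Fin.prod_univ_three, coord] at e
  change (D.q 1 0 ^ D.N) ^ 0 * (D.q 1 1 ^ D.N) ^ 1 * (D.q 1 2 ^ D.N) ^ 1 = 1 at e
  rwa [hB.q_eq.2.1, pow_right_comm (D.q 2 2), hq, one_pow, one_pow, pow_zero, one_mul, one_mul,
    pow_one] at e

theorem q_pow_sq_eq_one_of_a3t2 (hy : L.IsLiftOfGenerators y) (hB : D.IsCartanB3)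
    (h1 : L.HasChar 1 (D.rootVec y a3t2 ^ D.N)) (h0 : D.rootVec y a3t2 ^ D.N ≠ 0) :
    (D.q 1 2 ^ D.N) ^ 2 = 1 := by
  have hq : D.q 2 2 ^ D.N = 1 := isPrimitiveRoot_q.pow_eq_one
  have e := pow_χ_apply (((hy.hasChar_rootVec a3t2).pow D.N).eq_one h1 h0) (D.g 1)
  simp only [Fin.prod_univ_three, coord] at e
  change (D.q 1 0 ^ D.N) ^ 0 * (D.q 1 1 ^ D.N) ^ 1 * (D.q 1 2 ^ D.N) ^ 2 = 1 at e
  rwa [hB.q_eq.2.1, pow_right_comm (D.q 2 2), hq, one_pow, one_pow, pow_zero, one_mul, one_mul] at e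

theorem revVec32_pow (hy : L.IsLiftOfGenerators y) (hB : D.IsCartanB3) (hodd : Odd D.N)
    (h1 : L.HasChar 1 (D.rootVec y a32 ^ D.N)) : D.revVec32 y ^ D.N =
      HopfAlgebra.antipode k (D.rootVec y a32 ^ D.N) * L.grp (D.gRoot a32 ^ D.N) := by
  have hq : D.q 2 2 ^ D.N = 1 := isPrimitiveRoot_q.pow_eq_one
  have e := hy.hasChar_revVec32.pow_eq_antipode hodd (hy.antipode_a32 hB) (σ := 1)
    (by rw [← χRoot_a32, ← qRoot, qRoot_self_pow hB]) (by simp) (fun h0 => by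
      rw [inv_pow, mul_pow, pow_right_comm, hq, hy.q_pow_eq_one_of_a32 hB h1 h0]; simp)
  simpa using e

theorem revVec3t2_pow (hy : L.IsLiftOfGenerators y) (hB : D.IsCartanB3) (hodd : Odd D.N)
    (h1 : L.HasChar 1 (D.rootVec y a3t2 ^ D.N)) : D.revVec3t2 y ^ D.N =
      -(HopfAlgebra.antipode k (D.rootVec y a3t2 ^ D.N) * L.grp (D.gRoot a3t2 ^ D.N)) := by
  have hq : D.q 2 2 ^ D.N = 1 := isPrimitiveRoot_q.pow_eq_one
  have e := hy.hasChar_revVec3t2.pow_eq_antipode hodd (hy.antipode_a3t2 hB) (σ := -1)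
    (by rw [← χRoot_a3t2, ← qRoot, qRoot_self_pow hB]) (by simp) (fun h0 => by
      rw [inv_pow, hodd.neg_pow, mul_pow, pow_right_comm, hq, pow_right_comm (D.q 1 2),
        hy.q_pow_sq_eq_one_of_a3t2 hB h1 h0]
      norm_num)
  rw [e]
  norm_num

theorem cornerVec_pow [Finite Γ] (hy : L.IsLiftOfGenerators y) (hB : D.IsCartanB3)
    (hodd : Odd D.N) (hN : 5 < D.N) (h32 : L.HasChar 1 (D.rootVec y a32 ^ D.N))
    (h3t2 : L.HasChar 1 (D.rootVec y a3t2 ^ D.N)) : D.cornerVec y ^ D.N =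
      (D.ξ 2 ^ D.N) ^ 2 • (D.rootVec y a2 ^ D.N * D.rootVec y a3t2 ^ D.N) -
        (D.ξ 1 ^ D.N * D.ξ 2 ^ D.N) • (D.rootVec y a32 ^ D.N) ^ 2 := by
  have e := (hy.isSerre hB hodd hN).cornerVec_pow hB hodd
  by_cases hz : D.rootVec y a32 ^ D.N = 0
  · rw [hz] at e ⊢
    rw [zero_pow two_ne_zero, smul_zero, add_zero] at e
    rw [zero_pow two_ne_zero, smul_zero, sub_zero, e]
    by_cases hz' : D.rootVec y a3t2 ^ D.N = 0
    · rw [hz', mul_zero, smul_zero] at e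
      rw [(smul_eq_zero.1 e.symm).resolve_left
        (pow_ne_zero _ (pow_ne_zero _ (D.q_ne_zero 1 2))), smul_zero]
    · obtain ⟨m, hm⟩ := hodd
      have e1 := hy.q_pow_sq_eq_one_of_a3t2 hB h3t2 hz'
      rw [show D.N - 1 = 2 * m by omega, pow_mul, e1, one_pow, one_smul]
  · rw [e, hy.q_pow_eq_one_of_a32 hB h32 hz, one_pow, one_smul, mul_one, add_sub_cancel_right]

end IsLiftOfGenerators
end Lifting
end YDDatum

/-! ### The deformed relations for the roots of height at most four -/

namespace YDDatum

open PosRoot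

namespace Lifting

variable {k Γ A : Type*} [Field k] [CommGroup Γ] {D : YDDatum k Γ (Fin 3)} [Ring A]
  [HopfAlgebra k A] {L : D.Lifting A}

theorem hasChar_grp_sub_one (c : k) (g : Γ) : L.HasChar 1 (c • (L.grp g - 1)) :=
  ((HasChar.grp g).sub HasChar.one).smul c

theorem HasChar.add_smul {χ : Γ →* kˣ} {x : A} {c d : k} (hc : L.HasChar χ (c • x))
    (hd : L.HasChar χ (d • x)) : L.HasChar χ ((c + d) • x) := by
  rw [_root_.add_smul]
  exact hc.add hd

/-- If `γ = m α + m' α' + β` and the `N`-th powers of the characters of `α` and `α'` are trivial,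
then those of `β` and `γ` agree. -/
theorem χRoot_pow_eq {α α' β γ : PosRoot} {N : ℕ} (m m' : ℕ)
    (h : ∀ i, γ.coord i = m * α.coord i + m' * α'.coord i + β.coord i)
    (hα : D.χRoot α ^ N = 1) (hα' : D.χRoot α' ^ N = 1) : D.χRoot β ^ N = D.χRoot γ ^ N := by
  ext g
  have e := IsLiftOfGenerators.pow_χ_apply hα g
  have e' := IsLiftOfGenerators.pow_χ_apply hα' g
  rw [MonoidHom.pow_apply, MonoidHom.pow_apply, Units.val_pow_eq_pow_val, Units.val_pow_eq_pow_val,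
    χRoot_apply, χRoot_apply, ← Finset.prod_pow, ← Finset.prod_pow]
  calc ∏ i, ((D.χ i g : k) ^ β.coord i) ^ N = (∏ i, ((D.χ i g : k) ^ N) ^ α.coord i) ^ m *
        (∏ i, ((D.χ i g : k) ^ N) ^ α'.coord i) ^ m' * ∏ i, ((D.χ i g : k) ^ β.coord i) ^ N := by
        rw [e, e', one_pow, one_pow, one_mul, one_mul]
    _ = ∏ i, ((D.χ i g : k) ^ γ.coord i) ^ N := by
        rw [← Finset.prod_pow, ← Finset.prod_pow, ← Finset.prod_mul_distrib,
          ← Finset.prod_mul_distrib]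
        refine Finset.prod_congr rfl fun i _ => ?_
        rw [h i]
        ring

namespace IsLiftOfGenerators

variable {y : Fin 3 → A}

theorem exists_a1 [Finite Γ] (hy : L.IsLiftOfGenerators y) (hB : D.IsCartanB3) (hodd : Odd D.N)
    (hN : 5 < D.N) : ∃ d : k, D.rootVec y a1 ^ D.N = d • (L.grp (D.gRoot a1 ^ D.N) - 1) ∧
      (D.gRoot a1 ^ D.N = 1 ∨ D.χRoot a1 ^ D.N ≠ 1 → d = 0) :=
  hy.eq_smul_of_comul hB hN (hy.comul_pow_a1 hB hodd) ((hy.hasChar_rootVec a1).pow _)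

theorem exists_a2 [Finite Γ] (hy : L.IsLiftOfGenerators y) (hB : D.IsCartanB3) (hodd : Odd D.N)
    (hN : 5 < D.N) : ∃ d : k, D.rootVec y a2 ^ D.N = d • (L.grp (D.gRoot a2 ^ D.N) - 1) ∧
      (D.gRoot a2 ^ D.N = 1 ∨ D.χRoot a2 ^ D.N ≠ 1 → d = 0) :=
  hy.eq_smul_of_comul hB hN (hy.comul_pow_a2 hB hodd) ((hy.hasChar_rootVec a2).pow _)

theorem exists_a3 [Finite Γ] (hy : L.IsLiftOfGenerators y) (hB : D.IsCartanB3) (hodd : Odd D.N)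
    (hN : 5 < D.N) : ∃ d : k, D.rootVec y a3 ^ D.N = d • (L.grp (D.gRoot a3 ^ D.N) - 1) ∧
      (D.gRoot a3 ^ D.N = 1 ∨ D.χRoot a3 ^ D.N ≠ 1 → d = 0) :=
  hy.eq_smul_of_comul hB hN (hy.comul_pow_a3 hodd) ((hy.hasChar_rootVec a3).pow _)

theorem exists_a21 [Finite Γ] (hy : L.IsLiftOfGenerators y) (hB : D.IsCartanB3) (hodd : Odd D.N)
    (hN : 5 < D.N) {m2 : k} (r2 : D.rootVec y a2 ^ D.N = m2 • (L.grp (D.gRoot a2 ^ D.N) - 1))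
    (c2 : m2 ≠ 0 → D.χRoot a2 ^ D.N = 1) :
    ∃ d : k, D.rootVec y a21 ^ D.N = d • (L.grp (D.gRoot a21 ^ D.N) - 1)
        - (D.ξ 2 ^ D.N * m2) • D.rootVec y a1 ^ D.N ∧
      (D.gRoot a21 ^ D.N = 1 ∨ D.χRoot a21 ^ D.N ≠ 1 → d = 0) := by
  have h2 : L.HasChar 1 (D.rootVec y a2 ^ D.N) := r2 ▸ hasChar_grp_sub_one _ _
  obtain ⟨d, hd, hd'⟩ := hy.eq_smul_of_comul hB hN (α := a21)
    (x := D.rootVec y a21 ^ D.N + (D.ξ 2 ^ D.N * m2) • D.rootVec y a1 ^ D.N) (by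
      rw [map_add, map_smul, hy.comul_pow_a21 hB hodd hN h2, hy.comul_pow_a1 hB hodd, r2]
      simp only [gRoot_a21, mul_pow, sub_mul, one_mul, smul_mul_assoc, ← L.grp_mul, mul_comm,
        TensorProduct.add_tmul, TensorProduct.sub_tmul,
        ← TensorProduct.smul_tmul', TensorProduct.tmul_add, TensorProduct.tmul_smul]
      module)
    (((hy.hasChar_rootVec a21).pow _).add (((hy.hasChar_rootVec a1).pow _).smul_of_ne fun h =>
      χRoot_pow_eq (α := a2) (α' := a2) 1 0 (by decide) (c2 (right_ne_zero_of_mul h))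
        (c2 (right_ne_zero_of_mul h))))
  exact ⟨d, eq_sub_of_add_eq hd, hd'⟩

theorem exists_a32 [Finite Γ] (hy : L.IsLiftOfGenerators y) (hB : D.IsCartanB3) (hodd : Odd D.N)
    (hN : 5 < D.N) {m3 : k} (r3 : D.rootVec y a3 ^ D.N = m3 • (L.grp (D.gRoot a3 ^ D.N) - 1))
    (c3 : m3 ≠ 0 → D.χRoot a3 ^ D.N = 1) :
    ∃ d : k, D.rootVec y a32 ^ D.N = d • (L.grp (D.gRoot a32 ^ D.N) - 1)
        - (D.ξ 2 ^ D.N * m3) • D.rootVec y a2 ^ D.N ∧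
      (D.gRoot a32 ^ D.N = 1 ∨ D.χRoot a32 ^ D.N ≠ 1 → d = 0) := by
  have h3 : L.HasChar 1 (D.rootVec y a3 ^ D.N) := r3 ▸ hasChar_grp_sub_one _ _
  obtain ⟨d, hd, hd'⟩ := hy.eq_smul_of_comul hB hN (α := a32)
    (x := D.rootVec y a32 ^ D.N + (D.ξ 2 ^ D.N * m3) • D.rootVec y a2 ^ D.N) (by
      rw [map_add, map_smul, hy.comul_pow_a32 hB hodd hN h3, hy.comul_pow_a2 hB hodd, r3]
      simp only [gRoot_a32, mul_pow, sub_mul, one_mul, smul_mul_assoc, ← L.grp_mul, mul_comm,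
        TensorProduct.add_tmul, TensorProduct.sub_tmul,
        ← TensorProduct.smul_tmul', TensorProduct.tmul_add, TensorProduct.tmul_smul]
      module)
    (((hy.hasChar_rootVec a32).pow _).add (((hy.hasChar_rootVec a2).pow _).smul_of_ne fun h =>
      χRoot_pow_eq (α := a3) (α' := a3) 1 0 (by decide) (c3 (right_ne_zero_of_mul h))
        (c3 (right_ne_zero_of_mul h))))
  exact ⟨d, eq_sub_of_add_eq hd, hd'⟩

theorem exists_a31 [Finite Γ] (hy : L.IsLiftOfGenerators y) (hB : D.IsCartanB3) (hodd : Odd D.N)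
    (hN : 5 < D.N) {m2 m3 m32 : k}
    (r2 : D.rootVec y a2 ^ D.N = m2 • (L.grp (D.gRoot a2 ^ D.N) - 1))
    (r3 : D.rootVec y a3 ^ D.N = m3 • (L.grp (D.gRoot a3 ^ D.N) - 1))
    (r32 : D.rootVec y a32 ^ D.N = m32 • (L.grp (D.gRoot a32 ^ D.N) - 1)
        - (D.ξ 2 ^ D.N * m3) • D.rootVec y a2 ^ D.N)
    (c3 : m3 ≠ 0 → D.χRoot a3 ^ D.N = 1) (c32 : m32 ≠ 0 → D.χRoot a32 ^ D.N = 1) :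
    ∃ d : k, D.rootVec y a31 ^ D.N = d • (L.grp (D.gRoot a31 ^ D.N) - 1)
        - (D.ξ 2 ^ D.N * m3) • D.rootVec y a21 ^ D.N
        - (D.ξ 2 ^ D.N * m32) • D.rootVec y a1 ^ D.N ∧
      (D.gRoot a31 ^ D.N = 1 ∨ D.χRoot a31 ^ D.N ≠ 1 → d = 0) := by
  have h2 : L.HasChar 1 (D.rootVec y a2 ^ D.N) := r2 ▸ hasChar_grp_sub_one _ _
  have h3 : L.HasChar 1 (D.rootVec y a3 ^ D.N) := r3 ▸ hasChar_grp_sub_one _ _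
  have h32 : L.HasChar 1 (D.rootVec y a32 ^ D.N) :=
    r32 ▸ (hasChar_grp_sub_one _ _).sub (h2.smul _)
  obtain ⟨d, hd, hd'⟩ := hy.eq_smul_of_comul hB hN (α := a31)
    (x := D.rootVec y a31 ^ D.N + (D.ξ 2 ^ D.N * m32) • D.rootVec y a1 ^ D.N +
      (D.ξ 2 ^ D.N * m3) • D.rootVec y a21 ^ D.N) (by
      rw [map_add, map_add, map_smul, map_smul, hy.comul_pow_a31 hB hodd hN h3 h32,
        hy.comul_pow_a21 hB hodd hN h2, hy.comul_pow_a1 hB hodd, r32, r3, r2]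
      simp only [gRoot_a31, gRoot_a32, gRoot_a21, mul_pow, sub_mul, one_mul, smul_mul_assoc,
        ← L.grp_mul, mul_comm, mul_assoc, TensorProduct.add_tmul,
        TensorProduct.sub_tmul, ← TensorProduct.smul_tmul', TensorProduct.tmul_add,
        TensorProduct.tmul_smul]
      module)
    ((((hy.hasChar_rootVec a31).pow _).add (((hy.hasChar_rootVec a1).pow _).smul_of_ne fun h =>
      χRoot_pow_eq (α := a32) (α' := a32) 1 0 (by decide) (c32 (right_ne_zero_of_mul h))
        (c32 (right_ne_zero_of_mul h)))).add (((hy.hasChar_rootVec a21).pow _).smul_of_ne fun h =>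
      χRoot_pow_eq (α := a3) (α' := a3) 1 0 (by decide) (c3 (right_ne_zero_of_mul h))
        (c3 (right_ne_zero_of_mul h))))
  exact ⟨d, by rw [← hd]; abel, hd'⟩

theorem exists_a3t2 [Finite Γ] (hy : L.IsLiftOfGenerators y) (hB : D.IsCartanB3) (hodd : Odd D.N)
    (hN : 5 < D.N) {m3 : k} (r3 : D.rootVec y a3 ^ D.N = m3 • (L.grp (D.gRoot a3 ^ D.N) - 1))
    (c3 : m3 ≠ 0 → D.χRoot a3 ^ D.N = 1) :
    ∃ d : k, D.rootVec y a3t2 ^ D.N = d • (L.grp (D.gRoot a3t2 ^ D.N) - 1)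
        - (2 * D.ξ 1 ^ D.N * m3) • D.rootVec y a32 ^ D.N
        - (D.ξ 1 ^ D.N * D.ξ 2 ^ D.N * m3 ^ 2) • D.rootVec y a2 ^ D.N ∧
      (D.gRoot a3t2 ^ D.N = 1 ∨ D.χRoot a3t2 ^ D.N ≠ 1 → d = 0) := by
  have h3 : L.HasChar 1 (D.rootVec y a3 ^ D.N) := r3 ▸ hasChar_grp_sub_one _ _
  have c3' : ∀ {c : k}, c * m3 ^ 2 ≠ 0 → D.χRoot a3 ^ D.N = 1 := fun h =>
    c3 (ne_zero_pow two_ne_zero (right_ne_zero_of_mul h))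
  obtain ⟨d, hd, hd'⟩ := hy.eq_smul_of_comul hB hN (α := a3t2)
    (x := D.rootVec y a3t2 ^ D.N + (D.ξ 1 ^ D.N * D.ξ 2 ^ D.N * m3 ^ 2) • D.rootVec y a2 ^ D.N +
      (2 * D.ξ 1 ^ D.N * m3) • D.rootVec y a32 ^ D.N) (by
      rw [map_add, map_add, map_smul, map_smul, hy.comul_pow_a3t2 hB hodd hN h3,
        hy.comul_pow_a32 hB hodd hN h3, hy.comul_pow_a2 hB hodd, r3]
      simp only [gRoot_a3t2, gRoot_a32, mul_pow, sub_mul, mul_sub, mul_one, one_mul,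
        smul_mul_assoc, mul_smul_comm, ← L.grp_mul, mul_comm, mul_left_comm,
        TensorProduct.add_tmul, TensorProduct.sub_tmul, ← TensorProduct.smul_tmul',
        TensorProduct.tmul_add, TensorProduct.tmul_smul, smul_sub]
      module)
    ((((hy.hasChar_rootVec a3t2).pow _).add (((hy.hasChar_rootVec a2).pow _).smul_of_ne fun h =>
      χRoot_pow_eq (α := a3) (α' := a3) 2 0 (by decide) (c3' h) (c3' h))).add
      (((hy.hasChar_rootVec a32).pow _).smul_of_ne fun h =>
      χRoot_pow_eq (α := a3) (α' := a3) 1 0 (by decide) (c3 (right_ne_zero_of_mul h))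
        (c3 (right_ne_zero_of_mul h))))
  exact ⟨d, by rw [← hd]; abel, hd'⟩

theorem exists_a3t1 [Finite Γ] (hy : L.IsLiftOfGenerators y) (hB : D.IsCartanB3) (hodd : Odd D.N)
    (hN : 5 < D.N) {m2 m3 m32 m3t2 : k}
    (r2 : D.rootVec y a2 ^ D.N = m2 • (L.grp (D.gRoot a2 ^ D.N) - 1))
    (r3 : D.rootVec y a3 ^ D.N = m3 • (L.grp (D.gRoot a3 ^ D.N) - 1))
    (r32 : D.rootVec y a32 ^ D.N = m32 • (L.grp (D.gRoot a32 ^ D.N) - 1)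
        - (D.ξ 2 ^ D.N * m3) • D.rootVec y a2 ^ D.N)
    (r3t2 : D.rootVec y a3t2 ^ D.N = m3t2 • (L.grp (D.gRoot a3t2 ^ D.N) - 1)
        - (2 * D.ξ 1 ^ D.N * m3) • D.rootVec y a32 ^ D.N
        - (D.ξ 1 ^ D.N * D.ξ 2 ^ D.N * m3 ^ 2) • D.rootVec y a2 ^ D.N)
    (c3 : m3 ≠ 0 → D.χRoot a3 ^ D.N = 1) (c3t2 : m3t2 ≠ 0 → D.χRoot a3t2 ^ D.N = 1) :
    ∃ d : k, D.rootVec y a3t1 ^ D.N = d • (L.grp (D.gRoot a3t1 ^ D.N) - 1)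
        - (2 * D.ξ 1 ^ D.N * m3) • D.rootVec y a31 ^ D.N
        - (D.ξ 1 ^ D.N * D.ξ 2 ^ D.N * m3 ^ 2) • D.rootVec y a21 ^ D.N
        - (D.ξ 2 ^ D.N * m3t2) • D.rootVec y a1 ^ D.N ∧
      (D.gRoot a3t1 ^ D.N = 1 ∨ D.χRoot a3t1 ^ D.N ≠ 1 → d = 0) := by
  have h2 : L.HasChar 1 (D.rootVec y a2 ^ D.N) := r2 ▸ hasChar_grp_sub_one _ _
  have h3 : L.HasChar 1 (D.rootVec y a3 ^ D.N) := r3 ▸ hasChar_grp_sub_one _ _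
  have h32 : L.HasChar 1 (D.rootVec y a32 ^ D.N) :=
    r32 ▸ (hasChar_grp_sub_one _ _).sub (h2.smul _)
  have h3t2 : L.HasChar 1 (D.rootVec y a3t2 ^ D.N) :=
    r3t2 ▸ ((hasChar_grp_sub_one _ _).sub (h32.smul _)).sub (h2.smul _)
  have c3' : ∀ {c : k}, c * m3 ^ 2 ≠ 0 → D.χRoot a3 ^ D.N = 1 := fun h =>
    c3 (ne_zero_pow two_ne_zero (right_ne_zero_of_mul h))
  obtain ⟨d, hd, hd'⟩ := hy.eq_smul_of_comul hB hN (α := a3t1)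
    (x := D.rootVec y a3t1 ^ D.N + (D.ξ 2 ^ D.N * m3t2) • D.rootVec y a1 ^ D.N +
      (D.ξ 1 ^ D.N * D.ξ 2 ^ D.N * m3 ^ 2) • D.rootVec y a21 ^ D.N +
      (2 * D.ξ 1 ^ D.N * m3) • D.rootVec y a31 ^ D.N) (by
      rw [map_add, map_add, map_add, map_smul, map_smul, map_smul,
        hy.comul_pow_a3t1 hB hodd hN h3 h3t2, hy.comul_pow_a31 hB hodd hN h3 h32,
        hy.comul_pow_a21 hB hodd hN h2, hy.comul_pow_a1 hB hodd, r3t2, r32, r3, r2]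
      simp only [gRoot_a3t1, gRoot_a31, gRoot_a21, gRoot_a3t2, gRoot_a32, mul_pow, sub_mul, mul_sub,
        mul_one, one_mul, smul_mul_assoc, mul_smul_comm, ← L.grp_mul, mul_comm, mul_left_comm,
        mul_assoc, TensorProduct.add_tmul, TensorProduct.sub_tmul, ← TensorProduct.smul_tmul',
        TensorProduct.tmul_add, TensorProduct.tmul_smul, smul_sub]
      module)
    (((((hy.hasChar_rootVec a3t1).pow _).add (((hy.hasChar_rootVec a1).pow _).smul_of_ne fun h =>
      χRoot_pow_eq (α := a3t2) (α' := a3t2) 1 0 (by decide) (c3t2 (right_ne_zero_of_mul h))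
        (c3t2 (right_ne_zero_of_mul h)))).add (((hy.hasChar_rootVec a21).pow _).smul_of_ne fun h =>
      χRoot_pow_eq (α := a3) (α' := a3) 2 0 (by decide) (c3' h) (c3' h))).add
      (((hy.hasChar_rootVec a31).pow _).smul_of_ne fun h =>
      χRoot_pow_eq (α := a3) (α' := a3) 1 0 (by decide) (c3 (right_ne_zero_of_mul h))
        (c3 (right_ne_zero_of_mul h))))
  exact ⟨d, by rw [← hd]; abel, hd'⟩

end IsLiftOfGenerators
end Lifting
end YDDatum

/-! ### The deformed relation for the root of height five -/

namespace YDDatum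

open PosRoot

namespace Lifting

variable {k Γ A : Type*} [Field k] [CommGroup Γ] {D : YDDatum k Γ (Fin 3)} [Ring A]
  [HopfAlgebra k A] {L : D.Lifting A}

namespace IsLiftOfGenerators

variable {y : Fin 3 → A}

theorem antipode_smul_grp_sub_one_mul (c : k) (g h : Γ) :
    HopfAlgebra.antipode k (c • (L.grp g - 1)) * L.grp (g * h) =
      c • (L.grp h - L.grp (g * h)) := by
  rw [map_smul, map_sub, L.antipode_grp, HopfAlgebra.antipode_one, smul_mul_assoc, sub_mul, one_mul,
    ← L.grp_mul, inv_mul_cancel_left]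

/-- The `N`-th power of the opposite root vector of `α₂ + α₃` in the group algebra. -/
theorem revVec32_pow_eq (hy : L.IsLiftOfGenerators y) (hB : D.IsCartanB3) (hodd : Odd D.N)
    {m2 m3 m32 : k}
    (r2 : D.rootVec y a2 ^ D.N = m2 • (L.grp (D.gRoot a2 ^ D.N) - 1))
    (r32 : D.rootVec y a32 ^ D.N = m32 • (L.grp (D.gRoot a32 ^ D.N) - 1)
        - (D.ξ 2 ^ D.N * m3) • D.rootVec y a2 ^ D.N) :
    D.revVec32 y ^ D.N = (D.ξ 2 ^ D.N * m2 * m3 - m32) • (L.grp (D.gRoot a32 ^ D.N) - 1) -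
      (D.ξ 2 ^ D.N * m2 * m3) • (L.grp (D.gRoot a3 ^ D.N) - 1) := by
  have h2 : L.HasChar 1 (D.rootVec y a2 ^ D.N) := r2 ▸ hasChar_grp_sub_one _ _
  have h32 : L.HasChar 1 (D.rootVec y a32 ^ D.N) :=
    r32 ▸ (hasChar_grp_sub_one _ _).sub (h2.smul _)
  have e2 := antipode_smul_grp_sub_one_mul (L := L) m2 (D.gRoot a2 ^ D.N) (D.gRoot a3 ^ D.N)
  have e32 := antipode_smul_grp_sub_one_mul (L := L) m32 (D.gRoot a32 ^ D.N) 1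
  have g : D.gRoot a2 ^ D.N * D.gRoot a3 ^ D.N = D.gRoot a32 ^ D.N := by
    rw [gRoot_a32, mul_pow, mul_comm]
  rw [g] at e2
  rw [mul_one, L.grp_one] at e32
  rw [hy.revVec32_pow hB hodd h32, r32, r2, map_sub, map_smul _ (D.ξ 2 ^ D.N * m3), sub_mul,
    smul_mul_assoc, e2, e32]
  module

/-- The `N`-th power of the opposite root vector of `α₂ + 2α₃` in the group algebra. -/
theorem revVec3t2_pow_eq (hy : L.IsLiftOfGenerators y) (hB : D.IsCartanB3) (hodd : Odd D.N)
    {m2 m3 m32 m3t2 : k}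
    (r2 : D.rootVec y a2 ^ D.N = m2 • (L.grp (D.gRoot a2 ^ D.N) - 1))
    (r32 : D.rootVec y a32 ^ D.N = m32 • (L.grp (D.gRoot a32 ^ D.N) - 1)
        - (D.ξ 2 ^ D.N * m3) • D.rootVec y a2 ^ D.N)
    (r3t2 : D.rootVec y a3t2 ^ D.N = m3t2 • (L.grp (D.gRoot a3t2 ^ D.N) - 1)
        - (2 * D.ξ 1 ^ D.N * m3) • D.rootVec y a32 ^ D.N
        - (D.ξ 1 ^ D.N * D.ξ 2 ^ D.N * m3 ^ 2) • D.rootVec y a2 ^ D.N) :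
    D.revVec3t2 y ^ D.N = m3t2 • (L.grp (D.gRoot a3t2 ^ D.N) - 1) +
      (2 * D.ξ 1 ^ D.N * m3 * m32) • (L.grp (D.gRoot a3 ^ D.N) - L.grp (D.gRoot a3t2 ^ D.N)) -
      (D.ξ 1 ^ D.N * D.ξ 2 ^ D.N * m2 * m3 ^ 2) •
        (L.grp (D.gRoot a3 ^ D.N * D.gRoot a3 ^ D.N) - L.grp (D.gRoot a3t2 ^ D.N)) := by
  have h2 : L.HasChar 1 (D.rootVec y a2 ^ D.N) := r2 ▸ hasChar_grp_sub_one _ _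
  have h32 : L.HasChar 1 (D.rootVec y a32 ^ D.N) :=
    r32 ▸ (hasChar_grp_sub_one _ _).sub (h2.smul _)
  have h3t2 : L.HasChar 1 (D.rootVec y a3t2 ^ D.N) :=
    r3t2 ▸ ((hasChar_grp_sub_one _ _).sub (h32.smul _)).sub (h2.smul _)
  have e2 := antipode_smul_grp_sub_one_mul (L := L) m2 (D.gRoot a2 ^ D.N)
    (D.gRoot a3 ^ D.N * D.gRoot a3 ^ D.N)
  have e32 := antipode_smul_grp_sub_one_mul (L := L) m32 (D.gRoot a32 ^ D.N) (D.gRoot a3 ^ D.N)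
  have e3t2 := antipode_smul_grp_sub_one_mul (L := L) m3t2 (D.gRoot a3t2 ^ D.N) 1
  have g : D.gRoot a2 ^ D.N * (D.gRoot a3 ^ D.N * D.gRoot a3 ^ D.N) = D.gRoot a3t2 ^ D.N := by
    rw [gRoot_a3t2, gRoot_a32, mul_pow, mul_pow, mul_left_comm, mul_comm (D.gRoot a2 ^ D.N)]
  have g' : D.gRoot a32 ^ D.N * D.gRoot a3 ^ D.N = D.gRoot a3t2 ^ D.N := by
    rw [gRoot_a3t2, mul_pow, mul_comm]
  rw [g] at e2
  rw [g'] at e32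
  rw [mul_one, L.grp_one] at e3t2
  rw [hy.revVec3t2_pow hB hodd h3t2, r3t2, r32, r2, map_sub, map_sub,
    map_smul _ (2 * D.ξ 1 ^ D.N * m3), map_sub, map_smul _ (D.ξ 2 ^ D.N * m3),
    map_smul _ (D.ξ 1 ^ D.N * D.ξ 2 ^ D.N * m3 ^ 2), sub_mul, sub_mul, smul_mul_assoc, sub_mul,
    smul_mul_assoc, smul_mul_assoc, e2, e32, e3t2]
  module

/-- The four lower terms have the character of the leading one: a parameter that occurs with a
nonzero coefficient belongs to a root whose character has trivial `N`-th power. -/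
theorem hasChar_sum_a2t1 (hy : L.IsLiftOfGenerators y) {μ : PosRoot → k}
    (c : ∀ α, α ≠ a2t1 → μ α ≠ 0 → D.χRoot α ^ D.N = 1) :
    L.HasChar (D.χRoot a2t1 ^ D.N) (D.rootVec y a2t1 ^ D.N +
      D.lam1 μ • D.rootVec y a1 ^ D.N + D.lam21 μ • D.rootVec y a21 ^ D.N +
      D.lam31 μ • D.rootVec y a31 ^ D.N + D.lam3t1 μ • D.rootVec y a3t1 ^ D.N) := by
  have c2 := c a2 nofun
  have c3 := c a3 nofun
  have c32 := c a32 nofun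
  have c3t2 := c a3t2 nofun
  have z : ∀ α, L.HasChar (D.χRoot α ^ D.N) (D.rootVec y α ^ D.N) :=
    fun α => (hy.hasChar_rootVec α).pow _
  have t1 : L.HasChar (D.χRoot a2t1 ^ D.N) (D.lam1 μ • D.rootVec y a1 ^ D.N) := by
    rw [lam1, mul_sub, sub_eq_add_neg]
    refine HasChar.add_smul ((z a1).smul_of_ne fun h => ?_) ((z a1).smul_of_ne fun h => ?_)
    · refine χRoot_pow_eq (α := a2) (α' := a3t2) 1 1 (by decide) (c2 ?_) (c3t2 ?_) <;>
      · intro h0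
        simp [h0] at h
    · refine χRoot_pow_eq (α := a32) (α' := a32) 2 0 (by decide) (c32 ?_) (c32 ?_) <;>
      · intro h0
        simp [h0] at h
  have t21 : L.HasChar (D.χRoot a2t1 ^ D.N) (D.lam21 μ • D.rootVec y a21 ^ D.N) := by
    rw [lam21, mul_add, mul_sub, sub_eq_add_neg]
    refine HasChar.add_smul (HasChar.add_smul ((z a21).smul_of_ne fun h => ?_)
      ((z a21).smul_of_ne fun h => ?_)) ((z a21).smul_of_ne fun h => ?_)
    · refine χRoot_pow_eq (α := a2) (α' := a3) 1 2 (by decide) (c2 ?_) (c3 ?_) <;>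
      · intro h0
        simp [h0] at h
    · refine χRoot_pow_eq (α := a3) (α' := a32) 1 1 (by decide) (c3 ?_) (c32 ?_) <;>
      · intro h0
        simp [h0] at h
    · refine χRoot_pow_eq (α := a3t2) (α' := a3t2) 1 0 (by decide) (c3t2 ?_) (c3t2 ?_) <;>
      · intro h0
        simp [h0] at h
  have t31 : L.HasChar (D.χRoot a2t1 ^ D.N) (D.lam31 μ • D.rootVec y a31 ^ D.N) := by
    rw [lam31, mul_sub, sub_eq_add_neg]
    refine HasChar.add_smul ((z a31).smul_of_ne fun h => ?_) ((z a31).smul_of_ne fun h => ?_)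
    · refine χRoot_pow_eq (α := a2) (α' := a3) 1 1 (by decide) (c2 ?_) (c3 ?_) <;>
      · intro h0
        simp [h0] at h
    · refine χRoot_pow_eq (α := a32) (α' := a32) 1 0 (by decide) (c32 ?_) (c32 ?_) <;>
      · intro h0
        simp [h0] at h
  have t3t1 : L.HasChar (D.χRoot a2t1 ^ D.N) (D.lam3t1 μ • D.rootVec y a3t1 ^ D.N) := by
    refine (z a3t1).smul_of_ne fun h => ?_
    have h2 := c2 (right_ne_zero_of_mul h)
    exact χRoot_pow_eq (α := a2) (α' := a2) 1 0 (by decide) h2 h2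
  exact ((((z a2t1).add t1).add t21).add t31).add t3t1

theorem exists_a2t1 [Finite Γ] (hy : L.IsLiftOfGenerators y) (hB : D.IsCartanB3) (hodd : Odd D.N)
    (hN : 5 < D.N) {μ : PosRoot → k}
    (r2 : D.rootVec y a2 ^ D.N = μ a2 • (L.grp (D.gRoot a2 ^ D.N) - 1))
    (r3 : D.rootVec y a3 ^ D.N = μ a3 • (L.grp (D.gRoot a3 ^ D.N) - 1))
    (r32 : D.rootVec y a32 ^ D.N = μ a32 • (L.grp (D.gRoot a32 ^ D.N) - 1)
        - (D.ξ 2 ^ D.N * μ a3) • D.rootVec y a2 ^ D.N)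
    (r3t2 : D.rootVec y a3t2 ^ D.N = μ a3t2 • (L.grp (D.gRoot a3t2 ^ D.N) - 1)
        - (2 * D.ξ 1 ^ D.N * μ a3) • D.rootVec y a32 ^ D.N
        - (D.ξ 1 ^ D.N * D.ξ 2 ^ D.N * μ a3 ^ 2) • D.rootVec y a2 ^ D.N)
    (c : ∀ α, α ≠ a2t1 → μ α ≠ 0 → D.χRoot α ^ D.N = 1) :
    ∃ d : k, D.rootVec y a2t1 ^ D.N = d • (L.grp (D.gRoot a2t1 ^ D.N) - 1)
        - D.lam3t1 μ • D.rootVec y a3t1 ^ D.N - D.lam31 μ • D.rootVec y a31 ^ D.N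
        - D.lam21 μ • D.rootVec y a21 ^ D.N - D.lam1 μ • D.rootVec y a1 ^ D.N ∧
      (D.gRoot a2t1 ^ D.N = 1 ∨ D.χRoot a2t1 ^ D.N ≠ 1 → d = 0) := by
  have h2 : L.HasChar 1 (D.rootVec y a2 ^ D.N) := r2 ▸ hasChar_grp_sub_one _ _
  have h3 : L.HasChar 1 (D.rootVec y a3 ^ D.N) := r3 ▸ hasChar_grp_sub_one _ _
  have h32 : L.HasChar 1 (D.rootVec y a32 ^ D.N) :=
    r32 ▸ (hasChar_grp_sub_one _ _).sub (h2.smul _)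
  have h3t2 : L.HasChar 1 (D.rootVec y a3t2 ^ D.N) :=
    r3t2 ▸ ((hasChar_grp_sub_one _ _).sub (h32.smul _)).sub (h2.smul _)
  -- the `N`-th powers of the coefficients in `Δ(y_{α₁+2α₂+2α₃})` lie in the group algebra
  have e32 := hy.revVec32_pow_eq hB hodd r2 r32
  have e3t2 := hy.revVec3t2_pow_eq hB hodd r2 r32 r3t2
  have ec := hy.cornerVec_pow hB hodd hN h32 h3t2
  have k32 : L.HasChar 1 (D.revVec32 y ^ D.N) :=
    e32 ▸ (hasChar_grp_sub_one _ _).sub (hasChar_grp_sub_one _ _)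
  have k3t2 : L.HasChar 1 (D.revVec3t2 y ^ D.N) :=
    e3t2 ▸ ((hasChar_grp_sub_one _ _).add (((HasChar.grp _).sub (HasChar.grp _)).smul _)).sub
      (((HasChar.grp _).sub (HasChar.grp _)).smul _)
  have kc : L.HasChar 1 (D.cornerVec y ^ D.N) := by
    rw [ec, pow_two (D.rootVec y a32 ^ D.N)]
    exact ((h2.mul_one_char h3t2).smul _).sub ((h32.mul_one_char h32).smul _)
  obtain ⟨d, hd, hd'⟩ := hy.eq_smul_of_comul hB hN (α := a2t1) (by
      rw [map_add, map_add, map_add, map_add, map_smul, map_smul, map_smul, map_smul,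
        hy.comul_pow_a2t1 hB hodd hN h2 k32 k3t2 kc, hy.comul_pow_a3t1 hB hodd hN h3 h3t2,
        hy.comul_pow_a31 hB hodd hN h3 h32,
        hy.comul_pow_a21 hB hodd hN h2, hy.comul_pow_a1 hB hodd, ec, e3t2, e32, r3t2, r32, r3, r2]
      simp only [lam1, lam21, lam31, lam3t1, gRoot_a2t1, gRoot_a3t1, gRoot_a31, gRoot_a21,
        gRoot_a3t2, gRoot_a32, mul_pow, pow_two (_ - _ : A), sub_mul, mul_sub, add_mul,
        mul_one, one_mul, smul_mul_assoc, mul_smul_comm, ← L.grp_mul, mul_comm, mul_left_comm,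
        mul_assoc, TensorProduct.add_tmul, TensorProduct.sub_tmul, ← TensorProduct.smul_tmul',
        TensorProduct.tmul_add, TensorProduct.tmul_smul, smul_sub]
      module)
    (hy.hasChar_sum_a2t1 c)
  exact ⟨d, by rw [← hd]; abel, hd'⟩

end IsLiftOfGenerators
end Lifting
end YDDatum

theorem mainTheorem3 {k Γ A : Type*} [Field k] [IsAlgClosed k] [CharZero k]
    [CommGroup Γ] [Finite Γ] (D : YDDatum k Γ (Fin 3)) (hB3 : D.IsCartanB3)
    (hodd : Odd D.N) (hN : 5 < D.N) [Ring A] [HopfAlgebra k A]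
    (L : D.Lifting A) (y : Fin 3 → A) (hy : L.IsLiftOfGenerators y) :
    (∃ μ : PosRoot → k, L.IsLowerParameter y μ) ∧
    ∀ μ : PosRoot → k, L.IsLowerParameter y μ →
      ∃ ν : k,
        D.rootVec y .a2t1 ^ D.N = ν • (L.grp (D.gRoot .a2t1 ^ D.N) - 1)
          - D.lam3t1 μ • D.rootVec y .a3t1 ^ D.N - D.lam31 μ • D.rootVec y .a31 ^ D.N
          - D.lam21 μ • D.rootVec y .a21 ^ D.N - D.lam1 μ • D.rootVec y .a1 ^ D.N ∧
        (D.gRoot .a2t1 ^ D.N = 1 ∨ D.χRoot .a2t1 ^ D.N ≠ 1 → ν = 0) := by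
  have aux : ∀ {α : PosRoot} {m : k},
      (D.gRoot α ^ D.N = 1 ∨ D.χRoot α ^ D.N ≠ 1 → m = 0) → m ≠ 0 → D.χRoot α ^ D.N = 1 :=
    fun h hm => by_contra fun hχ => hm (h (Or.inr hχ))
  refine ⟨?_, fun μ hμ => hy.exists_a2t1 hB3 hodd hN hμ.rel2 hμ.rel3 hμ.rel32 hμ.rel3t2
    fun α hα => aux (hμ.vanish α hα)⟩
  obtain ⟨m1, r1, v1⟩ := hy.exists_a1 hB3 hodd hN
  obtain ⟨m2, r2, v2⟩ := hy.exists_a2 hB3 hodd hN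
  obtain ⟨m3, r3, v3⟩ := hy.exists_a3 hB3 hodd hN
  obtain ⟨m21, r21, v21⟩ := hy.exists_a21 hB3 hodd hN r2 (aux v2)
  obtain ⟨m32, r32, v32⟩ := hy.exists_a32 hB3 hodd hN r3 (aux v3)
  obtain ⟨m31, r31, v31⟩ := hy.exists_a31 hB3 hodd hN r2 r3 r32 (aux v3) (aux v32)
  obtain ⟨m3t2, r3t2, v3t2⟩ := hy.exists_a3t2 hB3 hodd hN r3 (aux v3)
  obtain ⟨m3t1, r3t1, v3t1⟩ := hy.exists_a3t1 hB3 hodd hN r2 r3 r32 r3t2 (aux v3) (aux v3t2)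
  let μ : PosRoot → k
    | .a1 => m1
    | .a2 => m2
    | .a3 => m3
    | .a21 => m21
    | .a32 => m32
    | .a31 => m31
    | .a3t2 => m3t2
    | .a3t1 => m3t1
    | .a2t1 => 0
  refine ⟨μ, ?_, r1, r2, r3, r21, r32, r31, r3t2, r3t1⟩
  intro α hα
  cases α
  exacts [v1, v2, v3, v21, v32, v31, v3t2, v3t1, absurd rfl hα]

end
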